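/- Let $\gamma\in\mathbb R$, $N\in\mathbb Z_{\ge 0}$, and let $J=[x^+,x^-]\subset\mathbb R$ be a bounded interval with $x^+<x^-$. For a permutation $w\in S_N$ and $f:\mathbb R^N\to\mathbb C$ put $(wf)(\boldsymbol x)=f(w^{-1}\boldsymbol x)$, where $(w\boldsymbol x)_{w(j)}=x_j$, and let $\mathbb R^N_+=\{\boldsymbol x: x_1>\dots>x_N\}$. *Wavefunctions.* On continuous functions on $\mathbb R^N$ let $(I_{jk}f)(\boldsymbol x)=\int_0^{x_j-x_k} f(\boldsymbol x-y(\boldsymbol e_j-\boldsymbol e_k))\,dy$, let $s_j$ be the transposition of $j$ and $j+1$, and let $s_j^\gamma=s_j+\gamma I_{j\,j+1}$ for $1\le j<N$. For $w=s_{i_1}\cdots s_{i_l}\in S_N$ put $w^\gamma=s_{i_1}^\gamma\cdots s_{i_l}^\gamma$ (this does not depend on the decomposition). For $\boldsymbol\lambda\in\mathbb C^N$ let $\psi_{\boldsymbol\lambda}$ be the continuous function on $\mathbb R^N$ that equals $w^{-1}w^\gamma e^{\mathrm i\boldsymbol\lambda}$ on $w^{-1}\mathbb R^N_+$ for every $w\in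 S_N$, where $e^{\mathrm i\boldsymbol\lambda}(\boldsymbol x)=e^{\mathrm i\sum_j\lambda_jx_j}$. Let $$\bar{\mathfrak z}_N=\overline{\operatorname{span}\{\psi_{\boldsymbol\lambda}|_{J^N}:\boldsymbol\lambda\in\mathbb C^N\}}\subset L^2(J^N).$$ *Operators.* For $0\le n\le N$, an $n$-tuple $\boldsymbol i=(i_1,\dots,i_n)$ of distinct elements of $\{1,\dots,N\}$, and $\mu\in\mathbb C$, define for $\boldsymbol x\in J^{N+1}$ $$(\hat e^{+}_{\mu;\boldsymbol i}f)(\boldsymbol x)=e^{\mathrm i\mu x_1}\,\mathbf 1_{\{x_{i_1+1}>\dots>x_{i_n+1}>x_1\}}\int e^{\mathrm i\mu\sum_{m}(x_{i_m+1}-y_m)}f(\boldsymbol x'_{\boldsymbol i\to\boldsymbol y})\,d\boldsymbol y,$$ $$(\hat e^{-}_{\mu;\boldsymbol i}f)(\boldsymbol x)=e^{\mathrm i\mu x_{N+1}}\,\mathbf 1_{\{x_{N+1}>x_{i_1}>\dots>x_{i_n}\}}\int e^{\mathrm i\mu\sum_{m}(x_{i_m}-y_m)}f(\boldsymbol x''_{\boldsymbol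 i\to\boldsymbol y})\,d\boldsymbol y,$$ where $\boldsymbol x'=(x_2,\dots,x_{N+1})$, $\boldsymbol x''=(x_1,\dots,x_N)$, the subscript $\boldsymbol i\to\boldsymbol y$ means that for each $m$ the $i_m$-th entry is replaced by $y_m$, and $y_m$ runs from $x_{i_{m+1}+1}$ to $x_{i_m+1}$ in the first formula (with $x_{i_{n+1}+1}$ read as $x_1$) and from $x_{i_m}$ to $x_{i_{m-1}}$ in the second (with $x_{i_0}$ read as $x_{N+1}$). Put $$b^\pm_\mu=\sum_{n=0}^N\gamma^n\sum_{\boldsymbol i}\hat e^\pm_{\mu;\boldsymbol i},\qquad (a^+_\mu f)(\boldsymbol x)=(b^+_\mu f)(x^+,\boldsymbol x),\qquad (a^-_\mu f)(\boldsymbol x)=(b^-_\mu f)(\boldsymbol x,x^-)\qquad(\boldsymbol x\in J^N).$$ These formulas define bounded operators $a^\pm_\mu$ on $L^2(J^N)$. **Theorem.** For $\epsilon=\pm$ and all $\mu,\nu\in\mathbb C$, the operators $a^\epsilon_\mu$ and $a^\epsilon_\nu$ map $\bar{\mathfrak z}_N$ into itself and commute on it: $$[a^\epsilon_\mu,a^\epsilon_\nu]=0\quad\text{in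 }\operatorname{End}(\bar{\mathfrak z}_N).$$ -/

import Mathlib

open MeasureTheory Filter
open scoped ENNReal NNReal

noncomputable section

namespace QNLS

/-! ### Integral-reflection operators, propagation operator, non-symmetric wavefunctions -/

/-- The left action of permutations on functions on `ℝ^N`: `(w f)(x) = f(w⁻¹ x)`, where
`(w x)_{w(j)} = x_j`, so that `w⁻¹ x = x ∘ w`. -/
def permAct {N : ℕ} (w : Equiv.Perm (Fin N)) (f : (Fin N → ℝ) → ℂ) : (Fin N → ℝ) → ℂ :=
  fun x => f (x ∘ w)

/-- `(I_{jk} f)(x) = ∫_0^{x_j - x_k} f(x - y (e_j - e_k)) dy`. -/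
def intOp {N : ℕ} (j k : Fin N) (f : (Fin N → ℝ) → ℂ) : (Fin N → ℝ) → ℂ :=
  fun x => ∫ y in (0 : ℝ)..(x j - x k),
    f (x - y • (Pi.single j (1 : ℝ) - Pi.single k (1 : ℝ)))

/-- Left index of the `j`-th adjacent pair. -/
def adjL {N : ℕ} (j : Fin (N - 1)) : Fin N := ⟨j, by omega⟩

/-- Right index of the `j`-th adjacent pair. -/
def adjR {N : ℕ} (j : Fin (N - 1)) : Fin N := ⟨j + 1, by omega⟩

/-- The simple transposition `s_j`. -/
def simpleSwap {N : ℕ} (j : Fin (N - 1)) : Equiv.Perm (Fin N) := Equiv.swap (adjL j) (adjR j)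

/-- The integral-reflection operator `s_j^γ = s_j + γ I_{j,j+1}`. -/
def intRefl {N : ℕ} (γ : ℝ) (j : Fin (N - 1)) (f : (Fin N → ℝ) → ℂ) : (Fin N → ℝ) → ℂ :=
  fun x => permAct (simpleSwap j) f x + (γ : ℂ) * intOp (adjL j) (adjR j) f x

/-- `s_{i_1}^γ ⋯ s_{i_l}^γ` for a word `[i_1, …, i_l]`. -/
def wordRefl {N : ℕ} (γ : ℝ) (l : List (Fin (N - 1))) (f : (Fin N → ℝ) → ℂ) :
    (Fin N → ℝ) → ℂ :=
  l.foldr (fun j g => intRefl γ j g) f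

theorem exists_word {N : ℕ} (w : Equiv.Perm (Fin N)) :
    ∃ l : List (Fin (N - 1)), (l.map simpleSwap).prod = w := by
  cases N with
  | zero => exact ⟨[], Subsingleton.elim _ _⟩
  | succ n =>
    have hw : w ∈ Submonoid.closure
        (Set.range fun i : Fin n => Equiv.swap i.castSucc i.succ) := by
      rw [Equiv.Perm.mclosure_swap_castSucc_succ]; trivial
    obtain ⟨l, hl, rfl⟩ := Submonoid.exists_list_of_mem_closure hw
    clear hw
    induction l with
    | nil => exact ⟨[], rfl⟩
    | cons a l ih =>
      obtain ⟨l', hl'⟩ := ih (fun y hy => hl y (List.mem_cons_of_mem _ hy))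
      obtain ⟨i, rfl⟩ := hl a List.mem_cons_self
      refine ⟨(i : Fin (n + 1 - 1)) :: l', ?_⟩
      rw [List.map_cons, List.prod_cons, List.prod_cons, hl']
      rfl

/-- `w^γ = s_{i_1}^γ ⋯ s_{i_l}^γ` for a decomposition `w = s_{i_1} ⋯ s_{i_l}` into simple
transpositions. On continuous functions the result does not depend on the decomposition, because
the `s_j^γ` satisfy the relations of the symmetric group there. -/
def permRefl {N : ℕ} (γ : ℝ) (w : Equiv.Perm (Fin N)) (f : (Fin N → ℝ) → ℂ) :
    (Fin N → ℝ) → ℂ :=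
  wordRefl γ (exists_word w).choose f

/-- A permutation `w` with `w x` in the closed fundamental chamber `x_1 ≥ ⋯ ≥ x_N`; it is the only
one when the coordinates of `x` are distinct. -/
def chamberPerm {N : ℕ} (x : Fin N → ℝ) : Equiv.Perm (Fin N) :=
  (Tuple.sort (fun j => -x j))⁻¹

theorem antitone_chamberPerm {N : ℕ} (x : Fin N → ℝ) :
    Antitone (fun j => x ((chamberPerm x)⁻¹ j)) := by
  intro a b hab
  have h := Tuple.monotone_sort (fun j => -x j) hab
  simp only [Function.comp] at h
  simp only [chamberPerm, inv_inv]
  linarith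

/-- The propagation operator: `P f = w⁻¹ w^γ f` on the chamber `w⁻¹ ℝ^N_+`. The value at a point
on a wall is taken from an adjacent chamber, which for continuous `f` is the continuous
extension. -/
def propagation {N : ℕ} (γ : ℝ) (f : (Fin N → ℝ) → ℂ) : (Fin N → ℝ) → ℂ :=
  fun x => permAct (chamberPerm x)⁻¹ (permRefl γ (chamberPerm x) f) x

/-- The plane wave `x ↦ exp(i ∑ λ_j x_j)`. -/
def planeWave {N : ℕ} (lam : Fin N → ℂ) : (Fin N → ℝ) → ℂ :=
  fun x => Complex.exp (Complex.I * ∑ j, lam j * (x j : ℂ))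

/-- The non-symmetric wavefunction `ψ_λ = P e^{iλ}`. -/
def psi {N : ℕ} (γ : ℝ) (lam : Fin N → ℂ) : (Fin N → ℝ) → ℂ :=
  propagation γ (planeWave lam)

/-! ### Creation operators and the operators `a` -/

/-- The sign `ε = ±`. -/
inductive Side
  | plus
  | minus

/-- The position of the added particle among `N + 1` particles: first for `+`, last for `-`. -/
def Side.newIdx (N : ℕ) : Side → Fin (N + 1)
  | .plus => 0
  | .minus => Fin.last N

/-- `j ↦ j^ε`, the relabelling of the old particles: `j + 1` for `+` and `j` for `-`. -/
def Side.shift {N : ℕ} : Side → Fin N → Fin (N + 1)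
  | .plus => Fin.succ
  | .minus => Fin.castSucc

/-- `(hatPhi ε f)(x)` is `f(x_2, …, x_{N+1})` for `+` and `f(x_1, …, x_N)` for `-`. -/
def hatPhi {N : ℕ} (ε : Side) (f : (Fin N → ℝ) → ℂ) : (Fin (N + 1) → ℝ) → ℂ :=
  fun x => f (fun k => x (ε.shift k))

/-- Replace, for each `m`, the coordinate with index `i_m` by `y_m`. -/
def barPhi {N n : ℕ} (i : Fin n ↪ Fin N) (y : Fin n → ℝ) (f : (Fin N → ℝ) → ℂ) :
    (Fin N → ℝ) → ℂ :=
  fun x => f (Function.extend i y x)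

/-- The sequence `(x_{i_1 + 1}, …, x_{i_n + 1}, x_1)` for `+`, and
`(x_{N+1}, x_{i_1}, …, x_{i_n})` for `-`. -/
def nodes {N n : ℕ} (ε : Side) (i : Fin n ↪ Fin N) (x : Fin (N + 1) → ℝ) : Fin (n + 1) → ℝ :=
  match ε with
  | .plus => Fin.snoc (α := fun _ => ℝ) (fun m => x (Side.plus.shift (i m))) (x 0)
  | .minus => Fin.cons (α := fun _ => ℝ) (x (Fin.last N)) (fun m => x (Side.minus.shift (i m)))

open Classical in
/-- The elementary creation operator. With `p` the sequence of nodes, it vanishes unless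
`p` is strictly decreasing, and then it is the integral over `p_{m+1} < y_m < p_m` of
`exp(i μ x_new) exp(i μ ∑ (x_{i_m} - y_m))` times `f` with the coordinates `i_m` replaced
by `y_m`. -/
def eHat {N n : ℕ} (ε : Side) (μ : ℂ) (i : Fin n ↪ Fin N) (f : (Fin N → ℝ) → ℂ) :
    (Fin (N + 1) → ℝ) → ℂ :=
  fun x =>
    if ∀ m : Fin n, nodes ε i x m.succ < nodes ε i x m.castSucc then
      Complex.exp (Complex.I * μ * (x (ε.newIdx N) : ℂ)) *
        ∫ y in Set.univ.pi (fun m : Fin n =>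
            Set.Ioc (nodes ε i x m.succ) (nodes ε i x m.castSucc)),
          Complex.exp (Complex.I * μ * ∑ m, ((x (ε.shift (i m)) : ℂ) - (y m : ℂ))) *
            hatPhi ε (barPhi i y f) x
    else 0

/-- The non-symmetric creation operator `b^ε_μ = ∑_n γ^n ∑_i e^ε_{μ;i}`, where `i` runs over the
`n`-tuples of distinct indices. -/
def bFun {N : ℕ} (γ : ℝ) (ε : Side) (μ : ℂ) (f : (Fin N → ℝ) → ℂ) : (Fin (N + 1) → ℝ) → ℂ :=
  fun x => ∑ n ∈ Finset.range (N + 1), (γ : ℂ) ^ n * ∑ i : Fin n ↪ Fin N, eHat ε μ i f x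

/-- `x ↦ (x⁺, x)` for `+` and `x ↦ (x, x⁻)` for `-`. -/
def bdry {N : ℕ} (xp xm : ℝ) (ε : Side) (x : Fin N → ℝ) : Fin (N + 1) → ℝ :=
  match ε with
  | .plus => Fin.cons (α := fun _ => ℝ) xp x
  | .minus => Fin.snoc (α := fun _ => ℝ) x xm

/-- Boundary evaluation: `(checkPhi + f)(x) = f(x⁺, x)` and `(checkPhi - f)(x) = f(x, x⁻)`. -/
def checkPhi {N : ℕ} (xp xm : ℝ) (ε : Side) (f : (Fin (N + 1) → ℝ) → ℂ) : (Fin N → ℝ) → ℂ :=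
  fun x => f (bdry xp xm ε x)

/-- `a^ε_μ = checkPhi^ε ∘ b^ε_μ`, as a formula on functions. -/
def aFun {N : ℕ} (γ xp xm : ℝ) (ε : Side) (μ : ℂ) (f : (Fin N → ℝ) → ℂ) : (Fin N → ℝ) → ℂ :=
  checkPhi xp xm ε (bFun γ ε μ f)

/-! ### The Hilbert space `L²(J^N)` -/

/-- Lebesgue measure on `J^N`, where `J = [x⁺, x⁻]`. -/
def cubeMeasure (N : ℕ) (xp xm : ℝ) : Measure (Fin N → ℝ) :=
  volume.restrict (Set.univ.pi fun _ => Set.Icc xp xm)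

/-- The Hilbert space `L²(J^N)`. -/
abbrev Sector (N : ℕ) (xp xm : ℝ) : Type := Lp ℂ 2 (cubeMeasure N xp xm)

/-- The formula `T` on functions induces a bounded linear operator on `L²(X)`. -/
structure IsL2Bounded {α : Type*} [MeasurableSpace α] (X : Measure α)
    (T : (α → ℂ) → α → ℂ) : Prop where
  meas : ∀ f, MemLp f 2 X → AEStronglyMeasurable (T f) X
  bound : ∃ C : ℝ≥0, ∀ f, MemLp f 2 X → eLpNorm (T f) 2 X ≤ C * eLpNorm f 2 X
  congr : ∀ f g, f =ᵐ[X] g → T f =ᵐ[X] T g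
  add : ∀ f g, MemLp f 2 X → MemLp g 2 X → T (f + g) =ᵐ[X] T f + T g
  smul : ∀ (c : ℂ) f, MemLp f 2 X → T (c • f) =ᵐ[X] c • T f

namespace IsL2Bounded

variable {α : Type*} [MeasurableSpace α] {X : Measure α} {T : (α → ℂ) → α → ℂ}

theorem memLp (h : IsL2Bounded X T) {f : α → ℂ} (hf : MemLp f 2 X) : MemLp (T f) 2 X := by
  obtain ⟨C, hC⟩ := h.bound
  exact ⟨h.meas f hf, (hC f hf).trans_lt (ENNReal.mul_lt_top ENNReal.coe_lt_top hf.2)⟩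

/-- The bounded operator on `L²(X)` that sends the class of `f` to the class of `T f`. -/
def toCLM (h : IsL2Bounded X T) : Lp ℂ 2 X →L[ℂ] Lp ℂ 2 X :=
  LinearMap.mkContinuousOfExistsBound
    { toFun := fun f => (h.memLp (Lp.memLp f)).toLp (T f)
      map_add' := fun f g => by
        rw [← MemLp.toLp_add, MemLp.toLp_eq_toLp_iff]
        exact (h.congr _ _ (Lp.coeFn_add f g)).trans (h.add _ _ (Lp.memLp f) (Lp.memLp g))
      map_smul' := fun c f => by
        rw [RingHom.id_apply, ← MemLp.toLp_const_smul, MemLp.toLp_eq_toLp_iff]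
        exact (h.congr _ _ (Lp.coeFn_smul c f)).trans (h.smul c _ (Lp.memLp f)) }
    (by
      obtain ⟨C, hC⟩ := h.bound
      refine ⟨C, fun f => ?_⟩
      have h1 := hC f (Lp.memLp f)
      simp only [LinearMap.coe_mk, AddHom.coe_mk]
      rw [Lp.norm_toLp, Lp.norm_def]
      have h2 := ENNReal.toReal_mono (ENNReal.mul_ne_top ENNReal.coe_ne_top (Lp.memLp f).2.ne) h1
      simpa [ENNReal.toReal_mul] using h2)

theorem coeFn_toCLM (h : IsL2Bounded X T) (f : Lp ℂ 2 X) : h.toCLM f =ᵐ[X] T f :=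
  MemLp.coeFn_toLp (h.memLp (Lp.memLp f))

theorem const_mul (h : IsL2Bounded X T) (c : ℂ) :
    IsL2Bounded X (fun f x => c * T f x) where
  meas f hf := (h.meas f hf).const_mul c
  bound := by
    obtain ⟨C, hC⟩ := h.bound
    refine ⟨‖c‖₊ * C, fun f hf => ?_⟩
    have : (fun x => c * T f x) = c • T f := rfl
    rw [this, eLpNorm_const_smul, ENNReal.coe_mul, mul_assoc]
    exact mul_le_mul_right (hC f hf) _
  congr f g hfg := by
    filter_upwards [h.congr f g hfg] with x hx
    rw [hx]
  add f g hf hg := by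
    filter_upwards [h.add f g hf hg] with x hx
    simp only [Pi.add_apply] at hx ⊢
    rw [hx, mul_add]
  smul d f hf := by
    filter_upwards [h.smul d f hf] with x hx
    simp only [Pi.smul_apply, smul_eq_mul] at hx ⊢
    rw [hx]; ring

theorem sum {ι : Type*} (s : Finset ι) {T : ι → (α → ℂ) → α → ℂ}
    (h : ∀ i ∈ s, IsL2Bounded X (T i)) :
    IsL2Bounded X (fun f x => ∑ i ∈ s, T i f x) := by
  classical
  induction s using Finset.induction_on with
  | empty =>
    exact
      { meas := fun f _ => by simpa using aestronglyMeasurable_const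
        bound := ⟨0, fun f _ => by simp⟩
        congr := fun f g _ => by simp
        add := fun f g _ _ => by
          filter_upwards with x
          simp
        smul := fun c f _ => by
          filter_upwards with x
          simp }
  | insert a s ha ih =>
    have h1 := h a (Finset.mem_insert_self a s)
    have h2 := ih (fun i hi => h i (Finset.mem_insert_of_mem hi))
    simp only [Finset.sum_insert ha]
    exact
      { meas := fun f hf => (h1.meas f hf).add (h2.meas f hf)
        bound := by
          obtain ⟨C, hC⟩ := h1.bound
          obtain ⟨D, hD⟩ := h2.bound
          refine ⟨C + D, fun f hf => ?_⟩
          refine (eLpNorm_add_le (h1.meas f hf) (h2.meas f hf) (by norm_num)).trans ?_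
          rw [ENNReal.coe_add, add_mul]
          exact add_le_add (hC f hf) (hD f hf)
        congr := fun f g hfg => by
          filter_upwards [h1.congr f g hfg, h2.congr f g hfg] with x hx hy
          rw [hx, hy]
        add := fun f g hf hg => by
          filter_upwards [h1.add f g hf hg, h2.add f g hf hg] with x hx hy
          simp only [Pi.add_apply] at hx hy ⊢
          rw [hx, hy]; ring
        smul := fun c f hf => by
          filter_upwards [h1.smul c f hf, h2.smul c f hf] with x hx hy
          simp only [Pi.smul_apply, smul_eq_mul] at hx hy ⊢
          rw [hx, hy]; ring }

end IsL2Bounded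

theorem sq_integral_le {β : Type*} [MeasurableSpace β] {Y : Measure β} (u : β → ℝ≥0∞)
    (hu : AEMeasurable u Y) :
    (∫⁻ y, u y ∂Y) ^ (2 : ℝ) ≤ Y Set.univ * ∫⁻ y, u y ^ (2 : ℝ) ∂Y := by
  have h := ENNReal.lintegral_mul_le_Lp_mul_Lq Y (p := 2) (q := 2)
    ((Real.holderConjugate_iff).2 ⟨by norm_num, by norm_num⟩) hu
    (aemeasurable_const (b := (1 : ℝ≥0∞)))
  simp only [Pi.mul_apply, mul_one, ENNReal.one_rpow, lintegral_const, one_mul] at h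
  calc (∫⁻ y, u y ∂Y) ^ (2 : ℝ)
      ≤ ((∫⁻ y, u y ^ (2 : ℝ) ∂Y) ^ (1 / 2 : ℝ) * Y Set.univ ^ (1 / 2 : ℝ)) ^ (2 : ℝ) :=
        ENNReal.rpow_le_rpow h (by norm_num)
    _ = Y Set.univ * ∫⁻ y, u y ^ (2 : ℝ) ∂Y := by
        rw [ENNReal.mul_rpow_of_nonneg _ _ (by norm_num), ← ENNReal.rpow_mul,
          ← ENNReal.rpow_mul]
        norm_num [mul_comm]

theorem eLpNorm_integral_le {α β : Type*} [MeasurableSpace α] [MeasurableSpace β]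
    {X : Measure α} {Y : Measure β} [SFinite X] [SFinite Y] (F : α × β → ℂ)
    (hF : AEStronglyMeasurable F (X.prod Y)) :
    eLpNorm (fun x => ∫ y, F (x, y) ∂Y) 2 X
      ≤ Y Set.univ ^ (1 / 2 : ℝ) * eLpNorm F 2 (X.prod Y) := by
  rw [eLpNorm_eq_lintegral_rpow_enorm_toReal (by norm_num) (by norm_num),
    eLpNorm_eq_lintegral_rpow_enorm_toReal (by norm_num) (by norm_num)]
  simp only [ENNReal.toReal_ofNat]
  rw [← ENNReal.mul_rpow_of_nonneg _ _ (by norm_num)]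
  refine ENNReal.rpow_le_rpow ?_ (by norm_num)
  have hE : AEMeasurable (fun z => ‖F z‖ₑ ^ (2 : ℝ)) (X.prod Y) := hF.enorm.pow_const _
  rw [lintegral_prod _ hE]
  have hE' : AEMeasurable (fun x => ∫⁻ y, ‖F (x, y)‖ₑ ^ (2 : ℝ) ∂Y) X :=
    hE.lintegral_prod_right'
  rw [← lintegral_const_mul'' _ hE']
  refine lintegral_mono_ae ?_
  filter_upwards [hF.prodMk_left] with x hx
  exact (ENNReal.rpow_le_rpow (enorm_integral_le_lintegral_enorm _) (by norm_num)).trans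
    (sq_integral_le _ hx.enorm)

/-- An integral operator `f ↦ ∫ K(x,y) f(Φ(x,y)) dy` with bounded kernel. -/
theorem isL2Bounded_kernel {α β : Type*} [MeasurableSpace α] [MeasurableSpace β]
    {X : Measure α} {Y : Measure β} [IsFiniteMeasure X] [IsFiniteMeasure Y]
    {Φ : α × β → α} (hΦ : Measurable Φ) {c : ℝ≥0} (hmap : (X.prod Y).map Φ = c • X)
    {K : α × β → ℂ} (hK : Measurable K) {C : ℝ≥0} (hKC : ∀ᵐ z ∂X.prod Y, ‖K z‖ ≤ C)
    {T : (α → ℂ) → α → ℂ}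
    (hT : ∀ᵐ x ∂X, ∀ f, T f x = ∫ y, K (x, y) * f (Φ (x, y)) ∂Y) :
    IsL2Bounded X T := by
  have hQ : Measure.QuasiMeasurePreserving Φ (X.prod Y) X :=
    ⟨hΦ, by rw [hmap]; exact Measure.smul_absolutelyContinuous⟩
  have hT' : ∀ f, T f =ᵐ[X] fun x => ∫ y, K (x, y) * f (Φ (x, y)) ∂Y := fun f => by
    filter_upwards [hT] with x hx using hx f
  have hcomp : ∀ f : α → ℂ, MemLp f 2 X → MemLp (f ∘ Φ) 2 (X.prod Y) := fun f hf =>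
    MemLp.comp_of_map (by
      rw [hmap]; exact MemLp.smul_measure (c := (c : ℝ≥0∞)) hf ENNReal.coe_ne_top) hΦ.aemeasurable
  have hF : ∀ f : α → ℂ, MemLp f 2 X → MemLp (fun z => K z * f (Φ z)) 2 (X.prod Y) := fun f hf =>
    MemLp.of_le_mul (g := f ∘ Φ) (c := C) (hcomp f hf)
      (hK.aestronglyMeasurable.mul (hcomp f hf).1) (by
        filter_upwards [hKC] with z hz
        rw [norm_mul]
        exact mul_le_mul_of_nonneg_right hz (norm_nonneg _))
  have hint : ∀ f : α → ℂ, MemLp f 2 X → ∀ᵐ x ∂X, Integrable (fun y => K (x, y) * f (Φ (x, y))) Y :=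
    fun f hf => ((hF f hf).integrable (by norm_num)).prod_right_ae
  refine ⟨fun f hf => ?_, ?_, fun f g hfg => ?_, fun f g hf hg => ?_, fun d f hf => ?_⟩
  · exact ((hF f hf).1.integral_prod_right').congr (hT' f).symm
  · refine ⟨(Y Set.univ ^ (1 / 2 : ℝ) * (C * (c : ℝ≥0∞) ^ (1 / 2 : ℝ))).toNNReal,
      fun f hf => ?_⟩
    rw [ENNReal.coe_toNNReal (ENNReal.mul_ne_top
      (ENNReal.rpow_ne_top_of_nonneg (by norm_num) (measure_ne_top _ _))
      (ENNReal.mul_ne_top ENNReal.coe_ne_top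
        (ENNReal.rpow_ne_top_of_nonneg (by norm_num) ENNReal.coe_ne_top)))]
    rw [eLpNorm_congr_ae (hT' f), mul_assoc]
    refine (eLpNorm_integral_le _ (hF f hf).1).trans ?_
    refine mul_le_mul_right ?_ _
    have h1 : eLpNorm (fun z => K z * f (Φ z)) 2 (X.prod Y)
        ≤ C * eLpNorm (f ∘ Φ) 2 (X.prod Y) := by
      have := eLpNorm_le_mul_eLpNorm_of_ae_le_mul (μ := X.prod Y) (c := (C : ℝ))
        (f := fun z => K z * f (Φ z)) (g := f ∘ Φ) (by
          filter_upwards [hKC] with z hz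
          rw [norm_mul]
          exact mul_le_mul_of_nonneg_right hz (norm_nonneg _)) 2
      simpa using this
    refine h1.trans ?_
    rw [mul_assoc]
    refine mul_le_mul_right ?_ _
    have hm : AEStronglyMeasurable f ((X.prod Y).map Φ) := by
      rw [hmap]; exact hf.1.smul_measure c
    rw [← eLpNorm_map_measure hm hΦ.aemeasurable, hmap]
    have := eLpNorm_smul_measure_of_ne_top (p := 2) (by norm_num) f (c : ℝ≥0∞) (μ := X)
    simp only [ENNReal.toReal_div, ENNReal.toReal_one, ENNReal.toReal_ofNat, smul_eq_mul] at this
    exact this.le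
  · refine (hT' f).trans (EventuallyEq.trans ?_ (hT' g).symm)
    have h := hQ.ae_eq_comp hfg
    filter_upwards [Measure.ae_ae_of_ae_prod h] with x hx
    refine integral_congr_ae ?_
    filter_upwards [hx] with y hy
    simp only [Function.comp] at hy
    simp only [hy]
  · filter_upwards [hT' f, hT' g, hT' (f + g), hint f hf, hint g hg] with x h1 h2 h3 h4 h5
    rw [Pi.add_apply, h1, h2, h3, ← integral_add h4 h5]
    simp only [Pi.add_apply, mul_add]
  · filter_upwards [hT' f, hT' (d • f)] with x h1 h2
    rw [Pi.smul_apply, h1, h2, smul_eq_mul, ← integral_const_mul]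
    refine integral_congr_ae (Eventually.of_forall fun y => ?_)
    simp only [Pi.smul_apply, smul_eq_mul]; ring

theorem measurable_extend {N n : ℕ} (i : Fin n ↪ Fin N) :
    Measurable (fun z : (Fin N → ℝ) × (Fin n → ℝ) => Function.extend i z.2 z.1) := by
  refine measurable_pi_lambda _ fun k => ?_
  by_cases hk : ∃ m, i m = k
  · obtain ⟨m, rfl⟩ := hk
    simp only [i.injective.extend_apply]
    fun_prop
  · simp only [Function.extend_apply' _ _ _ hk]
    fun_prop

theorem map_extend {N n : ℕ} (i : Fin n ↪ Fin N) (ν : Measure ℝ) [IsFiniteMeasure ν] :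
    ((Measure.pi fun _ : Fin N => ν).prod (Measure.pi fun _ : Fin n => ν)).map
      (fun z => Function.extend i z.2 z.1)
      = ((ν Set.univ) ^ n).toNNReal • (Measure.pi fun _ : Fin N => ν) := by
  classical
  have key : ∀ s : Fin N → Set ℝ, (∀ k, MeasurableSet (s k)) →
      ((Measure.pi fun _ : Fin N => ν).prod (Measure.pi fun _ : Fin n => ν)).map
        (fun z => Function.extend i z.2 z.1) (Set.univ.pi s)
        = (((ν Set.univ) ^ n).toNNReal • (Measure.pi fun _ : Fin N => ν)) (Set.univ.pi s) := by
    intro s hs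
    rw [Measure.map_apply (measurable_extend i) (MeasurableSet.univ_pi hs)]
    have hpre : (fun z : (Fin N → ℝ) × (Fin n → ℝ) => Function.extend i z.2 z.1) ⁻¹'
        (Set.univ.pi s) = (Set.univ.pi fun k => if k ∈ Finset.univ.map i then Set.univ else s k)
          ×ˢ (Set.univ.pi fun m => s (i m)) := by
      ext ⟨x, y⟩
      simp only [Set.mem_preimage, Set.mem_univ_pi, Set.mem_prod, Finset.mem_map,
        Finset.mem_univ, true_and]
      constructor
      · intro h
        refine ⟨fun k => ?_, fun m => ?_⟩
        · split_ifs with hk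
          · trivial
          · have := h k
            rwa [Function.extend_apply' _ _ _ hk] at this
        · have := h (i m)
          rwa [i.injective.extend_apply] at this
      · rintro ⟨h1, h2⟩ k
        by_cases hk : ∃ m, i m = k
        · obtain ⟨m, rfl⟩ := hk
          rw [i.injective.extend_apply]
          exact h2 m
        · have := h1 k
          rw [if_neg hk] at this
          rwa [Function.extend_apply' _ _ _ hk]
    rw [hpre, Measure.prod_prod, Measure.pi_pi, Measure.pi_pi, Measure.smul_apply,
      Measure.pi_pi, ENNReal.smul_def, smul_eq_mul,
      ENNReal.coe_toNNReal (ENNReal.pow_ne_top (measure_ne_top _ _))]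
    have h1 : ∀ k, ν (if k ∈ Finset.univ.map i then Set.univ else s k)
        = if k ∈ Finset.univ.map i then ν Set.univ else ν (s k) := fun k => by
      split_ifs <;> rfl
    simp only [h1]
    have h2 : ∏ m, ν (s (i m)) = ∏ k ∈ Finset.univ.map i, ν (s k) := by
      rw [Finset.prod_map]
    rw [h2, ← Finset.prod_mul_prod_compl (Finset.univ.map i) (fun k => ν (s k)),
      ← Finset.prod_mul_prod_compl (Finset.univ.map i)
        (fun k => if k ∈ Finset.univ.map i then ν Set.univ else ν (s k)),
      Finset.prod_congr rfl (fun k hk => if_pos hk),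
      Finset.prod_congr (s₁ := (Finset.univ.map i)ᶜ) rfl
        (fun k hk => if_neg (Finset.mem_compl.1 hk)),
      Finset.prod_const, Finset.card_map, Finset.card_univ, Fintype.card_fin]
    ring
  refine ext_of_generate_finite _ generateFrom_pi.symm isPiSystem_pi ?_ ?_
  · rintro _ ⟨s, hs, rfl⟩
    exact key s (fun k => hs k (Set.mem_univ k))
  · have := key (fun _ => Set.univ) (fun _ => MeasurableSet.univ)
    rwa [Set.pi_univ] at this

theorem cubeMeasure_eq (N : ℕ) (xp xm : ℝ) :
    cubeMeasure N xp xm = Measure.pi fun _ => volume.restrict (Set.Icc xp xm) := by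
  rw [cubeMeasure, volume_pi, Measure.restrict_pi_pi]

instance (N : ℕ) (xp xm : ℝ) : IsFiniteMeasure (cubeMeasure N xp xm) := by
  rw [cubeMeasure_eq]; infer_instance

theorem ae_mem_cube (N : ℕ) (xp xm : ℝ) :
    ∀ᵐ x ∂cubeMeasure N xp xm, ∀ k, x k ∈ Set.Icc xp xm := by
  filter_upwards [ae_restrict_mem (MeasurableSet.univ_pi fun _ => measurableSet_Icc)] with x hx k
  exact hx k (Set.mem_univ k)

theorem continuous_bdry {N : ℕ} (xp xm : ℝ) (ε : Side) :
    Continuous (bdry (N := N) xp xm ε) := by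
  cases ε <;> unfold bdry <;> fun_prop

theorem continuous_nodes {N n : ℕ} (ε : Side) (i : Fin n ↪ Fin N) :
    Continuous (nodes ε i) := by
  cases ε <;> unfold nodes <;> fun_prop

theorem bdry_shift {N : ℕ} (xp xm : ℝ) (ε : Side) (x : Fin N → ℝ) (k : Fin N) :
    bdry xp xm ε x (ε.shift k) = x k := by
  cases ε <;> simp [bdry, Side.shift]

theorem nodes_mem {N n : ℕ} {xp xm : ℝ} (h : xp ≤ xm) (ε : Side) (i : Fin n ↪ Fin N)
    {x : Fin N → ℝ} (hx : ∀ k, x k ∈ Set.Icc xp xm) (m : Fin (n + 1)) :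
    nodes ε i (bdry xp xm ε x) m ∈ Set.Icc xp xm := by
  cases ε
  · induction m using Fin.lastCases with
    | last => simpa [nodes, bdry] using h
    | cast m => simpa [nodes, bdry, Side.shift] using hx (i m)
  · induction m using Fin.cases with
    | zero => simpa [nodes, bdry] using h
    | succ m => simpa [nodes, bdry, Side.shift] using hx (i m)

theorem measurableSet_forall {α ι : Type*} [MeasurableSpace α] [Countable ι] {p : ι → α → Prop}
    (h : ∀ i, MeasurableSet {x | p i x}) : MeasurableSet {x | ∀ i, p i x} := by
  have : {x | ∀ i, p i x} = ⋂ i, {x | p i x} := by ext; simp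
  rw [this]
  exact MeasurableSet.iInter h

theorem measurableSet_imp {α : Type*} [MeasurableSpace α] {p : Prop} {q : α → Prop}
    (hq : p → MeasurableSet {x | q x}) : MeasurableSet {x | p → q x} := by
  by_cases hp : p
  · simpa [hp] using hq hp
  · simp [hp]

theorem measurableSet_and {α : Type*} [MeasurableSpace α] {p q : α → Prop}
    (hp : MeasurableSet {x | p x}) (hq : MeasurableSet {x | q x}) :
    MeasurableSet {x | p x ∧ q x} := by
  have : {x | p x ∧ q x} = {x | p x} ∩ {x | q x} := by ext; simp
  rw [this]
  exact hp.inter hq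

theorem isL2Bounded_eHat {N n : ℕ} {xp xm : ℝ} (h : xp ≤ xm) (ε : Side) (μ : ℂ)
    (i : Fin n ↪ Fin N) :
    IsL2Bounded (cubeMeasure N xp xm) (fun f => checkPhi xp xm ε (eHat ε μ i f)) := by
  classical
  set p : (Fin N → ℝ) → Fin (n + 1) → ℝ := fun x => nodes ε i (bdry xp xm ε x) with hp
  have hpc : Continuous p := (continuous_nodes ε i).comp (continuous_bdry xp xm ε)
  have hpm : ∀ m, Measurable fun z : (Fin N → ℝ) × (Fin n → ℝ) => p z.1 m := fun m =>
    ((continuous_apply m).comp (hpc.comp continuous_fst)).measurable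
  set S : Set ((Fin N → ℝ) × (Fin n → ℝ)) :=
    {z | (∀ m : Fin n, p z.1 m.succ < p z.1 m.castSucc) ∧
      ∀ m : Fin n, z.2 m ∈ Set.Ioc (p z.1 m.succ) (p z.1 m.castSucc)} with hS
  have hSm : MeasurableSet S := by
    refine measurableSet_and ?_ ?_
    · exact measurableSet_forall fun m => measurableSet_lt (hpm _) (hpm _)
    · refine measurableSet_forall fun m => measurableSet_and ?_ ?_
      · exact measurableSet_lt (hpm _) (by fun_prop)
      · exact measurableSet_le (by fun_prop) (hpm _)
  set e : (Fin N → ℝ) × (Fin n → ℝ) → ℂ := fun z =>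
    Complex.exp (Complex.I * μ * (bdry xp xm ε z.1 (ε.newIdx N) : ℂ)) *
      Complex.exp (Complex.I * μ * ∑ m, ((z.1 (i m) : ℂ) - (z.2 m : ℂ))) with he
  have hec : Continuous e := by
    have hb := continuous_bdry (N := N) xp xm ε
    have hb' : Continuous fun z : (Fin N → ℝ) × (Fin n → ℝ) =>
        bdry xp xm ε z.1 (ε.newIdx N) := (continuous_apply _).comp (hb.comp continuous_fst)
    simp only [he]
    fun_prop
  -- bound of the kernel on the compact set
  have hcpt : IsCompact ((Set.univ.pi fun _ : Fin N => Set.Icc xp xm) ×ˢ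
      (Set.univ.pi fun _ : Fin n => Set.Icc xp xm)) :=
    (isCompact_univ_pi fun _ => isCompact_Icc).prod (isCompact_univ_pi fun _ => isCompact_Icc)
  obtain ⟨C, hC⟩ := hcpt.exists_bound_of_continuousOn hec.continuousOn
  have hmap := map_extend i (volume.restrict (Set.Icc xp xm))
  rw [← cubeMeasure_eq, ← cubeMeasure_eq] at hmap
  refine isL2Bounded_kernel (Y := cubeMeasure n xp xm) (measurable_extend i) hmap
    (K := S.indicator e) (hec.measurable.indicator hSm) (C := C.toNNReal) ?_ ?_
  · refine (Measure.ae_prod_iff_ae_ae ?_).2 ?_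
    · exact measurableSet_le (hec.measurable.indicator hSm).norm measurable_const
    · filter_upwards [ae_mem_cube N xp xm] with x hx
      filter_upwards [ae_mem_cube n xp xm] with y hy
      rw [Real.coe_toNNReal']
      refine (norm_indicator_le_norm_self _ _).trans ((hC _ ⟨fun k _ => hx k, fun k _ => hy k⟩).trans
        (le_max_left _ _))
  · filter_upwards [ae_mem_cube N xp xm] with x hx f
    simp only [checkPhi, eHat]
    split_ifs with hlt
    · have hbox : MeasurableSet (Set.univ.pi fun m : Fin n =>
          Set.Ioc (p x m.succ) (p x m.castSucc)) :=
        MeasurableSet.univ_pi fun _ => measurableSet_Ioc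
      have hsub : (Set.univ.pi fun m : Fin n => Set.Ioc (p x m.succ) (p x m.castSucc)) ⊆
          Set.univ.pi fun _ => Set.Icc xp xm := by
        intro y hy m _
        have h1 := hy m (Set.mem_univ m)
        exact ⟨(nodes_mem h ε i hx m.succ).1.trans h1.1.le,
          h1.2.trans (nodes_mem h ε i hx m.castSucc).2⟩
      rw [← integral_const_mul, cubeMeasure]
      rw [← integral_indicator hbox, ← integral_indicator
        (MeasurableSet.univ_pi fun _ => measurableSet_Icc)]
      refine integral_congr_ae (Eventually.of_forall fun y => ?_)
      simp only [Set.indicator_apply]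
      by_cases hy : y ∈ Set.univ.pi fun m : Fin n => Set.Ioc (p x m.succ) (p x m.castSucc)
      · rw [if_pos hy, if_pos (hsub hy),
          if_pos (show (x, y) ∈ S from ⟨hlt, fun m => hy m (Set.mem_univ m)⟩)]
        simp only [he, hatPhi, barPhi, bdry_shift]
        ring
      · rw [if_neg hy, if_neg (show (x, y) ∉ S from fun hz => hy fun m _ => hz.2 m)]
        simp
    · have : ∀ y, S.indicator e (x, y) = 0 := fun y =>
        Set.indicator_of_notMem (fun hz => hlt hz.1) _
      simp [this]

theorem isL2Bounded_aFun {xp xm : ℝ} (h : xp ≤ xm) (N : ℕ) (γ : ℝ) (ε : Side) (μ : ℂ) :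
    IsL2Bounded (cubeMeasure N xp xm) (aFun γ xp xm ε μ) := by
  have := IsL2Bounded.sum (X := cubeMeasure N xp xm) (Finset.range (N + 1))
    (T := fun n f x => (γ : ℂ) ^ n *
      ∑ i : Fin n ↪ Fin N, checkPhi xp xm ε (eHat ε μ i f) x)
    (fun n _ => (IsL2Bounded.sum Finset.univ
      (fun i _ => isL2Bounded_eHat h ε μ i)).const_mul _)
  exact this

/-- The bounded operator `a^ε_μ` on `L²(J^N)`: it sends the class of `f` to the class of
`checkPhi^ε (b^ε_μ f)`, which is defined almost everywhere on `J^N`. -/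
def aOp {xp xm : ℝ} (h : xp < xm) (N : ℕ) (γ : ℝ) (ε : Side) (μ : ℂ) :
    Sector N xp xm →L[ℂ] Sector N xp xm :=
  (isL2Bounded_aFun h.le N γ ε μ).toCLM

theorem coeFn_aOp {xp xm : ℝ} (h : xp < xm) (N : ℕ) (γ : ℝ) (ε : Side) (μ : ℂ)
    (f : Sector N xp xm) : aOp h N γ ε μ f =ᵐ[cubeMeasure N xp xm] aFun γ xp xm ε μ f :=
  IsL2Bounded.coeFn_toCLM _ f

/-! ### The wavefunctions as elements of `L²(J^N)` -/

theorem continuous_intRefl {N : ℕ} (γ : ℝ) (j : Fin (N - 1)) {f : (Fin N → ℝ) → ℂ}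
    (hf : Continuous f) : Continuous (intRefl γ j f) := by
  have h1 : Continuous (permAct (simpleSwap j) f) :=
    hf.comp (continuous_pi fun k => continuous_apply _)
  have h2 : Continuous (intOp (adjL j) (adjR j) f) := by
    unfold intOp
    refine intervalIntegral.continuous_parametric_intervalIntegral_of_continuous (μ := volume)
      (f := fun x y => f (x - y • (Pi.single (adjL j) (1 : ℝ) - Pi.single (adjR j) (1 : ℝ))))
      ?_ ?_
    · exact hf.comp (by fun_prop)
    · fun_prop
  exact h1.add (continuous_const.mul h2)

theorem continuous_permRefl {N : ℕ} (γ : ℝ) (w : Equiv.Perm (Fin N)) {f : (Fin N → ℝ) → ℂ}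
    (hf : Continuous f) : Continuous (permRefl γ w f) := by
  unfold permRefl wordRefl
  induction (exists_word w).choose with
  | nil => exact hf
  | cons a l ih => exact continuous_intRefl γ a ih

theorem measurableSet_chamberPerm {N : ℕ} (w : Equiv.Perm (Fin N)) :
    MeasurableSet {x : Fin N → ℝ | chamberPerm x = w} := by
  have : {x : Fin N → ℝ | chamberPerm x = w} = {x | (∀ a b, a ≤ b → -x (w⁻¹ a) ≤ -x (w⁻¹ b)) ∧
      ∀ a b, a < b → -x (w⁻¹ a) = -x (w⁻¹ b) → w⁻¹ a < w⁻¹ b} := by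
    ext x
    simp only [Set.mem_ofPred_eq, chamberPerm]
    rw [inv_eq_iff_eq_inv, eq_comm, Tuple.eq_sort_iff]
    rfl
  rw [this]
  refine measurableSet_and ?_ ?_
  · exact measurableSet_forall fun a => measurableSet_forall fun b => measurableSet_imp fun _ =>
      measurableSet_le (by fun_prop) (by fun_prop)
  · refine measurableSet_forall fun a => measurableSet_forall fun b => measurableSet_imp fun _ =>
      ?_
    generalize w⁻¹ a = a'
    generalize w⁻¹ b = b'
    by_cases hw : a' < b'
    · simp [hw]
    · have : {x : Fin N → ℝ | -x a' = -x b' → a' < b'}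
          = {x : Fin N → ℝ | -x a' = -x b'}ᶜ := by ext x; simp [hw]
      rw [this]
      exact (measurableSet_eq_fun (by fun_prop) (by fun_prop)).compl

theorem psi_eq_sum {N : ℕ} (γ : ℝ) (lam : Fin N → ℂ) :
    psi γ lam = ∑ w : Equiv.Perm (Fin N), {x | chamberPerm x = w}.indicator
      (permAct w⁻¹ (permRefl γ w (planeWave lam))) := by
  classical
  ext x
  rw [Finset.sum_apply, Finset.sum_eq_single (chamberPerm x)]
  · exact (Set.indicator_of_mem (s := {y : Fin N → ℝ | chamberPerm y = chamberPerm x})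
      (show x ∈ {y : Fin N → ℝ | chamberPerm y = chamberPerm x} from rfl) _).symm
  · intro w _ hw
    exact Set.indicator_of_notMem (s := {y : Fin N → ℝ | chamberPerm y = w})
      (fun h => hw (Eq.symm h)) _
  · intro h; exact absurd (Finset.mem_univ _) h

theorem continuous_planeWave {N : ℕ} (lam : Fin N → ℂ) : Continuous (planeWave lam) := by
  unfold planeWave; fun_prop

theorem memLp_psi {N : ℕ} (xp xm : ℝ) (γ : ℝ) (lam : Fin N → ℂ) :
    MemLp (psi γ lam) 2 (cubeMeasure N xp xm) := by
  rw [psi_eq_sum]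
  refine memLp_finsetSum' _ fun w _ => MemLp.indicator (measurableSet_chamberPerm w) ?_
  have hc : Continuous (permAct w⁻¹ (permRefl γ w (planeWave lam))) :=
    (continuous_permRefl γ w (continuous_planeWave lam)).comp
      (continuous_pi fun k => continuous_apply _)
  obtain ⟨C, hC⟩ := (isCompact_univ_pi fun _ : Fin N => isCompact_Icc
    (a := xp) (b := xm)).exists_bound_of_continuousOn hc.continuousOn
  refine MemLp.of_bound hc.aestronglyMeasurable C ?_
  filter_upwards [ae_mem_cube N xp xm] with x hx
  exact hC x fun k _ => hx k

/-- The restriction of `ψ_λ` to `J^N`, as an element of `L²(J^N)`. -/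
def psiL2 {N : ℕ} (xp xm : ℝ) (γ : ℝ) (lam : Fin N → ℂ) : Sector N xp xm :=
  (memLp_psi xp xm γ lam).toLp (psi γ lam)

/-- The closure in `L²(J^N)` of the span of the restricted wavefunctions. -/
def zBar (N : ℕ) (xp xm : ℝ) (γ : ℝ) : Submodule ℂ (Sector N xp xm) :=
  (Submodule.span ℂ (Set.range fun lam : Fin N → ℂ => psiL2 xp xm γ lam)).topologicalClosure

end QNLS

end

/-! Everything is pulled back along the propagation operator P (`propOp`), which sends the plane
wave of frequency λ to ψ_λ. For a continuous f of N variables let τ_μ f = (s_1^γ ⋯ s_N^γ (f ⊗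
e^{iμ}))(a, ·) (`transfer`): a last variable carrying e^{iμ} is added, the reflections act, and the
first variable is frozen at a. With a = x^- one has a^-_μ P f = P τ_μ f at all points with distinct
coordinates below x^- (`aFun_minus_propOp`). So a^-_μ preserves the image of P, and it suffices that
the τ_μ commute.

Commutation (`transfer_comm`): τ_μ τ_ν f is the value at (a, a, ·) of X (f ⊗ e^{iν} ⊗ e^{iμ}), where
X is a product of reflections in N + 2 variables. The Coxeter relations give X s_{N+1}^γ = s_1^γ X,
and s_1^γ is invisible where the first two coordinates agree, so s_{N+1}^γ can be inserted freely.
It maps e^{iν} ⊗ e^{iμ} to 1 + c times the flipped tensor minus c times the tensor itself, with c =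
γ/(i(μ - ν)). Hence 1 + c annihilates the commutator; as c changes sign with the order of μ and ν,
one of the two orders has a nonzero factor.

Intertwining: for a decreasing z with entries at most a, τ_μ f(z) is e^{iμa} times a sum of iterated
integrals of P f over increasing index sequences (`transfer_eq_chainSum`). This goes by induction on
the number of variables; the key is how P f changes when one coordinate passes another
(`propOp_vcons_of_pairwise`) and what this exchange contributes to the iterated integrals
(`chainSum_exchange`). After the coordinates are sorted, the same sum is the defining formula of
a^-_μ (`chainSum_eq_sum`, `sum_eHat_minus`). Other chambers reduce to the fundamental one, because
τ_μ commutes with the reflections (`transfer_T`) and P(w^γ f)(wx) = P f(x) (`propOp_rearr`).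

The Coxeter relations are verified on plane waves with distinct frequencies, where each reflection
has an explicit two-term form, and extended by Stone–Weierstrass (`CubeBdd.ext`). The sign plus
follows from minus by x ↦ (-x_N, …, -x_1) (`aFun_plus`). Finally P f lies in the closed span for
every continuous f (`toL2_propOp_mem_zBar`), and both claims pass to the closure because the
operators are bounded. -/

noncomputable section

namespace QNLS

/-! ### Words in generators that satisfy the Coxeter relations of type `A` -/

section Coxeter

variable {M : Type*} [Monoid M]

/-- The Coxeter relations of type `A` for `t 0, …, t (n - 1)`. -/
structure IsCoxeterA (t : ℕ → M) (n : ℕ) : Prop where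
  sq : ∀ j < n, t j * t j = 1
  comm : ∀ i j, i + 1 < j → j < n → t i * t j = t j * t i
  braid : ∀ j, j + 1 < n → t j * t (j + 1) * t j = t (j + 1) * t j * t (j + 1)

theorem IsCoxeterA.mono {t : ℕ → M} {m n : ℕ} (h : IsCoxeterA t n) (hmn : m ≤ n) :
    IsCoxeterA t m where
  sq j hj := h.sq j (hj.trans_le hmn)
  comm i j hij hj := h.comm i j hij (hj.trans_le hmn)
  braid j hj := h.braid j (hj.trans_le hmn)

/-- The product of the generators over a word. -/
def wprod (t : ℕ → M) (l : List ℕ) : M := (l.map t).prod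

@[simp] theorem wprod_nil (t : ℕ → M) : wprod t [] = 1 := rfl

@[simp] theorem wprod_cons (t : ℕ → M) (j : ℕ) (l : List ℕ) :
    wprod t (j :: l) = t j * wprod t l := by simp [wprod]

theorem wprod_append (t : ℕ → M) (l l' : List ℕ) :
    wprod t (l ++ l') = wprod t l * wprod t l' := by simp [wprod]

/-- `t k * t (k + 1) * ⋯ * t (k + m - 1)`. -/
def asc (t : ℕ → M) (k m : ℕ) : M := wprod t (List.range' k m)

@[simp] theorem asc_zero (t : ℕ → M) (k : ℕ) : asc t k 0 = 1 := rfl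

theorem asc_succ (t : ℕ → M) (k m : ℕ) : asc t k (m + 1) = t k * asc t (k + 1) m := by
  simp [asc, List.range'_succ]

theorem asc_add (t : ℕ → M) (k a b : ℕ) : asc t k (a + b) = asc t k a * asc t (k + a) b := by
  rw [asc, asc, asc, ← wprod_append, List.range'_append_1]

theorem asc_succ_right (t : ℕ → M) (k m : ℕ) : asc t k (m + 1) = asc t k m * t (k + m) := by
  rw [asc_add, asc_succ, asc_zero, mul_one]

theorem IsCoxeterA.mul_asc_of_lt {t : ℕ → M} {n : ℕ} (h : IsCoxeterA t n) {i k m : ℕ}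
    (hi : i + 1 < k) (hk : k + m ≤ n) : t i * asc t k m = asc t k m * t i := by
  induction m generalizing k with
  | zero => simp
  | succ m ih =>
    rw [asc_succ, ← mul_assoc, h.comm i k hi (by omega), mul_assoc, ih (by omega) (by omega),
      mul_assoc]

theorem IsCoxeterA.mul_asc_of_gt {t : ℕ → M} {n : ℕ} (h : IsCoxeterA t n) {i k m : ℕ}
    (hi : k + m < i) (hn : i < n) : t i * asc t k m = asc t k m * t i := by
  induction m generalizing k with
  | zero => simp
  | succ m ih =>
    rw [asc_succ, ← mul_assoc, ← h.comm k i (by omega) hn, mul_assoc, ih (by omega), mul_assoc]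

/-- The generator t j commutes leftwards past every factor beyond t (j + 1), the braid relation
turns t j t (j + 1) t j into t (j + 1) t j t (j + 1), and the resulting t (j + 1) commutes past the
factors before t j. -/
theorem IsCoxeterA.asc_mul {t : ℕ → M} {n : ℕ} (h : IsCoxeterA t n) {j k m : ℕ}
    (hk : k ≤ j) (hj : j + 1 < k + m) (hn : k + m ≤ n) :
    asc t k m * t j = t (j + 1) * asc t k m := by
  obtain ⟨a, rfl⟩ := Nat.exists_eq_add_of_le hk
  obtain ⟨b, rfl⟩ : ∃ b, m = a + (b + 2) := ⟨m - a - 2, by omega⟩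
  rw [asc_add, asc_succ, asc_succ]
  have h1 := h.mul_asc_of_lt (i := k + a) (k := k + a + 1 + 1) (m := b) (by omega) (by omega)
  have h2 := h.mul_asc_of_gt (i := k + a + 1) (k := k) (m := a) (by omega) (by omega)
  have h3 := h.braid (k + a) (by omega)
  calc asc t k a * (t (k + a) * (t (k + a + 1) * asc t (k + a + 1 + 1) b)) * t (k + a)
      = asc t k a * (t (k + a) * t (k + a + 1) * (asc t (k + a + 1 + 1) b * t (k + a))) := by
        simp only [mul_assoc]
    _ = asc t k a * (t (k + a) * t (k + a + 1) * t (k + a)) * asc t (k + a + 1 + 1) b := by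
        rw [← h1]; simp only [mul_assoc]
    _ = asc t k a * t (k + a + 1) * (t (k + a) * (t (k + a + 1) * asc t (k + a + 1 + 1) b)) := by
        rw [h3]; simp only [mul_assoc]
    _ = _ := by rw [← h2]; simp only [mul_assoc]

/-- The ascending products ending at the last generator act as coset representatives for the
subgroup of the first n generators. Multiplying on the left by t j either passes through into that
subgroup (j < k - 1), lengthens the ascent (j = k - 1), cancels its first letter (j = k), or passes
through with index lowered by one (j > k). -/
theorem IsCoxeterA.exists_normalForm {t : ℕ → M} {n : ℕ} (h : IsCoxeterA t (n + 1)) (l : List ℕ)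
    (hl : ∀ j ∈ l, j < n + 1) : ∃ k m l', k + m = n + 1 ∧ (∀ j ∈ l', j < n) ∧
      wprod t l = asc t k m * wprod t l' := by
  induction l with
  | nil => exact ⟨n + 1, 0, [], by simp⟩
  | cons j l ih =>
    obtain ⟨k, m, l', hkm, hl', he⟩ := ih fun i hi => hl i (List.mem_cons_of_mem _ hi)
    have hj : j < n + 1 := hl j List.mem_cons_self
    rw [wprod_cons, he]
    rcases lt_trichotomy j k with hjk | rfl | hjk
    · rcases Nat.lt_or_ge (j + 1) k with h1 | h1
      · refine ⟨k, m, j :: l', hkm, ?_, ?_⟩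
        · simpa using ⟨by omega, hl'⟩
        · rw [← mul_assoc, h.mul_asc_of_lt h1 (by omega), wprod_cons, mul_assoc]
      · obtain rfl : k = j + 1 := by omega
        exact ⟨j, m + 1, l', by omega, hl', by rw [asc_succ, mul_assoc]⟩
    · obtain ⟨m, rfl⟩ : ∃ m', m = m' + 1 := ⟨m - 1, by omega⟩
      refine ⟨j + 1, m, l', by omega, hl', ?_⟩
      rw [asc_succ, ← mul_assoc, ← mul_assoc, h.sq j hj, one_mul]
    · obtain ⟨i, rfl⟩ : ∃ i, j = i + 1 := ⟨j - 1, by omega⟩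
      refine ⟨k, m, i :: l', hkm, ?_, ?_⟩
      · simpa using ⟨by omega, hl'⟩
      · rw [← mul_assoc, ← h.asc_mul (by omega) (by omega) (by omega), wprod_cons, mul_assoc]

/-- The simple transposition of `j` and `j + 1`. -/
def natSwap (j : ℕ) : Equiv.Perm ℕ := Equiv.swap j (j + 1)

theorem isCoxeterA_natSwap (n : ℕ) : IsCoxeterA natSwap n where
  sq j _ := Equiv.swap_mul_self _ _
  comm i j hij _ := by
    ext a
    simp only [natSwap, Equiv.Perm.mul_apply, Equiv.swap_apply_def]
    split_ifs <;> omega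
  braid j _ := by
    ext a
    simp only [natSwap, Equiv.Perm.mul_apply, Equiv.swap_apply_def]
    split_ifs <;> omega

theorem wprod_natSwap_apply {n : ℕ} (l : List ℕ) (hl : ∀ j ∈ l, j < n) :
    wprod natSwap l (n + 1) = n + 1 := by
  induction l with
  | nil => rfl
  | cons j l ih =>
    rw [wprod_cons, Equiv.Perm.mul_apply, ih fun i hi => hl i (List.mem_cons_of_mem _ hi)]
    have := hl j List.mem_cons_self
    exact Equiv.swap_apply_of_ne_of_ne (by omega) (by omega)

/-- With `wprod_natSwap_apply`, this shows that the image of the last point determines k in the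
normal form of a word. -/
theorem asc_natSwap_apply (k m : ℕ) : asc natSwap k m (k + m) = k := by
  induction m with
  | zero => rfl
  | succ m ih =>
    rw [asc_succ_right, Equiv.Perm.mul_apply, natSwap, ← add_assoc, Equiv.swap_apply_right, ih]

theorem wprod_prod {M' : Type*} [Monoid M'] (t : ℕ → M) (t' : ℕ → M') (l : List ℕ) :
    wprod (fun j => (t j, t' j)) l = (wprod t l, wprod t' l) := by
  induction l with
  | nil => rfl
  | cons j l ih => simp [ih]

/-- This is the Coxeter presentation of the symmetric group. A word that is trivial as a permutation
fixes the last point, so the ascent in its normal form is empty; the rest uses one generator fewer.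
-/
theorem IsCoxeterA.wprod_eq_one {n : ℕ} {t : ℕ → M} (h : IsCoxeterA t n) (l : List ℕ)
    (hl : ∀ j ∈ l, j < n) (h1 : wprod natSwap l = 1) : wprod t l = 1 := by
  induction n generalizing l with
  | zero =>
    cases l with
    | nil => rfl
    | cons j l => exact absurd (hl j List.mem_cons_self) (by omega)
  | succ n ih =>
    have hs := isCoxeterA_natSwap (n + 1)
    -- Working in the product monoid yields a single normal form that is valid for t and for the
    -- permutations at once.
    have hp : IsCoxeterA (fun j => (t j, natSwap j)) (n + 1) :=
      { sq := fun j hj => Prod.ext (h.sq j hj) (hs.sq j hj)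
        comm := fun i j hij hj => Prod.ext (h.comm i j hij hj) (hs.comm i j hij hj)
        braid := fun j hj => Prod.ext (h.braid j hj) (hs.braid j hj) }
    obtain ⟨k, m, l', hkm, hl', he⟩ := hp.exists_normalForm l hl
    simp only [asc, wprod_prod, Prod.mk_mul_mk, Prod.mk.injEq] at he
    obtain ⟨he1, he2⟩ := he
    have h2 := congrArg (fun σ : Equiv.Perm ℕ => σ (n + 1)) he2
    simp only [h1, Equiv.Perm.one_apply, Equiv.Perm.mul_apply, wprod_natSwap_apply l' hl'] at h2
    have h3 := asc_natSwap_apply k m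
    rw [hkm, asc, ← h2] at h3
    obtain rfl : m = 0 := by omega
    rw [he1, List.range'_zero, wprod_nil, one_mul]
    refine ih (h.mono (by omega)) l' hl' ?_
    rw [h1, List.range'_zero, wprod_nil, one_mul] at he2
    exact he2.symm

end Coxeter

/-! ### The integral-reflection operators on continuous functions -/

/-- Continuous functions on `ℝ^N`. -/
abbrev CF (N : ℕ) : Type := C(Fin N → ℝ, ℂ)

theorem continuous_intOp {N : ℕ} (i k : Fin N) {f : (Fin N → ℝ) → ℂ} (hf : Continuous f) :
    Continuous (intOp i k f) := by
  unfold intOp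
  refine intervalIntegral.continuous_parametric_intervalIntegral_of_continuous (μ := volume)
    (f := fun x y => f (x - y • (Pi.single i (1 : ℝ) - Pi.single k (1 : ℝ)))) ?_ ?_
  · exact hf.comp (by fun_prop)
  · fun_prop

/-- The operator `s_{ik} + γ I_{ik}` on continuous functions. -/
def reflOp {N : ℕ} (γ : ℝ) (i k : Fin N) : Module.End ℂ (CF N) where
  toFun f := ⟨fun x => f (x ∘ Equiv.swap i k) + γ * intOp i k f x,
    (f.continuous.comp (continuous_pi fun _ => continuous_apply _)).add
      (continuous_const.mul (continuous_intOp i k f.continuous))⟩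
  map_add' f g := by
    ext x
    simp only [ContinuousMap.coe_mk, ContinuousMap.add_apply, intOp]
    rw [intervalIntegral.integral_add]
    · ring
    all_goals
      refine Continuous.intervalIntegrable ?_ _ _
      exact (ContinuousMap.continuous _).comp (by fun_prop)
  map_smul' c f := by
    ext x
    simp only [ContinuousMap.coe_mk, ContinuousMap.smul_apply, intOp, smul_eq_mul,
      intervalIntegral.integral_const_mul, RingHom.id_apply]
    ring

theorem reflOp_apply {N : ℕ} (γ : ℝ) (i k : Fin N) (f : CF N) (x : Fin N → ℝ) :
    reflOp γ i k f x = f (x ∘ Equiv.swap i k) + γ * ∫ y in (0 : ℝ)..(x i - x k),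
      f (x - y • (Pi.single i (1 : ℝ) - Pi.single k (1 : ℝ))) := rfl

/-- The plane wave as a continuous function. -/
def pw {N : ℕ} (lam : Fin N → ℂ) : CF N := ⟨planeWave lam, continuous_planeWave lam⟩

theorem pw_apply {N : ℕ} (lam : Fin N → ℂ) (x : Fin N → ℝ) :
    pw lam x = Complex.exp (Complex.I * ∑ j, lam j * (x j : ℂ)) := rfl

theorem pw_comp_swap {N : ℕ} (i k : Fin N) (lam : Fin N → ℂ) (x : Fin N → ℝ) :
    pw lam (x ∘ Equiv.swap i k) = pw (lam ∘ Equiv.swap i k) x := by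
  rw [pw_apply, pw_apply, ← Equiv.sum_comp (Equiv.swap i k)]
  simp

theorem pw_sub {N : ℕ} (i k : Fin N) (lam : Fin N → ℂ) (x : Fin N → ℝ) (y : ℝ) :
    pw lam (x - y • (Pi.single i (1 : ℝ) - Pi.single k (1 : ℝ)))
      = pw lam x * Complex.exp (Complex.I * (lam k - lam i) * y) := by
  rw [pw_apply, pw_apply, ← Complex.exp_add]
  congr 1
  simp only [Pi.sub_apply, Pi.smul_apply, smul_eq_mul, Complex.ofReal_sub, Complex.ofReal_mul,
    mul_sub, Finset.sum_sub_distrib, Pi.single_apply]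
  have h1 : ∀ p : Fin N, ∑ j, lam j * ((y : ℂ) * ((if j = p then (1 : ℝ) else 0 : ℝ) : ℂ))
      = lam p * y := fun p => by
    rw [Finset.sum_eq_single p (fun j _ hj => by simp [hj]) (by simp)]
    simp
  rw [h1, h1]
  ring

theorem comp_swap_eq {N : ℕ} {i k : Fin N} (hik : i ≠ k) (x : Fin N → ℝ) :
    x ∘ Equiv.swap i k
      = x - (x i - x k) • (Pi.single i (1 : ℝ) - Pi.single k (1 : ℝ)) := by
  ext j
  simp only [Function.comp, Pi.sub_apply, Pi.smul_apply, smul_eq_mul, Pi.single_apply,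
    Equiv.swap_apply_def]
  by_cases hi : j = i
  · subst hi; simp [hik]
  · by_cases hk : j = k
    · subst hk; simp [hi]
    · simp [hi, hk]

/-- Along e_i - e_k a plane wave is an exponential with rate proportional to λ_k - λ_i, so the
integral is elementary, and its upper end point is the swapped point. -/
theorem reflOp_pw {N : ℕ} (γ : ℝ) {i k : Fin N} (hik : i ≠ k) {lam : Fin N → ℂ}
    (h : lam i ≠ lam k) :
    reflOp γ i k (pw lam) = (1 + γ / (Complex.I * (lam k - lam i))) • pw (lam ∘ Equiv.swap i k)
      - (γ / (Complex.I * (lam k - lam i))) • pw lam := by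
  ext x
  have hc : Complex.I * (lam k - lam i) ≠ 0 :=
    mul_ne_zero Complex.I_ne_zero (sub_ne_zero.2 h.symm)
  have h1 : pw (lam ∘ Equiv.swap i k) x
      = pw lam x * Complex.exp (Complex.I * (lam k - lam i) * (x i - x k : ℝ)) := by
    rw [← pw_comp_swap, comp_swap_eq hik, pw_sub]
  simp only [reflOp_apply, pw_sub, intervalIntegral.integral_const_mul,
    integral_exp_mul_complex hc, ContinuousMap.sub_apply, ContinuousMap.smul_apply, smul_eq_mul,
    pw_comp_swap]
  rw [h1]
  simp only [Complex.ofReal_zero, mul_zero, Complex.exp_zero]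
  field_simp
  ring

/-! ### Bounds on cubes and density of plane waves -/

/-- The operator is bounded for the supremum over every cube. -/
def CubeBdd {N : ℕ} (S : Module.End ℂ (CF N)) : Prop :=
  ∀ a b : ℝ, ∃ K : ℝ, 0 ≤ K ∧ ∀ (f : CF N) (c : ℝ),
    (∀ x : Fin N → ℝ, (∀ k, x k ∈ Set.Icc a b) → ‖f x‖ ≤ c) →
      ∀ x : Fin N → ℝ, (∀ k, x k ∈ Set.Icc a b) → ‖S f x‖ ≤ K * c

theorem CubeBdd.one {N : ℕ} : CubeBdd (1 : Module.End ℂ (CF N)) :=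
  fun _ _ => ⟨1, zero_le_one, fun f c h x hx => by simpa using h x hx⟩

theorem CubeBdd.mul {N : ℕ} {S T : Module.End ℂ (CF N)} (hS : CubeBdd S) (hT : CubeBdd T) :
    CubeBdd (S * T) := by
  intro a b
  obtain ⟨K, hK, h1⟩ := hS a b
  obtain ⟨K', hK', h2⟩ := hT a b
  refine ⟨K * K', mul_nonneg hK hK', fun f c h x hx => ?_⟩
  rw [mul_assoc]
  exact h1 (T f) _ (h2 f c h) x hx

theorem CubeBdd.sub {N : ℕ} {S T : Module.End ℂ (CF N)} (hS : CubeBdd S) (hT : CubeBdd T) :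
    CubeBdd (S - T) := by
  intro a b
  obtain ⟨K, hK, h1⟩ := hS a b
  obtain ⟨K', hK', h2⟩ := hT a b
  refine ⟨K + K', add_nonneg hK hK', fun f c h x hx => ?_⟩
  rw [add_mul]
  exact (norm_sub_le _ _).trans (add_le_add (h1 f c h x hx) (h2 f c h x hx))

theorem cubeBdd_reflOp {N : ℕ} (γ : ℝ) {i k : Fin N} (hik : i ≠ k) : CubeBdd (reflOp γ i k) := by
  intro a b
  refine ⟨1 + |γ| * |b - a|, by positivity, fun f c h x hx => ?_⟩
  rw [reflOp_apply, add_mul, one_mul]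
  refine (norm_add_le _ _).trans (add_le_add (h _ fun j => hx _) ?_)
  rw [norm_mul, mul_assoc, Complex.norm_real, Real.norm_eq_abs]
  refine mul_le_mul_of_nonneg_left ?_ (abs_nonneg _)
  have hc : 0 ≤ c := (norm_nonneg _).trans (h x hx)
  have hle : |x i - x k - 0| ≤ |b - a| := by
    have h1 := hx i; have h2 := hx k
    rw [abs_of_nonneg (a := b - a) (by linarith [h1.1, h1.2]), abs_le]
    constructor <;> linarith [h1.1, h1.2, h2.1, h2.2]
  rw [mul_comm]
  refine (intervalIntegral.norm_integral_le_of_norm_le_const fun y hy => ?_).trans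
    (mul_le_mul_of_nonneg_left hle hc)
  refine h _ fun j => ?_
  have h1 := hx i; have h2 := hx k; have h3 := hx j
  simp only [Pi.sub_apply, Pi.smul_apply, smul_eq_mul, Pi.single_apply]
  rw [Set.mem_uIoc] at hy
  by_cases hi : j = i
  · subst hi
    rw [if_pos rfl, if_neg hik]
    rcases hy with hy | hy <;> constructor <;> linarith [h1.1, h1.2, h2.1, h2.2, hy.1, hy.2]
  · by_cases hk : j = k
    · subst hk
      rw [if_neg hi, if_pos rfl]
      rcases hy with hy | hy <;> constructor <;> linarith [h1.1, h1.2, h2.1, h2.2, hy.1, hy.2]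
    · simpa [hi, hk] using h3

/-- Stone–Weierstrass on the cube: plane waves are closed under products and, because the
frequencies are complex, under conjugation, so their span is already a star subalgebra. -/
theorem exists_span_pw_near {N : ℕ} (a b : ℝ) (f : CF N) {ε : ℝ} (hε : 0 < ε) :
    ∃ g ∈ Submodule.span ℂ (Set.range (pw (N := N))),
      ∀ x : Fin N → ℝ, (∀ k, x k ∈ Set.Icc a b) → ‖(f - g) x‖ ≤ ε := by
  set K : Set (Fin N → ℝ) := Set.univ.pi fun _ => Set.Icc a b with hK
  have : CompactSpace K := isCompact_iff_compactSpace.1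
    (isCompact_univ_pi fun _ => isCompact_Icc)
  let ι : C(K, Fin N → ℝ) := ⟨Subtype.val, continuous_subtype_val⟩
  let r : CF N →ₐ[ℂ] C(K, ℂ) := ContinuousMap.compRightAlgHom ℂ ℂ ι
  have hr : ∀ (h : CF N) (x : K), r h x = h x := fun _ _ => rfl
  set S : Set C(K, ℂ) := Set.range fun lam : Fin N → ℂ => r (pw lam) with hS
  have hstar : S ∪ star S = S := by
    refine Set.union_eq_self_of_subset_right ?_
    rintro g ⟨lam, hlam⟩
    refine ⟨fun j => -(starRingEnd ℂ) (lam j), ?_⟩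
    rw [← star_star g, ← hlam]
    ext x
    simp only [hr, ContinuousMap.star_apply, pw_apply, RCLike.star_def, ← Complex.exp_conj,
      map_mul, map_sum, Complex.conj_I, Complex.conj_ofReal, neg_mul, Finset.sum_neg_distrib,
      mul_neg]
  have hmon : ∀ g ∈ Submonoid.closure S, g ∈ S := by
    intro g hg
    induction hg using Submonoid.closure_induction with
    | mem x hx => exact hx
    | one => exact ⟨0, by ext x; simp [hr, pw_apply]⟩
    | mul x y _ _ hx hy =>
      obtain ⟨l1, rfl⟩ := hx
      obtain ⟨l2, rfl⟩ := hy
      refine ⟨l1 + l2, ?_⟩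
      ext x
      simp only [hr, ContinuousMap.mul_apply, pw_apply, ← Complex.exp_add, ← mul_add,
        ← Finset.sum_add_distrib, Pi.add_apply, add_mul]
  have hsep : (StarAlgebra.adjoin ℂ S).SeparatesPoints := by
    intro x y hxy
    obtain ⟨k, hk⟩ : ∃ k, x.1 k ≠ y.1 k := by
      by_contra hcon
      push Not at hcon
      exact hxy (Subtype.ext (funext hcon))
    -- The frequency -i in the k-th slot gives the real exponential of x_k, which is injective in
    -- x_k.
    refine ⟨_, ⟨r (pw (Pi.single k (-Complex.I))),
      StarAlgebra.subset_adjoin ℂ S ⟨_, rfl⟩, rfl⟩, ?_⟩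
    have hval : ∀ z : K, r (pw (Pi.single k (-Complex.I))) z = (Real.exp (z.1 k) : ℂ) := by
      intro z
      rw [hr, pw_apply]
      simp [Pi.single_apply, ← mul_assoc]
    intro h
    simp only [hval] at h
    exact hk (Real.exp_injective (Complex.ofReal_injective h))
  have htop := ContinuousMap.starSubalgebra_topologicalClosure_eq_top_of_separatesPoints
    (StarAlgebra.adjoin ℂ S) hsep
  have hmem : r f ∈ (StarAlgebra.adjoin ℂ S).topologicalClosure := by rw [htop]; trivial
  obtain ⟨g, hg, hdist⟩ := Metric.mem_closure_iff.1 hmem ε hε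
  have hg' : g ∈ Submodule.span ℂ S := by
    have h1 : g ∈ (StarAlgebra.adjoin ℂ S).toSubalgebra := hg
    rw [StarAlgebra.adjoin_toSubalgebra, hstar] at h1
    have h2 : g ∈ Subalgebra.toSubmodule (Algebra.adjoin ℂ S) := h1
    rw [Algebra.adjoin_eq_span] at h2
    exact Submodule.span_mono (fun g hg => hmon g hg) h2
  have hS' : S = r.toLinearMap '' Set.range (pw (N := N)) := by
    rw [hS, ← Set.range_comp]; rfl
  rw [hS', Submodule.span_image] at hg'
  obtain ⟨g', hg', rfl⟩ := hg'
  refine ⟨g', hg', fun x hx => ?_⟩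
  have h3 := (ContinuousMap.dist_lt_iff hε).1 hdist ⟨x, fun k _ => hx k⟩
  rw [dist_eq_norm] at h3
  exact h3.le

/-- Adding t j to the j-th frequency produces a collision for at most one t per pair of indices, and
compactness makes the perturbation uniformly small on the cube. This removes the distinctness
hypothesis of `reflOp_pw`. -/
theorem exists_injective_pw_near {N : ℕ} (a b : ℝ) (lam : Fin N → ℂ) {ε : ℝ} (hε : 0 < ε) :
    ∃ lam' : Fin N → ℂ, Function.Injective lam' ∧
      ∀ x : Fin N → ℝ, (∀ k, x k ∈ Set.Icc a b) → ‖(pw lam - pw lam') x‖ ≤ ε := by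
  let ρ : ℝ → Fin N → ℂ := fun t j => lam j + t * (j : ℕ)
  have h1 : ∀ᶠ t in nhdsWithin (0 : ℝ) {0}ᶜ, Function.Injective (ρ t) := by
    have h2 : ∀ p : Fin N × Fin N, p.1 ≠ p.2 →
        ∀ᶠ t in nhdsWithin (0 : ℝ) {0}ᶜ, ρ t p.1 ≠ ρ t p.2 := by
      intro p hp
      refine (nhdsNE_le_cofinite (0 : ℝ)) ?_
      have hs : {t : ℝ | ρ t p.1 = ρ t p.2}.Subsingleton := by
        intro s hs t ht
        simp only [Set.mem_ofPred_eq, ρ] at hs ht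
        have h3 : ((s : ℂ) - t) * (((p.1 : ℕ) : ℂ) - ((p.2 : ℕ) : ℂ)) = 0 := by
          linear_combination hs - ht
        rcases mul_eq_zero.1 h3 with h4 | h4
        · exact Complex.ofReal_injective (sub_eq_zero.1 h4)
        · exact absurd (Fin.ext (Nat.cast_injective (sub_eq_zero.1 h4))) hp
      have := hs.finite.compl_mem_cofinite
      filter_upwards [this] with t ht using ht
    have h3 : ∀ᶠ t in nhdsWithin (0 : ℝ) {0}ᶜ, ∀ p : Fin N × Fin N, p.1 ≠ p.2 →
        ρ t p.1 ≠ ρ t p.2 := by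
      rw [eventually_all]
      intro p
      by_cases hp : p.1 = p.2
      · simp [hp]
      · simpa [hp] using h2 p hp
    filter_upwards [h3] with t ht i j hij
    by_contra hne
    exact ht (i, j) hne hij
  have h2 : ∀ᶠ t in nhds (0 : ℝ), ∀ x ∈ Set.univ.pi fun _ : Fin N => Set.Icc a b,
      ‖(pw lam - pw (ρ t)) x‖ < ε := by
    refine (isCompact_univ_pi fun _ => isCompact_Icc).eventually_forall_of_forall_eventually ?_
    intro x _
    have hc : Continuous fun z : ℝ × (Fin N → ℝ) => ‖(pw lam - pw (ρ z.1)) z.2‖ := by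
      simp only [ContinuousMap.sub_apply, pw_apply, ρ]
      fun_prop
    refine hc.continuousAt.eventually_lt_const ?_
    simpa [ρ] using hε
  obtain ⟨t, ht1, ht2⟩ := (h1.and (h2.filter_mono nhdsWithin_le_nhds)).exists
  exact ⟨ρ t, ht1, fun x hx => (ht2 x fun k _ => hx k).le⟩

theorem exists_Icc_mem {N : ℕ} (x : Fin N → ℝ) : ∃ a b : ℝ, ∀ k, x k ∈ Set.Icc a b := by
  refine ⟨-∑ k, |x k|, ∑ k, |x k|, fun k => ?_⟩
  have h := Finset.single_le_sum (f := fun k => |x k|) (fun i _ => abs_nonneg (x i))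
    (Finset.mem_univ k)
  exact abs_le.1 h

theorem CubeBdd.apply_eq_zero_of_near {N : ℕ} {D : Module.End ℂ (CF N)} (hD : CubeBdd D)
    (f : CF N) (h : ∀ (a b : ℝ) (ε : ℝ), 0 < ε → ∃ g : CF N, D g = 0 ∧
      ∀ x : Fin N → ℝ, (∀ k, x k ∈ Set.Icc a b) → ‖(f - g) x‖ ≤ ε) : D f = 0 := by
  ext x
  obtain ⟨a, b, hx⟩ := exists_Icc_mem x
  obtain ⟨K, hK, hb⟩ := hD a b
  have h1 : ∀ ε : ℝ, 0 < ε → ‖D f x‖ ≤ K * ε := by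
    intro ε hε
    obtain ⟨g, hg, hfg⟩ := h a b ε hε
    have := hb (f - g) ε hfg x hx
    rwa [map_sub, hg, sub_zero] at this
  have h2 : ‖D f x‖ ≤ 0 := by
    refine le_of_forall_pos_le_add fun ε hε => ?_
    refine (h1 (ε / (K + 1)) (by positivity)).trans ?_
    rw [zero_add, mul_div_assoc', div_le_iff₀ (by positivity)]
    nlinarith
  simpa using norm_le_zero_iff.1 h2

/-- The difference kills plane waves with distinct frequencies, hence all plane waves by
perturbation, hence all continuous functions by density; both limits use
`CubeBdd.apply_eq_zero_of_near`. -/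
theorem CubeBdd.ext {N : ℕ} {S T : Module.End ℂ (CF N)} (hS : CubeBdd S) (hT : CubeBdd T)
    (h : ∀ lam : Fin N → ℂ, Function.Injective lam → S (pw lam) = T (pw lam)) : S = T := by
  have hD := hS.sub hT
  rw [← sub_eq_zero]
  have h1 : ∀ lam : Fin N → ℂ, (S - T) (pw lam) = 0 := fun lam =>
    hD.apply_eq_zero_of_near _ fun a b ε hε => by
      obtain ⟨lam', h1, h2⟩ := exists_injective_pw_near a b lam hε
      exact ⟨pw lam', by rw [LinearMap.sub_apply, h lam' h1, sub_self], h2⟩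
  refine LinearMap.ext fun f => hD.apply_eq_zero_of_near f fun a b ε hε => ?_
  obtain ⟨g, hg, hfg⟩ := exists_span_pw_near a b f hε
  refine ⟨g, ?_, hfg⟩
  have : Submodule.span ℂ (Set.range (pw (N := N))) ≤ LinearMap.ker (S - T) := by
    rw [Submodule.span_le]
    rintro _ ⟨lam, rfl⟩
    exact h1 lam
  exact this hg

/-! ### The Coxeter relations -/

/-- The coefficient c of `reflOp_pw` changes sign when the two frequencies are exchanged, and (1 +
c)(1 - c) + c² = 1. -/
theorem reflOp_sq {N : ℕ} (γ : ℝ) {i k : Fin N} (hik : i ≠ k) :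
    reflOp γ i k * reflOp γ i k = 1 := by
  have hb := cubeBdd_reflOp γ hik
  refine (hb.mul hb).ext CubeBdd.one fun lam hlam => ?_
  have h1 : lam i ≠ lam k := hlam.ne hik
  have h2 : (lam ∘ Equiv.swap i k) i ≠ (lam ∘ Equiv.swap i k) k := by simpa using h1.symm
  have h3 : (lam ∘ Equiv.swap i k) ∘ Equiv.swap i k = lam := by ext j; simp
  rw [Module.End.mul_apply, reflOp_pw γ hik h1, map_sub, map_smul, map_smul,
    reflOp_pw γ hik h2, reflOp_pw γ hik h1, h3, Module.End.one_apply]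
  simp only [Function.comp, Equiv.swap_apply_left, Equiv.swap_apply_right]
  have h4 := sub_ne_zero.2 h1
  have h5 := sub_ne_zero.2 h1.symm
  have h6 : (γ : ℂ) / (Complex.I * (lam i - lam k)) = -(γ / (Complex.I * (lam k - lam i))) := by
    rw [← neg_sub (lam k) (lam i), mul_neg, div_neg]
  rw [h6]
  module

theorem reflOp_comm {N : ℕ} (γ : ℝ) {i k p q : Fin N} (hik : i ≠ k) (hpq : p ≠ q)
    (hip : i ≠ p) (hiq : i ≠ q) (hkp : k ≠ p) (hkq : k ≠ q) :
    reflOp γ i k * reflOp γ p q = reflOp γ p q * reflOp γ i k := by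
  have hb := cubeBdd_reflOp γ hik
  have hb' := cubeBdd_reflOp γ hpq
  refine (hb.mul hb').ext (hb'.mul hb) fun lam hlam => ?_
  have h1 : lam i ≠ lam k := hlam.ne hik
  have h2 : lam p ≠ lam q := hlam.ne hpq
  have e1 : (lam ∘ Equiv.swap p q) i = lam i := by
    simp [Equiv.swap_apply_of_ne_of_ne hip hiq]
  have e2 : (lam ∘ Equiv.swap p q) k = lam k := by
    simp [Equiv.swap_apply_of_ne_of_ne hkp hkq]
  have e3 : (lam ∘ Equiv.swap i k) p = lam p := by
    simp [Equiv.swap_apply_of_ne_of_ne hip.symm hkp.symm]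
  have e4 : (lam ∘ Equiv.swap i k) q = lam q := by
    simp [Equiv.swap_apply_of_ne_of_ne hiq.symm hkq.symm]
  have e5 : (lam ∘ Equiv.swap i k) ∘ Equiv.swap p q
      = (lam ∘ Equiv.swap p q) ∘ Equiv.swap i k := by
    ext j
    simp only [Function.comp, Equiv.swap_apply_def]
    congr 1
    split_ifs <;> simp_all
  rw [Module.End.mul_apply, Module.End.mul_apply, reflOp_pw γ hik h1, reflOp_pw γ hpq h2]
  simp only [map_sub, map_smul]
  rw [reflOp_pw γ hik (lam := lam ∘ Equiv.swap p q) (by rwa [e1, e2]),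
    reflOp_pw γ hpq (lam := lam ∘ Equiv.swap i k) (by rwa [e3, e4]),
    reflOp_pw γ hik h1, reflOp_pw γ hpq h2, e1, e2, e3, e4, e5]
  module

/-- On a plane wave both sides are combinations of the waves with permuted frequencies; their
coefficients agree by one partial fraction identity. -/
theorem reflOp_braid {N : ℕ} (γ : ℝ) {p q r : Fin N} (hpq : p ≠ q) (hqr : q ≠ r) (hpr : p ≠ r) :
    reflOp γ p q * reflOp γ q r * reflOp γ p q = reflOp γ q r * reflOp γ p q * reflOp γ q r := by
  have hb := cubeBdd_reflOp γ hpq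
  have hb' := cubeBdd_reflOp γ hqr
  refine ((hb.mul hb').mul hb).ext ((hb'.mul hb).mul hb') fun lam hlam => ?_
  set s := Equiv.swap p q with hs
  set t := Equiv.swap q r with ht
  have sp : s p = q := Equiv.swap_apply_left _ _
  have sq : s q = p := Equiv.swap_apply_right _ _
  have sr : s r = r := Equiv.swap_apply_of_ne_of_ne hpr.symm hqr.symm
  have tp : t p = p := Equiv.swap_apply_of_ne_of_ne hpq hpr
  have tq : t q = r := Equiv.swap_apply_left _ _
  have tr : t r = q := Equiv.swap_apply_right _ _
  have hss : (lam ∘ s) ∘ s = lam := by ext j; simp [hs]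
  have htt : (lam ∘ t) ∘ t = lam := by ext j; simp [ht]
  have hb1 : ((lam ∘ s) ∘ t) ∘ s = ((lam ∘ t) ∘ s) ∘ t := by
    ext j
    have : s * t * s = t * s * t := by
      rw [hs, ht, Equiv.swap_mul_swap_mul_swap hpq hpr, Equiv.swap_comm q r, Equiv.swap_comm p q,
        Equiv.swap_mul_swap_mul_swap hqr.symm hpr.symm, Equiv.swap_comm]
    exact congrArg (fun σ : Equiv.Perm (Fin N) => lam (σ j)) this
  have R : ∀ nu : Fin N → ℂ, Function.Injective nu → reflOp γ p q (pw nu)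
      = (1 + γ / (Complex.I * (nu q - nu p))) • pw (nu ∘ s)
        - (γ / (Complex.I * (nu q - nu p))) • pw nu := fun nu hnu =>
    reflOp_pw γ hpq (hnu.ne hpq)
  have R' : ∀ nu : Fin N → ℂ, Function.Injective nu → reflOp γ q r (pw nu)
      = (1 + γ / (Complex.I * (nu r - nu q))) • pw (nu ∘ t)
        - (γ / (Complex.I * (nu r - nu q))) • pw nu := fun nu hnu =>
    reflOp_pw γ hqr (hnu.ne hqr)
  have i1 : Function.Injective (lam ∘ s) := hlam.comp s.injective
  have i2 : Function.Injective (lam ∘ t) := hlam.comp t.injective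
  have i3 : Function.Injective ((lam ∘ s) ∘ t) := i1.comp t.injective
  have i4 : Function.Injective ((lam ∘ t) ∘ s) := i2.comp s.injective
  simp only [Module.End.mul_apply]
  rw [R lam hlam, R' lam hlam]
  simp only [map_sub, map_smul]
  rw [R' _ i1, R' lam hlam, R _ i2, R lam hlam]
  simp only [map_sub, map_smul]
  rw [R _ i3, R _ i1, R _ i2, R lam hlam, R' _ i4, R' _ i2, R' _ i1, R' lam hlam, hss, htt, hb1]
  simp only [Function.comp, sp, sq, sr, tp, tq, tr]
  have n1 : lam q - lam p ≠ 0 := sub_ne_zero.2 (hlam.ne hpq.symm)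
  have n2 : lam r - lam q ≠ 0 := sub_ne_zero.2 (hlam.ne hqr.symm)
  have n3 : lam r - lam p ≠ 0 := sub_ne_zero.2 (hlam.ne hpr.symm)
  have m1 : (γ : ℂ) / (Complex.I * (lam p - lam q)) = -(γ / (Complex.I * (lam q - lam p))) := by
    rw [← neg_sub (lam q) (lam p), mul_neg, div_neg]
  have m2 : (γ : ℂ) / (Complex.I * (lam q - lam r)) = -(γ / (Complex.I * (lam r - lam q))) := by
    rw [← neg_sub (lam r) (lam q), mul_neg, div_neg]
  rw [m1, m2]
  set A := (γ : ℂ) / (Complex.I * (lam q - lam p)) with hA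
  set B := (γ : ℂ) / (Complex.I * (lam r - lam q)) with hB
  set C := (γ : ℂ) / (Complex.I * (lam r - lam p)) with hC
  -- The denominators of A and B add up to that of C.
  have hABC : A * B = C * (A + B) := by
    rw [hA, hB, hC]
    have := Complex.I_ne_zero
    field_simp
    ring
  ext x
  simp only [ContinuousMap.sub_apply, ContinuousMap.smul_apply, smul_eq_mul]
  -- Only the coefficients of the waves at λ ∘ s, λ ∘ t and λ need the identity.
  linear_combination
    ((1 + A) * pw (lam ∘ s) x - (1 + B) * pw (lam ∘ t) x + (B - A) * pw lam x) * hABC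

/-! ### The simple integral-reflection operators and their words -/

/-- The operator `s_j^γ` on continuous functions, and the identity for `j` out of range. -/
def T (γ : ℝ) (N j : ℕ) : Module.End ℂ (CF N) :=
  if h : j + 1 < N then reflOp γ ⟨j, by omega⟩ ⟨j + 1, h⟩ else 1

/-- The simple transposition on `Fin N`, and the identity for `j` out of range. -/
def finSwap (N j : ℕ) : Equiv.Perm (Fin N) :=
  if h : j + 1 < N then Equiv.swap ⟨j, by omega⟩ ⟨j + 1, h⟩ else 1

theorem T_of_lt (γ : ℝ) {N j : ℕ} (h : j + 1 < N) :
    T γ N j = reflOp γ ⟨j, by omega⟩ ⟨j + 1, h⟩ := dif_pos h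

theorem finSwap_of_lt {N j : ℕ} (h : j + 1 < N) :
    finSwap N j = Equiv.swap ⟨j, by omega⟩ ⟨j + 1, h⟩ := dif_pos h

theorem isCoxeterA_T (γ : ℝ) (N : ℕ) : IsCoxeterA (T γ N) (N - 1) where
  sq j hj := by
    rw [T_of_lt γ (show j + 1 < N by omega)]
    exact reflOp_sq γ (by simp)
  comm i j hij hj := by
    rw [T_of_lt γ (show j + 1 < N by omega), T_of_lt γ (show i + 1 < N by omega)]
    refine reflOp_comm γ ?_ ?_ ?_ ?_ ?_ ?_ <;> simp only [ne_eq, Fin.mk.injEq] <;> omega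
  braid j hj := by
    rw [T_of_lt γ (show j + 1 < N by omega), T_of_lt γ (show j + 1 + 1 < N by omega)]
    refine reflOp_braid γ ?_ ?_ ?_ <;> simp only [ne_eq, Fin.mk.injEq] <;> omega

theorem cubeBdd_T (γ : ℝ) (N j : ℕ) : CubeBdd (T γ N j) := by
  by_cases h : j + 1 < N
  · rw [T_of_lt γ h]; exact cubeBdd_reflOp γ (by simp)
  · rw [T, dif_neg h]; exact CubeBdd.one

theorem cubeBdd_wprod (γ : ℝ) (N : ℕ) (l : List ℕ) : CubeBdd (wprod (T γ N) l) := by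
  induction l with
  | nil => exact CubeBdd.one
  | cons j l ih => rw [wprod_cons]; exact (cubeBdd_T γ N j).mul ih

/-- On the wall of the j-th reflection the swap does nothing and the integral runs over an empty
range. -/
theorem T_apply_of_comp_eq (γ : ℝ) {N j : ℕ} (f : CF N) {x : Fin N → ℝ}
    (h : x ∘ finSwap N j = x) : T γ N j f x = f x := by
  by_cases hj : j + 1 < N
  · rw [T_of_lt γ hj]
    rw [finSwap_of_lt hj] at h
    have h1 := congrFun h ⟨j, by omega⟩
    simp only [Function.comp, Equiv.swap_apply_left] at h1
    rw [reflOp_apply, h, h1, sub_self, intervalIntegral.integral_same, mul_zero, add_zero]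
  · rw [T, dif_neg hj]; rfl

theorem coe_finSwap_eq {N : ℕ} (j : ℕ) (hj : j + 1 < N) :
    Equiv.Perm.viaEmbeddingHom (Fin.valEmbedding (n := N)) (finSwap N j) = natSwap j := by
  ext a
  rw [Equiv.Perm.viaEmbeddingHom_apply]
  by_cases ha : a < N
  · have h1 := Equiv.Perm.viaEmbedding_apply (finSwap N j) (Fin.valEmbedding (n := N)) ⟨a, ha⟩
    rw [Fin.valEmbedding_apply] at h1
    rw [h1, finSwap_of_lt hj, natSwap]
    simp only [Equiv.swap_apply_def, Fin.mk.injEq]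
    split_ifs <;> rfl
  · rw [Equiv.Perm.viaEmbedding_apply_of_notMem]
    · exact (Equiv.swap_apply_of_ne_of_ne (by omega) (by omega)).symm
    · rintro ⟨b, rfl⟩
      exact ha b.2

theorem coe_wprod_finSwap {N : ℕ} (l : List ℕ) (hl : ∀ j ∈ l, j + 1 < N) :
    Equiv.Perm.viaEmbeddingHom (Fin.valEmbedding (n := N)) (wprod (finSwap N) l)
      = wprod natSwap l := by
  induction l with
  | nil => simp
  | cons j l ih =>
    rw [wprod_cons, wprod_cons, map_mul, coe_finSwap_eq j (hl j List.mem_cons_self),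
      ih fun i hi => hl i (List.mem_cons_of_mem _ hi)]

theorem IsCoxeterA.wprod_reverse_mul {M : Type*} [Monoid M] {t : ℕ → M} {n : ℕ}
    (h : IsCoxeterA t n) (l : List ℕ) (hl : ∀ j ∈ l, j < n) :
    wprod t l * wprod t l.reverse = 1 := by
  induction l with
  | nil => simp
  | cons j l ih =>
    rw [List.reverse_cons, wprod_append, wprod_cons, wprod_cons, wprod_nil, mul_one, mul_assoc,
      ← mul_assoc (wprod t l), ih fun i hi => hl i (List.mem_cons_of_mem _ hi), one_mul,
      h.sq j (hl j List.mem_cons_self)]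

/-- This is the independence of w^γ from the decomposition of w: the reverse of l' followed by l is
trivial as a permutation, and `IsCoxeterA.wprod_eq_one` applies. -/
theorem wprod_T_eq (γ : ℝ) {N : ℕ} {l l' : List ℕ} (hl : ∀ j ∈ l, j + 1 < N)
    (hl' : ∀ j ∈ l', j + 1 < N) (h : wprod (finSwap N) l = wprod (finSwap N) l') :
    wprod (T γ N) l = wprod (T γ N) l' := by
  have hT := isCoxeterA_T γ N
  have hl1 : ∀ j ∈ l, j < N - 1 := fun j hj => by have := hl j hj; omega
  have hl1' : ∀ j ∈ l', j < N - 1 := fun j hj => by have := hl' j hj; omega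
  have hs := isCoxeterA_natSwap (N - 1)
  have h1 : wprod natSwap (l'.reverse ++ l) = 1 := by
    rw [wprod_append, ← coe_wprod_finSwap l hl, h, coe_wprod_finSwap l' hl']
    have := hs.wprod_reverse_mul l'.reverse (by simpa using hl1')
    rwa [List.reverse_reverse] at this
  have h2 := hT.wprod_eq_one (l'.reverse ++ l) (by
    intro j hj
    rw [List.mem_append, List.mem_reverse] at hj
    exact hj.elim (hl1' j) (hl1 j)) h1
  rw [wprod_append] at h2
  calc wprod (T γ N) l
      = (wprod (T γ N) l' * wprod (T γ N) l'.reverse) * wprod (T γ N) l := by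
        rw [hT.wprod_reverse_mul l' hl1', one_mul]
    _ = wprod (T γ N) l' := by rw [mul_assoc, h2, mul_one]

theorem wordRefl_eq_wprod (γ : ℝ) {N : ℕ} (l : List (Fin (N - 1))) (f : CF N) :
    wordRefl γ l f = wprod (T γ N) (l.map Fin.val) f := by
  induction l with
  | nil => rfl
  | cons j l ih =>
    have h1 : wordRefl γ (j :: l) f = intRefl γ j (wordRefl γ l f) := rfl
    rw [h1, ih, List.map_cons, wprod_cons, T_of_lt γ (show (j : ℕ) + 1 < N by omega)]
    rfl

theorem prod_simpleSwap {N : ℕ} (l : List (Fin (N - 1))) :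
    (l.map simpleSwap).prod = wprod (finSwap N) (l.map Fin.val) := by
  induction l with
  | nil => rfl
  | cons j l ih =>
    rw [List.map_cons, List.prod_cons, ih, List.map_cons, wprod_cons,
      finSwap_of_lt (show (j : ℕ) + 1 < N by omega)]
    rfl

theorem mem_map_val_lt {N : ℕ} (l : List (Fin (N - 1))) : ∀ j ∈ l.map Fin.val, j + 1 < N := by
  intro j hj
  obtain ⟨i, -, rfl⟩ := List.mem_map.1 hj
  omega

theorem exists_wprod_finSwap {N : ℕ} (w : Equiv.Perm (Fin N)) :
    ∃ l : List ℕ, (∀ j ∈ l, j + 1 < N) ∧ wprod (finSwap N) l = w := by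
  obtain ⟨l, hl⟩ := exists_word w
  exact ⟨l.map Fin.val, mem_map_val_lt l, by rw [← prod_simpleSwap, hl]⟩

theorem permRefl_wprod (γ : ℝ) {N : ℕ} {l : List ℕ} (hl : ∀ j ∈ l, j + 1 < N) (f : CF N) :
    permRefl γ (wprod (finSwap N) l) f = wprod (T γ N) l f := by
  rw [permRefl, wordRefl_eq_wprod]
  rw [wprod_T_eq γ (mem_map_val_lt _) hl]
  rw [← prod_simpleSwap, (exists_word _).choose_spec]

/-! ### The propagation operator on continuous functions -/

theorem exists_descent {N : ℕ} {u : Equiv.Perm (Fin N)} (hu : u ≠ 1) :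
    ∃ (j : ℕ) (h : j + 1 < N), u ⟨j + 1, h⟩ < u ⟨j, by omega⟩ := by
  by_contra hcon
  push Not at hcon
  refine hu ?_
  have hmono : Monotone u := by
    cases N with
    | zero => intro a; exact a.elim0
    | succ n =>
      refine Fin.monotone_iff_le_succ.2 fun i => ?_
      exact hcon i (by omega)
  have h1 : u = (1 : Equiv.Perm (Fin N)) := by
    have hs : StrictMono u := hmono.strictMono_of_injective u.injective
    have h2 := Subsingleton.elim (StrictMono.orderIsoOfSurjective u hs u.surjective)
      (OrderIso.refl _)
    ext a
    exact congrArg (fun e : Fin N ≃o Fin N => ((e a : Fin N) : ℕ)) h2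
  exact h1

theorem sum_mul_finSwap {N j : ℕ} (h : j + 1 < N) (u : Fin N → ℤ) :
    ∑ i : Fin N, (i : ℤ) * u (finSwap N j i)
      = ∑ i : Fin N, (i : ℤ) * u i + (u ⟨j, by omega⟩ - u ⟨j + 1, h⟩) := by
  rw [← sub_eq_iff_eq_add', ← Finset.sum_sub_distrib,
    Finset.sum_eq_add (⟨j, by omega⟩ : Fin N) ⟨j + 1, h⟩ (by simp)]
  · rw [finSwap_of_lt h, Equiv.swap_apply_left, Equiv.swap_apply_right]
    push_cast
    ring
  · rintro c - ⟨h1, h2⟩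
    rw [finSwap_of_lt h, Equiv.swap_apply_of_ne_of_ne h1 h2, sub_self]
  · simp
  · simp

/-- The stabilizer of a point of the closed chamber is generated by the simple swaps that fix it. At
a descent j of v⁻¹, invariance and monotonicity of z force z_j = z_{j+1}, so the j-th swap can be
split off, and its reflection is invisible at z by `T_apply_of_comp_eq`. -/
theorem exists_stabilizer_word (γ : ℝ) {N : ℕ} {z : Fin N → ℝ} (hz : Antitone z)
    (v : Equiv.Perm (Fin N)) (hv : z ∘ v = z) :
    ∃ l : List ℕ, (∀ j ∈ l, j + 1 < N) ∧ wprod (finSwap N) l = v ∧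
      ∀ f : CF N, wprod (T γ N) l f z = f z := by
  have hmain : ∀ (n : ℕ) (v : Equiv.Perm (Fin N)), z ∘ v = z →
      -- The sum of i v⁻¹(i) grows strictly when a descent of v⁻¹ is removed and is bounded by N ·
      -- N², so the difference serves as induction measure.
      (N : ℤ) * (N * N) - ∑ i : Fin N, (i : ℤ) * ((v⁻¹ i : Fin N) : ℤ) ≤ n →
      ∃ l : List ℕ, (∀ j ∈ l, j + 1 < N) ∧ wprod (finSwap N) l = v ∧
        ∀ f : CF N, wprod (T γ N) l f z = f z := by
    intro n
    induction n with
    | zero =>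
      intro v hv hn
      by_cases hv1 : v = 1
      · exact ⟨[], by simp, hv1.symm, fun f => rfl⟩
      · exfalso
        obtain ⟨j, hj, -⟩ := exists_descent (inv_ne_one.2 hv1)
        have hb : ∑ i : Fin N, (i : ℤ) * ((v⁻¹ i : Fin N) : ℤ)
            < ∑ _i : Fin N, (N : ℤ) * N := by
          refine Finset.sum_lt_sum_of_nonempty ⟨⟨j, by omega⟩, Finset.mem_univ _⟩ fun i _ => ?_
          have h1 : (i : ℤ) < N := by exact_mod_cast i.2
          have h2 : ((v⁻¹ i : Fin N) : ℤ) < N := by exact_mod_cast (v⁻¹ i).2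
          have h3 : (0 : ℤ) ≤ (i : ℤ) := by positivity
          have h4 : (0 : ℤ) ≤ ((v⁻¹ i : Fin N) : ℤ) := by positivity
          nlinarith
        rw [Finset.sum_const, Finset.card_univ, Fintype.card_fin, nsmul_eq_mul] at hb
        push_cast at hn
        linarith
    | succ n ih =>
      intro v hv hn
      by_cases hv1 : v = 1
      · exact ⟨[], by simp, hv1.symm, fun f => rfl⟩
      obtain ⟨j, hj, hdesc⟩ := exists_descent (inv_ne_one.2 hv1)
      have hv' : z ∘ ⇑(v⁻¹) = z := by
        conv_lhs => rw [← hv]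
        ext i; simp
      have hzj : z ⟨j, by omega⟩ = z ⟨j + 1, hj⟩ := by
        refine le_antisymm ?_ (hz (by simp [Fin.le_def]))
        have h1 := congrFun hv' ⟨j, by omega⟩
        have h2 := congrFun hv' ⟨j + 1, hj⟩
        simp only [Function.comp] at h1 h2
        rw [← h1, ← h2]
        exact hz hdesc.le
      have hzs : z ∘ finSwap N j = z := by
        ext i
        rw [finSwap_of_lt hj]
        simp only [Function.comp, Equiv.swap_apply_def]
        split_ifs with h1 h2
        · rw [h1, hzj]
        · rw [h2, hzj]
        · rfl
      have hss : finSwap N j * finSwap N j = 1 := by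
        rw [finSwap_of_lt hj]; exact Equiv.swap_mul_self _ _
      obtain ⟨l, hl, hlv, hlf⟩ := ih (finSwap N j * v) (by
          ext i
          have h1 := congrFun hzs (v i)
          have h2 := congrFun hv i
          simp only [Function.comp, Equiv.Perm.mul_apply] at h1 h2 ⊢
          rw [h1, h2]) (by
          have h1 := sum_mul_finSwap hj fun i => ((v⁻¹ i : Fin N) : ℤ)
          have h2 : ∀ i, (finSwap N j * v)⁻¹ i = v⁻¹ (finSwap N j i) := fun i => by
            rw [mul_inv_rev, Equiv.Perm.mul_apply, inv_eq_of_mul_eq_one_left hss]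
          simp only [h2]
          rw [h1]
          have h3 : ((v⁻¹ ⟨j + 1, hj⟩ : Fin N) : ℤ) < ((v⁻¹ ⟨j, by omega⟩ : Fin N) : ℤ) := by
            exact_mod_cast hdesc
          push_cast at hn
          linarith)
      refine ⟨j :: l, by simpa using ⟨hj, hl⟩, ?_, fun f => ?_⟩
      · rw [wprod_cons, hlv, ← mul_assoc, hss, one_mul]
      · rw [wprod_cons, Module.End.mul_apply, T_apply_of_comp_eq γ _ hzs, hlf]
  exact hmain ((N : ℤ) * (N * N) - ∑ i : Fin N, (i : ℤ) * ((v⁻¹ i : Fin N) : ℤ)).toNat v hv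
    (Int.self_le_toNat _)

/-- The rearrangement of the coordinates of `x` by the permutation of a word. -/
def rearr {N : ℕ} (l : List ℕ) (x : Fin N → ℝ) : Fin N → ℝ := x ∘ ⇑((wprod (finSwap N) l)⁻¹)

theorem finSwap_inv (N j : ℕ) : (finSwap N j)⁻¹ = finSwap N j := by
  rw [finSwap]; split_ifs
  · exact Equiv.swap_inv _ _
  · exact inv_one

theorem rearr_cons {N : ℕ} (j : ℕ) (l : List ℕ) (x : Fin N → ℝ) :
    rearr (j :: l) x = rearr l x ∘ finSwap N j := by
  rw [rearr, rearr, wprod_cons, mul_inv_rev, finSwap_inv]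
  rfl

theorem continuous_rearr {N : ℕ} (l : List ℕ) : Continuous (rearr (N := N) l) :=
  continuous_pi fun _ => continuous_apply _

theorem exists_antitone_rearr {N : ℕ} (x : Fin N → ℝ) :
    ∃ l : List ℕ, (∀ j ∈ l, j + 1 < N) ∧ wprod (finSwap N) l = chamberPerm x ∧
      Antitone (rearr l x) := by
  obtain ⟨l, hl, he⟩ := exists_wprod_finSwap (chamberPerm x)
  refine ⟨l, hl, he, ?_⟩
  rw [rearr, he]
  exact antitone_chamberPerm x

/-- Two words that sort x yield the same sorted point and differ by a stabilizer element, whose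
reflections have no effect there. Hence the choice of chamber on a wall is immaterial; this also
gives continuity across walls. -/
theorem propagation_eq (γ : ℝ) {N : ℕ} (f : CF N) {x : Fin N → ℝ} {l : List ℕ}
    (hl : ∀ j ∈ l, j + 1 < N) (hs : Antitone (rearr l x)) :
    propagation γ f x = wprod (T γ N) l f (rearr l x) := by
  obtain ⟨l0, hl0, he, hs0⟩ := exists_antitone_rearr x
  have hz : rearr l0 x = rearr l x := by
    have h1 : Monotone ((fun i => -x i) ∘ ⇑((wprod (finSwap N) l0)⁻¹)) := fun a b hab =>
      neg_le_neg (hs0 hab)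
    have h2 : Monotone ((fun i => -x i) ∘ ⇑((wprod (finSwap N) l)⁻¹)) := fun a b hab =>
      neg_le_neg (hs hab)
    have h3 := Tuple.unique_monotone h1 h2
    ext i
    exact neg_injective (congrFun h3 i)
  have h0 : propagation γ f x = wprod (T γ N) l0 f (rearr l0 x) := by
    rw [propagation, ← he, permRefl_wprod γ hl0]
    rfl
  rw [h0]
  obtain ⟨lv, hlv, hev, hf⟩ := exists_stabilizer_word γ hs
    (wprod (finSwap N) l0 * (wprod (finSwap N) l)⁻¹) (by
      ext i
      have h4 := congrFun hz (wprod (finSwap N) l0 ((wprod (finSwap N) l)⁻¹ i))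
      simp only [Function.comp, Equiv.Perm.mul_apply]
      rw [← h4]
      simp [rearr])
  have h5 : wprod (T γ N) l0 = wprod (T γ N) (lv ++ l) := by
    refine wprod_T_eq γ hl0 (fun j hj => (List.mem_append.1 hj).elim (hlv j) (hl j)) ?_
    rw [wprod_append, hev]
    simp
  rw [h5, wprod_append, Module.End.mul_apply, hz, hf]

theorem continuous_propagation (γ : ℝ) {N : ℕ} (f : CF N) : Continuous (propagation γ f) := by
  refine LocallyFinite.continuous (f := fun w : Equiv.Perm (Fin N) => {x | Antitone (x ∘ ⇑(w⁻¹))})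
    (locallyFinite_of_finite _) ?_ (fun w => ?_) fun w => ?_
  · refine Set.eq_univ_of_forall fun x => Set.mem_iUnion.2 ⟨chamberPerm x, ?_⟩
    exact antitone_chamberPerm x
  · have : {x : Fin N → ℝ | Antitone (x ∘ ⇑(w⁻¹))}
        = ⋂ a, ⋂ b, ⋂ (_ : a ≤ b), {x : Fin N → ℝ | x (w⁻¹ b) ≤ x (w⁻¹ a)} := by
      ext x
      simp only [Set.mem_iInter]
      exact Iff.rfl
    rw [this]
    exact isClosed_iInter fun a => isClosed_iInter fun b => isClosed_iInter fun _ =>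
      isClosed_le (continuous_apply _) (continuous_apply _)
  · obtain ⟨l, hl, rfl⟩ := exists_wprod_finSwap w
    refine ContinuousOn.congr (f := fun x => wprod (T γ N) l f (rearr l x)) ?_ fun x hx =>
      propagation_eq γ f hl hx
    exact ((ContinuousMap.continuous _).comp (continuous_rearr l)).continuousOn

/-- The propagation operator on continuous functions. -/
def propOp (γ : ℝ) (N : ℕ) : Module.End ℂ (CF N) where
  toFun f := ⟨propagation γ f, continuous_propagation γ f⟩
  map_add' f g := by
    ext x
    obtain ⟨l, hl, -, hs⟩ := exists_antitone_rearr x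
    simp only [ContinuousMap.coe_mk, ContinuousMap.add_apply]
    rw [propagation_eq γ _ hl hs, propagation_eq γ f hl hs, propagation_eq γ g hl hs, map_add,
      ContinuousMap.add_apply]
  map_smul' c f := by
    ext x
    obtain ⟨l, hl, -, hs⟩ := exists_antitone_rearr x
    simp only [ContinuousMap.coe_mk, ContinuousMap.smul_apply, RingHom.id_apply]
    rw [propagation_eq γ _ hl hs, propagation_eq γ f hl hs, map_smul, ContinuousMap.smul_apply]

theorem propOp_eq (γ : ℝ) {N : ℕ} (f : CF N) {x : Fin N → ℝ} {l : List ℕ}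
    (hl : ∀ j ∈ l, j + 1 < N) (hs : Antitone (rearr l x)) :
    propOp γ N f x = wprod (T γ N) l f (rearr l x) := propagation_eq γ f hl hs

theorem propOp_of_antitone (γ : ℝ) {N : ℕ} (f : CF N) {x : Fin N → ℝ} (hx : Antitone x) :
    propOp γ N f x = f x := propOp_eq γ f (l := []) (by simp) hx

/-- A word that sorts the rearranged point, followed by l, sorts x itself. -/
theorem propOp_rearr (γ : ℝ) {N : ℕ} (f : CF N) (x : Fin N → ℝ) {l : List ℕ}
    (hl : ∀ j ∈ l, j + 1 < N) :
    propOp γ N (wprod (T γ N) l f) (rearr l x) = propOp γ N f x := by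
  obtain ⟨l0, hl0, -, hs⟩ := exists_antitone_rearr (rearr l x)
  have h1 : rearr (l0 ++ l) x = rearr l0 (rearr l x) := by
    rw [rearr, wprod_append, mul_inv_rev]; rfl
  rw [propOp_eq γ _ hl0 hs, propOp_eq γ f (l := l0 ++ l)
    (fun j hj => (List.mem_append.1 hj).elim (hl0 j) (hl j)) (by rwa [h1]), h1, wprod_append,
    Module.End.mul_apply]

theorem cubeBdd_propOp (γ : ℝ) (N : ℕ) : CubeBdd (propOp γ N) := by
  intro a b
  choose wd hwd hwe using fun w : Equiv.Perm (Fin N) => exists_wprod_finSwap w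
  choose K hK hb using fun w => cubeBdd_wprod γ N (wd w) a b
  refine ⟨∑ w, K w, Finset.sum_nonneg fun w _ => hK w, fun f c h x hx => ?_⟩
  have hc : 0 ≤ c := (norm_nonneg _).trans (h x hx)
  have hs : Antitone (rearr (wd (chamberPerm x)) x) := by
    rw [rearr, hwe]; exact antitone_chamberPerm x
  rw [propOp_eq γ f (hwd (chamberPerm x)) hs]
  refine (hb (chamberPerm x) f c h _ fun k => hx _).trans (mul_le_mul_of_nonneg_right ?_ hc)
  exact Finset.single_le_sum (fun w _ => hK w) (Finset.mem_univ _)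

/-! ### Adding and evaluating variables -/

/-- Evaluation of the first variable. -/
def consEval {N : ℕ} (a : ℝ) : CF (N + 1) →ₗ[ℂ] CF N where
  toFun f := ⟨fun x => f (Fin.cons (α := fun _ => ℝ) a x), f.continuous.comp (by fun_prop)⟩
  map_add' _ _ := rfl
  map_smul' _ _ := rfl

theorem consEval_apply {N : ℕ} (a : ℝ) (f : CF (N + 1)) (x : Fin N → ℝ) :
    consEval a f x = f (Fin.cons (α := fun _ => ℝ) a x) := rfl

/-- The product of `f` with the plane wave of frequency `μ` in a new last variable. -/
def tens {N : ℕ} (μ : ℂ) : CF N →ₗ[ℂ] CF (N + 1) where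
  toFun f := ⟨fun x => f (fun k => x k.castSucc) * Complex.exp (Complex.I * μ * x (Fin.last N)),
    (f.continuous.comp (by fun_prop)).mul (by fun_prop)⟩
  map_add' f g := by ext x; simp [add_mul]
  map_smul' c f := by ext x; simp [mul_assoc]

theorem tens_apply {N : ℕ} (μ : ℂ) (f : CF N) (x : Fin (N + 1) → ℝ) :
    tens μ f x = f (fun k => x k.castSucc) * Complex.exp (Complex.I * μ * x (Fin.last N)) := rfl

theorem consEval_reflOp {N : ℕ} (γ a : ℝ) (i k : Fin N) (f : CF (N + 1)) :
    consEval a (reflOp γ i.succ k.succ f) = reflOp γ i k (consEval a f) := by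
  ext x
  simp only [consEval_apply, reflOp_apply, Fin.cons_succ]
  congr 2
  · ext j
    refine Fin.cases ?_ (fun j => ?_) j
    · simp [Equiv.swap_apply_of_ne_of_ne (Fin.succ_ne_zero i).symm (Fin.succ_ne_zero k).symm]
    · simp only [Function.comp, Fin.cons_succ, Equiv.swap_apply_def, Fin.succ_inj]
      split_ifs <;> simp
  · congr 1
    ext y
    congr 1
    ext j
    refine Fin.cases ?_ (fun j => ?_) j
    · simp [(Fin.succ_ne_zero i).symm, (Fin.succ_ne_zero k).symm]
    · simp [Pi.single_apply, Fin.succ_inj]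

theorem consEval_T (γ a : ℝ) {N j : ℕ} (f : CF (N + 1)) :
    consEval a (T γ (N + 1) (j + 1) f) = T γ N j (consEval a f) := by
  by_cases h : j + 1 < N
  · rw [T_of_lt γ h, T_of_lt γ (show j + 1 + 1 < N + 1 by omega)]
    exact consEval_reflOp γ a ⟨j, by omega⟩ ⟨j + 1, h⟩ f
  · rw [T, T, dif_neg h, dif_neg (by omega)]; rfl

theorem consEval_wprod (γ a : ℝ) {N : ℕ} (l : List ℕ) (f : CF (N + 1)) :
    consEval a (wprod (T γ (N + 1)) (l.map Nat.succ) f) = wprod (T γ N) l (consEval a f) := by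
  induction l with
  | nil => rfl
  | cons j l ih =>
    rw [List.map_cons, wprod_cons, wprod_cons, Module.End.mul_apply, Module.End.mul_apply, ← ih]
    exact consEval_T γ a _

theorem consEval_asc (γ a : ℝ) {N : ℕ} (k m : ℕ) (f : CF (N + 1)) :
    consEval a (asc (T γ (N + 1)) (k + 1) m f) = asc (T γ N) k m (consEval a f) := by
  have h : ∀ k, List.range' (k + 1) m = (List.range' k m).map Nat.succ := by
    induction m with
    | zero => intro k; rfl
    | succ m ih => intro k; rw [List.range'_succ, List.range'_succ, List.map_cons, ih]
  rw [asc, asc, ← consEval_wprod, h]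

theorem tens_reflOp {N : ℕ} (γ : ℝ) (μ : ℂ) (i k : Fin N) (f : CF N) :
    reflOp γ i.castSucc k.castSucc (tens μ f) = tens μ (reflOp γ i k f) := by
  ext x
  simp only [tens_apply, reflOp_apply]
  have h1 : (x ∘ Equiv.swap i.castSucc k.castSucc) (Fin.last N) = x (Fin.last N) := by
    simp [Equiv.swap_apply_of_ne_of_ne (Fin.castSucc_lt_last i).ne' (Fin.castSucc_lt_last k).ne']
  have h2 : (fun j : Fin N => (x ∘ Equiv.swap i.castSucc k.castSucc) j.castSucc)
      = (fun j => x (Fin.castSucc j)) ∘ Equiv.swap i k := by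
    ext j
    simp only [Function.comp, Equiv.swap_apply_def, Fin.castSucc_inj]
    split_ifs <;> rfl
  have h3 : ∀ y : ℝ, (x - y • (Pi.single i.castSucc (1 : ℝ) - Pi.single k.castSucc (1 : ℝ)) : Fin (N + 1) → ℝ)
      (Fin.last N) = x (Fin.last N) := fun y => by
    simp [(Fin.castSucc_lt_last i).ne', (Fin.castSucc_lt_last k).ne']
  have h4 : ∀ y : ℝ, (fun j : Fin N =>
      (x - y • (Pi.single i.castSucc (1 : ℝ) - Pi.single k.castSucc (1 : ℝ)) : Fin (N + 1) → ℝ) j.castSucc)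
      = (fun j => x (Fin.castSucc j)) - y • (Pi.single i (1 : ℝ) - Pi.single k (1 : ℝ)) := by
    intro y
    ext j
    simp [Pi.single_apply, Fin.castSucc_inj]
  rw [h1, h2]
  simp only [h3, h4]
  rw [intervalIntegral.integral_mul_const]
  ring

theorem tens_T (γ : ℝ) (μ : ℂ) {N j : ℕ} (h : j + 1 < N) (f : CF N) :
    T γ (N + 1) j (tens μ f) = tens μ (T γ N j f) := by
  rw [T_of_lt γ h, T_of_lt γ (show j + 1 < N + 1 by omega)]
  exact tens_reflOp γ μ ⟨j, by omega⟩ ⟨j + 1, h⟩ f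

theorem tens_wprod (γ : ℝ) (μ : ℂ) {N : ℕ} (l : List ℕ) (hl : ∀ j ∈ l, j + 1 < N) (f : CF N) :
    wprod (T γ (N + 1)) l (tens μ f) = tens μ (wprod (T γ N) l f) := by
  induction l with
  | nil => rfl
  | cons j l ih =>
    rw [wprod_cons, wprod_cons, Module.End.mul_apply, Module.End.mul_apply,
      ih fun i hi => hl i (List.mem_cons_of_mem _ hi), tens_T γ μ (hl j List.mem_cons_self)]

theorem tens_asc (γ : ℝ) (μ : ℂ) {N k m : ℕ} (h : k + m < N) (f : CF N) :
    asc (T γ (N + 1)) k m (tens μ f) = tens μ (asc (T γ N) k m f) := by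
  refine tens_wprod γ μ _ (fun j hj => ?_) f
  rw [List.mem_range'_1] at hj
  omega

theorem tens_consEval {N : ℕ} (μ : ℂ) (a : ℝ) (f : CF (N + 1)) :
    tens μ (consEval a f) = consEval a (tens μ f) := by
  ext x
  simp only [tens_apply, consEval_apply]
  congr 2
  ext j
  refine Fin.cases ?_ (fun j => ?_) j
  · rfl
  · rw [Fin.cons_succ, ← Fin.succ_castSucc, Fin.cons_succ]

/-- The substitution t = a - y parametrizes the segment on which the first two coordinates keep the
sum a + b. -/
theorem T_zero_cons_cons (γ : ℝ) {N : ℕ} (f : CF (N + 2)) (a b : ℝ) (z : Fin N → ℝ) :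
    T γ (N + 2) 0 f (Fin.cons (α := fun _ => ℝ) a (Fin.cons (α := fun _ => ℝ) b z))
      = f (Fin.cons (α := fun _ => ℝ) b (Fin.cons (α := fun _ => ℝ) a z))
        + γ * ∫ t in b..a, f (Fin.cons (α := fun _ => ℝ) t
          (Fin.cons (α := fun _ => ℝ) (a + b - t) z)) := by
  rw [T_of_lt γ (show 0 + 1 < N + 2 by omega), reflOp_apply]
  congr 2
  · ext j
    refine Fin.cases ?_ (fun j => Fin.cases ?_ (fun j => ?_) j) j
    · simp
    · exact congrArg _ (Equiv.swap_apply_right _ _)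
    · have : (Equiv.swap (⟨0, by omega⟩ : Fin (N + 2)) ⟨0 + 1, by omega⟩) j.succ.succ
          = j.succ.succ := by
        refine Equiv.swap_apply_of_ne_of_ne ?_ ?_ <;> simp [Fin.ext_iff]
      exact (congrArg _ this).trans rfl
  · have h0 : ∀ y : ℝ, (Fin.cons (α := fun _ => ℝ) a (Fin.cons (α := fun _ => ℝ) b z)
        - y • (Pi.single ⟨0, by omega⟩ (1 : ℝ) - Pi.single ⟨0 + 1, by omega⟩ (1 : ℝ)) :
          Fin (N + 2) → ℝ)
        = Fin.cons (α := fun _ => ℝ) (a - y) (Fin.cons (α := fun _ => ℝ) (a + b - (a - y)) z) := by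
      intro y
      ext j
      refine Fin.cases ?_ (fun j => Fin.cases ?_ (fun j => ?_) j) j
      · simp
      · simp
      · simp [Fin.ext_iff]
    simp only [h0]
    have h1 := intervalIntegral.integral_comp_sub_left (a := 0) (b := a - b)
      (fun t => f (Fin.cons (α := fun _ => ℝ) t (Fin.cons (α := fun _ => ℝ) (a + b - t) z))) a
    rw [sub_zero, sub_sub_cancel] at h1
    exact h1

/-- As in `reflOp_pw`, since the reflection only sees the last two variables. The inner factor ν
sits at index N and the outer factor μ at N + 1. -/
theorem T_tens_tens (γ : ℝ) {N : ℕ} {μ ν : ℂ} (h : μ ≠ ν) (f : CF N) :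
    T γ (N + 2) N (tens μ (tens ν f)) = (1 + γ / (Complex.I * (μ - ν))) • tens ν (tens μ f)
      - (γ / (Complex.I * (μ - ν))) • tens μ (tens ν f) := by
  have hc : Complex.I * (μ - ν) ≠ 0 := mul_ne_zero Complex.I_ne_zero (sub_ne_zero.2 h)
  rw [T_of_lt γ (show N + 1 < N + 2 by omega)]
  ext x
  set p : Fin (N + 2) := ⟨N, by omega⟩ with hp
  set q : Fin (N + 2) := ⟨N + 1, by omega⟩ with hq
  have hpq : p ≠ q := by simp [hp, hq]
  have hF : ∀ (μ ν : ℂ) (x : Fin (N + 2) → ℝ), tens μ (tens ν f) x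
      = f (fun k => x k.castSucc.castSucc) * Complex.exp (Complex.I * ν * x p)
        * Complex.exp (Complex.I * μ * x q) := fun _ _ _ => rfl
  have n1 : ∀ k : Fin N, k.castSucc.castSucc ≠ p := fun k => by
    simp only [hp, ne_eq, Fin.ext_iff, Fin.val_castSucc]; omega
  have n2 : ∀ k : Fin N, k.castSucc.castSucc ≠ q := fun k => by
    simp only [hq, ne_eq, Fin.ext_iff, Fin.val_castSucc]; omega
  have hx1 : (fun k : Fin N => (x ∘ Equiv.swap p q) k.castSucc.castSucc)
      = fun k => x k.castSucc.castSucc := by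
    ext k
    simp [Equiv.swap_apply_of_ne_of_ne (n1 k) (n2 k)]
  have hx2 : ∀ y : ℝ, (fun k : Fin N => (x - y • (Pi.single p (1 : ℝ) - Pi.single q (1 : ℝ)) : Fin (N + 2) → ℝ)
      k.castSucc.castSucc) = fun k => x k.castSucc.castSucc := fun y => by
    ext k
    simp [n1 k, n2 k]
  have hx3 : ∀ y : ℝ, (x - y • (Pi.single p (1 : ℝ) - Pi.single q (1 : ℝ)) : Fin (N + 2) → ℝ) p = x p - y :=
    fun y => by simp [hpq]
  have hx4 : ∀ y : ℝ, (x - y • (Pi.single p (1 : ℝ) - Pi.single q (1 : ℝ)) : Fin (N + 2) → ℝ) q = x q + y :=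
    fun y => by simp [hpq.symm]
  have hE : ∀ y : ℝ, f (fun k => x k.castSucc.castSucc)
      * Complex.exp (Complex.I * ν * ((x p - y : ℝ) : ℂ))
      * Complex.exp (Complex.I * μ * ((x q + y : ℝ) : ℂ))
      = f (fun k => x k.castSucc.castSucc) * Complex.exp (Complex.I * ν * x p)
        * Complex.exp (Complex.I * μ * x q) * Complex.exp (Complex.I * (μ - ν) * y) := fun y => by
    simp only [mul_assoc (f _), ← Complex.exp_add]
    congr 2
    push_cast
    ring
  have hS : f (fun k => x k.castSucc.castSucc)
      * Complex.exp (Complex.I * ν * x q) * Complex.exp (Complex.I * μ * x p)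
      = f (fun k => x k.castSucc.castSucc) * Complex.exp (Complex.I * ν * x p)
        * Complex.exp (Complex.I * μ * x q)
        * Complex.exp (Complex.I * (μ - ν) * ((x p - x q : ℝ) : ℂ)) := by
    rw [← hE]
    simp
  simp only [reflOp_apply, ContinuousMap.sub_apply, ContinuousMap.smul_apply, smul_eq_mul]
  simp only [hF, hx1, hx2, hx3, hx4]
  simp only [hE, intervalIntegral.integral_const_mul, integral_exp_mul_complex hc, Function.comp,
    Equiv.swap_apply_left, Equiv.swap_apply_right]
  have hS' : f (fun k => x k.castSucc.castSucc)
      * Complex.exp (Complex.I * μ * x p) * Complex.exp (Complex.I * ν * x q)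
      = f (fun k => x k.castSucc.castSucc) * Complex.exp (Complex.I * ν * x p)
        * Complex.exp (Complex.I * μ * x q)
        * Complex.exp (Complex.I * (μ - ν) * ((x p - x q : ℝ) : ℂ)) := by
    rw [← hS]; ring
  rw [hS, hS']
  simp only [Complex.ofReal_zero, mul_zero, Complex.exp_zero]
  field_simp
  ring

/-! ### The operators that intertwine with `a` under propagation -/

/-- The operator `f ↦ (s_1^γ ⋯ s_N^γ (f ⊗ e^{iμ}))(a, ·)`. -/
def transfer (γ a : ℝ) (N : ℕ) (μ : ℂ) : Module.End ℂ (CF N) :=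
  consEval a ∘ₗ asc (T γ (N + 1)) 0 N ∘ₗ tens μ

theorem transfer_apply (γ a : ℝ) {N : ℕ} (μ : ℂ) (f : CF N) :
    transfer γ a N μ f = consEval a (asc (T γ (N + 1)) 0 N (tens μ f)) := rfl

/-- Passing the ascending product raises the index j by one, and freezing the first variable lowers
it again. -/
theorem transfer_T (γ a : ℝ) {N j : ℕ} (μ : ℂ) (hj : j + 1 < N) (f : CF N) :
    transfer γ a N μ (T γ N j f) = T γ N j (transfer γ a N μ f) := by
  rw [transfer_apply, transfer_apply, ← tens_T γ μ hj, ← consEval_T, ← Module.End.mul_apply,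
    (isCoxeterA_T γ (N + 1)).asc_mul (Nat.zero_le j) (by omega) (by omega), Module.End.mul_apply]

theorem transfer_wprod (γ a : ℝ) {N : ℕ} (μ : ℂ) {l : List ℕ} (hl : ∀ j ∈ l, j + 1 < N)
    (f : CF N) :
    transfer γ a N μ (wprod (T γ N) l f) = wprod (T γ N) l (transfer γ a N μ f) := by
  induction l with
  | nil => rfl
  | cons j l ih =>
    rw [wprod_cons, Module.End.mul_apply, Module.End.mul_apply,
      transfer_T γ a μ (hl j List.mem_cons_self),
      ih fun i hi => hl i (List.mem_cons_of_mem _ hi)]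

theorem IsCoxeterA.asc_mul_asc {M : Type*} [Monoid M] {t : ℕ → M} {n : ℕ} (h : IsCoxeterA t n)
    (m : ℕ) {k i : ℕ} (hm : i + m < k) (hk : k ≤ n) :
    asc t 0 k * asc t i m = asc t (i + 1) m * asc t 0 k := by
  induction m generalizing i with
  | zero => simp
  | succ m ih =>
    rw [asc_succ, asc_succ, ← mul_assoc, h.asc_mul (Nat.zero_le i) (by omega) (by omega),
      mul_assoc, ih (by omega), mul_assoc]

/-- The inner evaluation commutes with the outer operations once their indices are shifted, so both
evaluations can be done last, at the same value a. -/
theorem transfer_transfer (γ a : ℝ) {N : ℕ} (μ ν : ℂ) (f : CF N) :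
    transfer γ a N μ (transfer γ a N ν f) = consEval a (consEval a
      ((asc (T γ (N + 2)) 1 N * asc (T γ (N + 2)) 0 N) (tens μ (tens ν f)))) := by
  rw [transfer_apply, transfer_apply, tens_consEval, ← tens_asc γ μ (by omega), ← consEval_asc]
  rfl

theorem consEval_consEval_T (γ a : ℝ) {N : ℕ} (f : CF (N + 2)) :
    consEval a (consEval a (T γ (N + 2) 0 f)) = consEval a (consEval a f) := by
  ext x
  simp only [consEval_apply]
  refine T_apply_of_comp_eq γ f (x := Fin.cons (α := fun _ => ℝ) a
    (Fin.cons (α := fun _ => ℝ) a x)) ?_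
  ext j
  rw [finSwap_of_lt (show 0 + 1 < N + 2 by omega)]
  simp only [Function.comp, Equiv.swap_apply_def]
  split_ifs with h1 h2
  · rw [h1]; rfl
  · rw [h2]; rfl
  · rfl

theorem consEval_asc_asc_T (γ a : ℝ) {N : ℕ} (f : CF (N + 2)) :
    consEval a (consEval a ((asc (T γ (N + 2)) 1 N * asc (T γ (N + 2)) 0 N) (T γ (N + 2) N f)))
      = consEval a (consEval a ((asc (T γ (N + 2)) 1 N * asc (T γ (N + 2)) 0 N) f)) := by
  -- The last reflection completes the second ascent; exchanging the two ascents then exposes the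
  -- first reflection on the left, which is invisible at (a, a, x).
  have h1 : asc (T γ (N + 2)) 1 N * asc (T γ (N + 2)) 0 N * T γ (N + 2) N
      = T γ (N + 2) 0 * (asc (T γ (N + 2)) 1 N * asc (T γ (N + 2)) 0 N) := by
    have h2 := asc_succ_right (T γ (N + 2)) 0 N
    rw [zero_add] at h2
    rw [mul_assoc, ← h2, ← (isCoxeterA_T γ (N + 2)).asc_mul_asc N (k := N + 1) (i := 0)
      (by omega) (by omega), asc_succ, mul_assoc]
  rw [← Module.End.mul_apply (asc _ _ _ * _), h1, Module.End.mul_apply, consEval_consEval_T]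

theorem transfer_comm (γ a : ℝ) {N : ℕ} (μ ν : ℂ) (f : CF N) :
    transfer γ a N μ (transfer γ a N ν f) = transfer γ a N ν (transfer γ a N μ f) := by
  rcases eq_or_ne μ ν with rfl | h
  · rfl
  have key : ∀ {μ ν : ℂ}, μ ≠ ν → (1 + γ / (Complex.I * (μ - ν))) •
      (transfer γ a N ν (transfer γ a N μ f) - transfer γ a N μ (transfer γ a N ν f)) = 0 := by
    intro μ ν h
    have h1 := consEval_asc_asc_T γ a (tens μ (tens ν f))
    rw [T_tens_tens γ h] at h1
    simp only [map_sub, map_smul, ← transfer_transfer] at h1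
    rw [← sub_eq_zero] at h1
    rw [← h1]
    module
  -- If the factor vanishes, the factor for the reversed order equals 2.
  by_cases h0 : 1 + (γ : ℂ) / (Complex.I * (μ - ν)) = 0
  · have h1 : 1 + (γ : ℂ) / (Complex.I * (ν - μ)) ≠ 0 := by
      rw [← neg_sub μ ν, mul_neg, div_neg, ← eq_neg_of_add_eq_zero_left h0]
      norm_num
    exact sub_eq_zero.1 ((smul_eq_zero.1 (key h.symm)).resolve_left h1)
  · exact (sub_eq_zero.1 ((smul_eq_zero.1 (key h)).resolve_left h0)).symm

/-! ### Iterated integrals over chains -/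

/-- The vector `(a, x)`. -/
def vcons {N : ℕ} (a : ℝ) (x : Fin N → ℝ) : Fin (N + 1) → ℝ := Fin.cons (α := fun _ => ℝ) a x

@[simp] theorem vcons_zero {N : ℕ} (a : ℝ) (x : Fin N → ℝ) : vcons a x 0 = a := rfl

@[simp] theorem vcons_succ {N : ℕ} (a : ℝ) (x : Fin N → ℝ) (k : Fin N) :
    vcons a x k.succ = x k := rfl

@[fun_prop]
theorem continuous_vcons {Z : Type*} [TopologicalSpace Z] {N : ℕ} {a : Z → ℝ} {x : Z → Fin N → ℝ}
    (ha : Continuous a) (hx : Continuous x) : Continuous fun ζ => vcons (a ζ) (x ζ) := by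
  refine continuous_pi fun k => ?_
  refine Fin.cases ha (fun k => ?_) k
  exact (continuous_apply k).comp hx

theorem update_vcons_zero {N : ℕ} (a b : ℝ) (x : Fin N → ℝ) :
    Function.update (vcons a x) 0 b = vcons b x := Fin.update_cons_zero _ _ _

theorem update_vcons_succ {N : ℕ} (a b : ℝ) (x : Fin N → ℝ) (k : Fin N) :
    Function.update (vcons a x) k.succ b = vcons a (Function.update x k b) :=
  (Fin.cons_update _ _ _ _).symm

theorem vcons_eq {N : ℕ} (a : ℝ) (x : Fin N → ℝ) :
    vcons a x = Fin.cons (α := fun _ => ℝ) a x := rfl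

attribute [irreducible] vcons

/-- The function `e^{iμ x}` of a real variable. -/
def cexp (μ : ℂ) (x : ℝ) : ℂ := Complex.exp (Complex.I * μ * x)

@[fun_prop]
theorem continuous_cexp (μ : ℂ) : Continuous (cexp μ) := by unfold cexp; fun_prop

theorem cexp_add (μ : ℂ) (x y : ℝ) : cexp μ (x + y) = cexp μ x * cexp μ y := by
  rw [cexp, cexp, cexp, ← Complex.exp_add]; congr 1; push_cast; ring

@[fun_prop]
theorem continuous_tail {N : ℕ} : Continuous fun z : Fin (N + 1) → ℝ => Fin.tail z :=
  continuous_pi fun _ => continuous_apply _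

/-- The sum over all increasing sequences of indices of the iterated integral in which the
coordinates of `z` with these indices are moved up to the preceding ones, the first one up to
`p`. -/
def chainSum (γ : ℝ) (μ : ℂ) : (N : ℕ) → ℝ → (Fin N → ℝ) → ((Fin N → ℝ) → ℂ) → ℂ
  | 0, _, z, g => g z
  | N + 1, p, z, g => chainSum γ μ N p (Fin.tail z) (fun x => g (vcons (z 0) x)) +
      γ * ∫ y in (z 0)..p, cexp μ (z 0 - y) *
        chainSum γ μ N (z 0) (Fin.tail z) (fun x => g (vcons y x))

theorem chainSum_succ (γ : ℝ) (μ : ℂ) {N : ℕ} (p : ℝ) (z : Fin (N + 1) → ℝ)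
    (g : (Fin (N + 1) → ℝ) → ℂ) :
    chainSum γ μ (N + 1) p z g = chainSum γ μ N p (Fin.tail z) (fun x => g (vcons (z 0) x)) +
      γ * ∫ y in (z 0)..p, cexp μ (z 0 - y) *
        chainSum γ μ N (z 0) (Fin.tail z) (fun x => g (vcons y x)) := rfl

theorem continuous_intervalIntegral {Z : Type*} [TopologicalSpace Z] [FirstCountableTopology Z]
    [LocallyCompactSpace Z] {F : Z → ℝ → ℂ} (hF : Continuous (Function.uncurry F)) {a b : Z → ℝ}
    (ha : Continuous a) (hb : Continuous b) : Continuous fun ζ => ∫ y in (a ζ)..(b ζ), F ζ y := by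
  have h : (fun ζ => ∫ y in (a ζ)..(b ζ), F ζ y)
      = fun ζ => (∫ y in (0 : ℝ)..(b ζ), F ζ y) - ∫ y in (0 : ℝ)..(a ζ), F ζ y := by
    ext ζ
    have hc : Continuous (F ζ) := hF.comp (f := fun y => (ζ, y)) (by fun_prop)
    rw [intervalIntegral.integral_interval_sub_left (hc.intervalIntegrable _ _)
      (hc.intervalIntegrable _ _)]
  rw [h]
  exact (intervalIntegral.continuous_parametric_intervalIntegral_of_continuous hF hb).sub
    (intervalIntegral.continuous_parametric_intervalIntegral_of_continuous hF ha)

theorem continuous_chainSum (γ : ℝ) (μ : ℂ) (N : ℕ) {Z : Type*} [TopologicalSpace Z]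
    [FirstCountableTopology Z] [LocallyCompactSpace Z] {F : Z → (Fin N → ℝ) → ℂ}
    (hF : Continuous (Function.uncurry F)) {p : Z → ℝ} (hp : Continuous p)
    {z : Z → Fin N → ℝ} (hz : Continuous z) :
    Continuous fun ζ => chainSum γ μ N (p ζ) (z ζ) (F ζ) := by
  induction N generalizing Z with
  | zero => exact hF.comp (continuous_id.prodMk hz)
  | succ N ih =>
    simp only [chainSum_succ]
    have hz0 : Continuous fun ζ => z ζ 0 := (continuous_apply 0).comp hz
    have hzt : Continuous fun ζ => Fin.tail (z ζ) := continuous_tail.comp hz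
    refine (ih (F := fun ζ x => F ζ (vcons (z ζ 0) x)) ?_ hp hzt).add (continuous_const.mul ?_)
    · exact hF.comp (continuous_fst.prodMk (by fun_prop))
    · refine continuous_intervalIntegral (F := fun ζ y => cexp μ (z ζ 0 - y) *
        chainSum γ μ N (z ζ 0) (Fin.tail (z ζ)) (fun x => F ζ (vcons y x))) ?_ hz0 hp
      refine Continuous.mul (by fun_prop) ?_
      refine ih (Z := Z × ℝ) (F := fun ζ x => F ζ.1 (vcons ζ.2 x)) ?_ (hz0.comp continuous_fst)
        (hzt.comp continuous_fst)
      exact hF.comp ((continuous_fst.comp continuous_fst).prodMk (by fun_prop))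

theorem continuous_chainSum_cons (γ : ℝ) (μ : ℂ) {N : ℕ} (p : ℝ) (z : Fin N → ℝ)
    {g : (Fin (N + 1) → ℝ) → ℂ} (hg : Continuous g) :
    Continuous fun y => chainSum γ μ N p z (fun x => g (vcons y x)) :=
  continuous_chainSum γ μ N (F := fun y x => g (vcons y x)) (hg.comp (by fun_prop))
    continuous_const continuous_const

theorem chainSum_const_mul (γ : ℝ) (μ : ℂ) {N : ℕ} (p : ℝ) (z : Fin N → ℝ) (c : ℂ)
    (g : (Fin N → ℝ) → ℂ) :
    chainSum γ μ N p z (fun x => c * g x) = c * chainSum γ μ N p z g := by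
  induction N generalizing p with
  | zero => rfl
  | succ N ih =>
    rw [chainSum_succ, chainSum_succ]
    have h1 := ih p (Fin.tail z) (fun x => g (vcons (z 0) x))
    have h2 := fun y => ih (z 0) (Fin.tail z) (fun x => g (vcons y x))
    simp only [h1, h2, mul_left_comm _ c, intervalIntegral.integral_const_mul]
    ring

theorem chainSum_add (γ : ℝ) (μ : ℂ) {N : ℕ} (p : ℝ) (z : Fin N → ℝ)
    {g h : (Fin N → ℝ) → ℂ} (hg : Continuous g) (hh : Continuous h) :
    chainSum γ μ N p z (fun x => g x + h x) = chainSum γ μ N p z g + chainSum γ μ N p z h := by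
  induction N generalizing p with
  | zero => rfl
  | succ N ih =>
    rw [chainSum_succ, chainSum_succ, chainSum_succ]
    have h1 := fun p y => ih p (Fin.tail z) (g := fun x => g (vcons y x))
      (h := fun x => h (vcons y x)) (hg.comp (by fun_prop)) (hh.comp (by fun_prop))
    simp only [h1, mul_add]
    rw [intervalIntegral.integral_add]
    · ring
    · exact ((by fun_prop : Continuous fun y => cexp μ (z 0 - y)).mul
        (continuous_chainSum_cons γ μ _ _ hg)).intervalIntegrable _ _
    · exact ((by fun_prop : Continuous fun y => cexp μ (z 0 - y)).mul
        (continuous_chainSum_cons γ μ _ _ hh)).intervalIntegrable _ _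

theorem intervalIntegral_swap_of_continuous {F : ℝ → ℝ → ℂ}
    (hF : Continuous (Function.uncurry F)) (a b c d : ℝ) :
    ∫ x in a..b, ∫ y in c..d, F x y = ∫ y in c..d, ∫ x in a..b, F x y := by
  refine intervalIntegral_intervalIntegral_swap ?_
  refine (hF.continuousOn.integrableOn_compact
    (isCompact_uIcc.prod isCompact_uIcc)).mono_set (s := Set.uIoc a b ×ˢ Set.uIoc c d)
    (t := Set.uIcc a b ×ˢ Set.uIcc c d) ?_
  exact Set.prod_mono Set.uIoc_subset_uIcc Set.uIoc_subset_uIcc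

theorem chainSum_integral (γ : ℝ) (μ : ℂ) {N : ℕ} (p : ℝ) (z : Fin N → ℝ)
    {G : ℝ → (Fin N → ℝ) → ℂ} (hG : Continuous (Function.uncurry G)) (a b : ℝ) :
    chainSum γ μ N p z (fun x => ∫ t in a..b, G t x) = ∫ t in a..b, chainSum γ μ N p z (G t) := by
  induction N generalizing p with
  | zero => rfl
  | succ N ih =>
    simp only [chainSum_succ]
    have h1 := fun p y => ih p (Fin.tail z) (G := fun t x => G t (vcons y x))
      (hG.comp (continuous_fst.prodMk (by fun_prop)))
    simp only [h1]
    have hc : Continuous (Function.uncurry fun y t => cexp μ (z 0 - y) *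
        chainSum γ μ N (z 0) (Fin.tail z) (fun x => G t (vcons y x))) := by
      refine Continuous.mul (by fun_prop) ?_
      refine continuous_chainSum γ μ N (Z := ℝ × ℝ) (F := fun ζ x => G ζ.2 (vcons ζ.1 x)) ?_
        continuous_const continuous_const
      exact hG.comp ((continuous_snd.comp continuous_fst).prodMk (by fun_prop))
    have h2 := intervalIntegral_swap_of_continuous hc (z 0) p a b
    simp only [intervalIntegral.integral_const_mul] at h2
    rw [h2, intervalIntegral.integral_add, intervalIntegral.integral_const_mul]
    · refine Continuous.intervalIntegrable ?_ _ _
      refine continuous_chainSum γ μ N (F := fun t x => G t (vcons (z 0) x)) ?_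
        continuous_const continuous_const
      exact hG.comp (continuous_fst.prodMk (by fun_prop))
    · refine Continuous.intervalIntegrable (continuous_const.mul ?_) _ _
      refine continuous_intervalIntegral (F := fun t y => cexp μ (z 0 - y) *
        chainSum γ μ N (z 0) (Fin.tail z) (fun x => G t (vcons y x))) ?_ continuous_const
        continuous_const
      exact hc.comp continuous_swap

theorem antitone_tail {N : ℕ} {z : Fin (N + 1) → ℝ} (hz : Antitone z) : Antitone (Fin.tail z) :=
  fun _ _ h => hz (Fin.succ_le_succ_iff.2 h)

/-- A chain sum never moves a coordinate above its upper limit p. -/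
theorem chainSum_congr_le (γ : ℝ) (μ : ℂ) {N : ℕ} {p : ℝ} {z : Fin N → ℝ} (hz : Antitone z)
    (hp : ∀ k, z k ≤ p) {g h : (Fin N → ℝ) → ℂ} (hgh : ∀ x, (∀ k, x k ≤ p) → g x = h x) :
    chainSum γ μ N p z g = chainSum γ μ N p z h := by
  induction N generalizing p with
  | zero => exact hgh z hp
  | succ N ih =>
    have hc : ∀ (y : ℝ) (x : Fin N → ℝ), y ≤ p → (∀ k, x k ≤ p) →
        g (vcons y x) = h (vcons y x) := fun y x hy hx =>
      hgh _ fun k => Fin.cases (by simpa using hy) (fun k => by simpa using hx k) k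
    rw [chainSum_succ, chainSum_succ]
    congr 1
    · exact ih (antitone_tail hz) (fun k => hp _) fun x hx => hc _ x (hp 0) hx
    · congr 1
      refine intervalIntegral.integral_congr fun y hy => ?_
      rw [Set.uIcc_of_le (hp 0)] at hy
      congr 1
      exact ih (antitone_tail hz) (fun k => hz (Fin.zero_le _)) fun x hx =>
        hc y x hy.2 fun k => (hx k).trans (hp 0)

/-- Only the first moved coordinate can reach beyond b; every later one stops at an original
coordinate, which is at most b. -/
theorem chainSum_congr_of_pairwise (γ : ℝ) (μ : ℂ) {N : ℕ} (p : ℝ) {b : ℝ} {z : Fin N → ℝ}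
    (hz : Antitone z) (hb : ∀ k, z k ≤ b) {g h : (Fin N → ℝ) → ℂ}
    (hgh : ∀ x, (∀ j k, j ≠ k → x j ≤ b ∨ x k ≤ b) → g x = h x) :
    chainSum γ μ N p z g = chainSum γ μ N p z h := by
  induction N generalizing p with
  | zero => exact hgh z fun j => j.elim0
  | succ N ih =>
    rw [chainSum_succ, chainSum_succ]
    congr 1
    · refine ih p (antitone_tail hz) (fun k => hb _) fun x hx => hgh _ fun j k => ?_
      refine Fin.cases ?_ (fun j => ?_) j
      · exact fun _ => Or.inl (by simpa using hb 0)
      · refine Fin.cases ?_ (fun k => ?_) k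
        · exact fun _ => Or.inr (by simpa using hb 0)
        · intro hjk
          simpa using hx j k fun h => hjk (congrArg Fin.succ h)
    · congr 2
      ext y
      congr 1
      refine chainSum_congr_le γ μ (antitone_tail hz) (fun k => hz (Fin.zero_le _)) fun x hx =>
        hgh _ fun j k => ?_
      refine Fin.cases ?_ (fun j => ?_) j
      · refine Fin.cases ?_ (fun k => ?_) k
        · intro h; exact absurd rfl h
        · exact fun _ => Or.inr (by simpa using (hx k).trans (hb 0))
      · exact fun _ => Or.inl (by simpa using (hx j).trans (hb 0))

/-! ### Triangle integrals and exchange terms under chain sums. -/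

theorem integral_triangle_swap {F : ℝ → ℝ → ℂ} (hF : Continuous (Function.uncurry F)) {a b : ℝ}
    (hab : b ≤ a) :
    ∫ y in b..a, ∫ t in b..y, F t y = ∫ t in b..a, ∫ y in t..a, F t y := by
  set G : ℝ → ℝ → ℂ := fun y t => {q : ℝ × ℝ | q.2 ≤ q.1}.indicator (fun q => F q.2 q.1) (y, t)
    with hG
  have h1 : ∀ y ∈ Set.uIcc b a, ∫ t in b..y, F t y = ∫ t in b..a, G y t := by
    intro y hy
    rw [Set.uIcc_of_le hab] at hy
    rw [intervalIntegral.integral_of_le hy.1, intervalIntegral.integral_of_le hab,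
      ← integral_indicator measurableSet_Ioc, ← integral_indicator measurableSet_Ioc]
    congr 1
    ext t
    simp only [hG, Set.indicator_apply, Set.mem_Ioc, Set.mem_ofPred_eq]
    have := hy.2
    split_ifs <;> first | rfl | (exfalso; grind)
  have h2 : ∀ t ∈ Set.uIcc b a, ∫ y in t..a, F t y = ∫ y in b..a, G y t := by
    intro t ht
    rw [Set.uIcc_of_le hab] at ht
    rw [intervalIntegral.integral_of_le ht.2, intervalIntegral.integral_of_le hab,
      ← integral_Icc_eq_integral_Ioc, ← integral_Icc_eq_integral_Ioc,
      ← integral_indicator measurableSet_Icc, ← integral_indicator measurableSet_Icc]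
    congr 1
    ext y
    simp only [hG, Set.indicator_apply, Set.mem_Icc, Set.mem_ofPred_eq]
    have := ht.1
    split_ifs <;> first | rfl | (exfalso; grind)
  rw [intervalIntegral.integral_congr h1, intervalIntegral.integral_congr h2]
  refine intervalIntegral_intervalIntegral_swap ?_
  have hc : Continuous fun q : ℝ × ℝ => F q.2 q.1 := hF.comp continuous_swap
  refine IntegrableOn.mono_set (t := Set.uIcc b a ×ˢ Set.uIcc b a) ?_
    (Set.prod_mono Set.uIoc_subset_uIcc Set.uIoc_subset_uIcc)
  exact (hc.continuousOn.integrableOn_compact (isCompact_uIcc.prod isCompact_uIcc)).indicator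
    (measurableSet_le measurable_snd measurable_fst)

/-- Fubini on the triangle b ≤ t ≤ y ≤ a, followed by s = b + y - t for fixed t. -/
theorem integral_triangle_shear {F : ℝ → ℝ → ℂ} (hF : Continuous (Function.uncurry F)) {a b : ℝ}
    (hab : b ≤ a) :
    ∫ y in b..a, ∫ t in b..y, F t (b + y - t) = ∫ t in b..a, ∫ s in b..(b + a - t), F t s := by
  rw [integral_triangle_swap (F := fun t y => F t (b + y - t))
    (hF.comp (f := fun q : ℝ × ℝ => (q.1, b + q.2 - q.1)) (by fun_prop)) hab]
  congr 1
  ext t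
  have h := intervalIntegral.integral_comp_add_right (a := t) (b := a) (fun s => F t s) (b - t)
  rw [show t + (b - t) = b by ring, show a + (b - t) = b + a - t by ring] at h
  rw [← h]
  congr 1
  ext y
  congr 1
  ring

/-- The sum of the contributions in which one coordinate above `b` exchanges an amount with a
coordinate at `b`. -/
def exchange {N : ℕ} (b : ℝ) (G : ℝ → (Fin N → ℝ) → ℂ) (x : Fin N → ℝ) : ℂ :=
  ∑ j, ∫ t in b..max (x j) b, G t (Function.update x j (b + x j - t))

theorem continuous_exchange {N : ℕ} (b : ℝ) {G : ℝ → (Fin N → ℝ) → ℂ}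
    (hG : Continuous (Function.uncurry G)) : Continuous (exchange b G) := by
  refine continuous_finsetSum _ fun j _ => ?_
  refine continuous_intervalIntegral
    (F := fun x t => G t (Function.update x j (b + x j - t))) ?_ continuous_const (by fun_prop)
  refine hG.comp (continuous_snd.prodMk ?_)
  exact continuous_fst.update j (by fun_prop)

theorem exchange_of_le {N : ℕ} {b : ℝ} (G : ℝ → (Fin N → ℝ) → ℂ) {x : Fin N → ℝ}
    (hx : ∀ k, x k ≤ b) : exchange b G x = 0 :=
  Finset.sum_eq_zero fun j _ => by rw [max_eq_right (hx j), intervalIntegral.integral_same]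

theorem exchange_cons {N : ℕ} (b : ℝ) (G : ℝ → (Fin (N + 1) → ℝ) → ℂ) (y : ℝ)
    (x : Fin N → ℝ) :
    exchange b G (vcons y x) = (∫ t in b..max y b, G t (vcons (b + y - t) x))
      + exchange b (fun t x => G t (vcons y x)) x := by
  rw [exchange, exchange, Fin.sum_univ_succ]
  simp only [vcons_zero, vcons_succ, update_vcons_zero, update_vcons_succ]

/-- Only a coordinate moved to some y > b exchanges anything: it becomes s = b + y - t while t goes
into the parameter of G. For fixed t, s fills the interval from b to b + a - t. A chain that moves
its first coordinate there is what the sum with top b + a - t has beyond the sum with top b, hence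
the difference. -/
theorem chainSum_exchange (γ : ℝ) (μ : ℂ) {N : ℕ} {a b : ℝ} (hab : b ≤ a) {z : Fin N → ℝ}
    (hz : Antitone z) (hb : ∀ k, z k ≤ b) {G : ℝ → (Fin N → ℝ) → ℂ}
    (hG : Continuous (Function.uncurry G)) :
    chainSum γ μ N a z (exchange b G) = ∫ t in b..a, cexp μ (b - t) *
      (chainSum γ μ N (b + a - t) z (G t) - chainSum γ μ N b z (G t)) := by
  induction N with
  | zero => simp [chainSum, exchange]
  | succ N ih =>
    set z' := Fin.tail z with hz'
    have hz't : Antitone z' := antitone_tail hz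
    have hcont : ∀ y, Continuous (Function.uncurry fun t x => G t (vcons y x)) := fun y =>
      hG.comp (continuous_fst.prodMk (by fun_prop))
    set Q : ℝ → ℝ → ℂ := fun t s => chainSum γ μ N (z 0) z' (fun x => G t (vcons s x)) with hQ
    have hQc : Continuous (Function.uncurry Q) :=
      continuous_chainSum γ μ N (Z := ℝ × ℝ) (F := fun ζ x => G ζ.1 (vcons ζ.2 x))
        (hG.comp ((continuous_fst.comp continuous_fst).prodMk (by fun_prop)))
        continuous_const continuous_const
    -- the part in which the first coordinate is kept
    have h1 : chainSum γ μ N a z' (fun x => exchange b G (vcons (z 0) x))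
        = ∫ t in b..a, cexp μ (b - t) *
          (chainSum γ μ N (b + a - t) z' (fun x => G t (vcons (z 0) x))
            - chainSum γ μ N b z' (fun x => G t (vcons (z 0) x))) := by
      rw [← ih hz't (fun k => hb _) (hcont (z 0))]
      congr 1
      ext x
      rw [exchange_cons, max_eq_right (hb 0), intervalIntegral.integral_same, zero_add]
    -- the part in which the first coordinate is moved
    have h2 : ∀ y, chainSum γ μ N (z 0) z' (fun x => exchange b G (vcons y x))
        = ∫ t in b..max y b, Q t (b + y - t) := by
      intro y
      rw [chainSum_congr_le γ μ hz't (fun k => hz (Fin.zero_le _))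
        (h := fun x => ∫ t in b..max y b, G t (vcons (b + y - t) x)) (fun x hx => by
          rw [exchange_cons, exchange_of_le _ fun k => (hx k).trans (hb 0), add_zero])]
      exact chainSum_integral γ μ _ _ (G := fun t x => G t (vcons (b + y - t) x))
        (hG.comp (continuous_fst.prodMk (by fun_prop))) _ _
    have hFc : Continuous fun y => cexp μ (z 0 - y) * ∫ t in b..max y b, Q t (b + y - t) := by
      refine Continuous.mul (by fun_prop) ?_
      exact continuous_intervalIntegral (F := fun y t => Q t (b + y - t))
        (hQc.comp (f := fun q : ℝ × ℝ => (q.2, b + q.1 - q.2)) (by fun_prop))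
        continuous_const (by fun_prop)
    have hφ : Continuous (Function.uncurry fun t s =>
        cexp μ (b - t) * (cexp μ (z 0 - s) * Q t s)) := by
      refine Continuous.mul (by fun_prop) (Continuous.mul (by fun_prop) hQc)
    have h3 : ∫ y in (z 0)..a, cexp μ (z 0 - y) * ∫ t in b..max y b, Q t (b + y - t)
        = ∫ t in b..a, cexp μ (b - t) * ∫ s in b..(b + a - t), cexp μ (z 0 - s) * Q t s := by
      rw [← intervalIntegral.integral_add_adjacent_intervals (b := b)
        (hFc.intervalIntegrable _ _) (hFc.intervalIntegrable _ _)]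
      have h4 : ∫ y in (z 0)..b, cexp μ (z 0 - y) * ∫ t in b..max y b, Q t (b + y - t) = 0 := by
        refine intervalIntegral.integral_zero_ae (Eventually.of_forall fun y hy => ?_)
        rw [Set.uIoc_of_le (hb 0)] at hy
        rw [max_eq_right hy.2, intervalIntegral.integral_same, mul_zero]
      rw [h4, zero_add]
      have h5 := integral_triangle_shear hφ hab
      simp only [intervalIntegral.integral_const_mul] at h5
      rw [← h5]
      refine intervalIntegral.integral_congr fun y hy => ?_
      rw [Set.uIcc_of_le hab] at hy
      -- The phases match because z_0 - y = (b - t) + (z_0 - s) for s = b + y - t.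
      rw [max_eq_left hy.1, ← intervalIntegral.integral_const_mul]
      congr 1
      ext t
      rw [← mul_assoc (cexp μ (b - t)), ← cexp_add]
      congr 2
      ring
    rw [chainSum_succ, ← hz', h1]
    simp only [h2, h3, chainSum_succ, ← hz']
    have h6 : ∀ t, (∫ y in (z 0)..(b + a - t), cexp μ (z 0 - y) * Q t y)
        - (∫ y in (z 0)..b, cexp μ (z 0 - y) * Q t y)
        = ∫ s in b..(b + a - t), cexp μ (z 0 - s) * Q t s := by
      intro t
      have hc : Continuous fun y => cexp μ (z 0 - y) * Q t y :=
        Continuous.mul (by fun_prop) (hQc.comp (f := fun y : ℝ => (t, y)) (by fun_prop))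
      exact intervalIntegral.integral_interval_sub_left (hc.intervalIntegrable _ _)
        (hc.intervalIntegrable _ _)
    rw [← intervalIntegral.integral_const_mul, ← intervalIntegral.integral_add]
    · refine intervalIntegral.integral_congr fun t _ => ?_
      rw [← h6]
      ring
    · refine Continuous.intervalIntegrable (Continuous.mul (by fun_prop) (Continuous.sub ?_ ?_)) _ _
      · exact continuous_chainSum γ μ N (hcont (z 0)) (by fun_prop) continuous_const
      · exact continuous_chainSum γ μ N (hcont (z 0)) continuous_const continuous_const
    · refine Continuous.intervalIntegrable
        (continuous_const.mul (Continuous.mul (by fun_prop) ?_)) _ _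
      refine continuous_intervalIntegral (F := fun t s => cexp μ (z 0 - s) * Q t s) ?_
        continuous_const (by fun_prop)
      exact Continuous.mul (by fun_prop) hQc

/-! ### The transfer operators as chain sums of propagated functions -/

theorem consEval_eq {N : ℕ} (a : ℝ) (f : CF (N + 1)) (x : Fin N → ℝ) :
    consEval a f x = f (vcons a x) := by rw [vcons_eq]; rfl

/-- Splitting off the first reflection leaves an ascent that does not touch the first variable; in
the integral the values t and a + b - t take the places of b and a. -/
theorem transfer_vcons (γ a : ℝ) {N : ℕ} (μ : ℂ) (f : CF (N + 1)) (b : ℝ) (z : Fin N → ℝ) :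
    transfer γ a (N + 1) μ f (vcons b z) = transfer γ a N μ (consEval b f) z
      + γ * ∫ t in b..a, transfer γ (a + b - t) N μ (consEval t f) z := by
  have h : ∀ t s : ℝ, transfer γ s N μ (consEval t f) z
      = asc (T γ (N + 2)) 1 N (tens μ f) (Fin.cons (α := fun _ => ℝ) t
        (Fin.cons (α := fun _ => ℝ) s z)) := by
    intro t s
    rw [transfer_apply, tens_consEval, ← consEval_asc]
    rfl
  simp only [h]
  rw [transfer_apply, asc_succ, vcons_eq, consEval_apply, Module.End.mul_apply, zero_add]
  exact T_zero_cons_cons γ _ a b z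

theorem rearr_map_succ {N : ℕ} (l : List ℕ) (a : ℝ) (x : Fin N → ℝ) :
    rearr (l.map Nat.succ) (vcons a x) = vcons a (rearr l x) := by
  induction l with
  | nil => rfl
  | cons j l ih =>
    rw [List.map_cons, rearr_cons, rearr_cons, ih]
    by_cases hj : j + 1 < N
    · rw [finSwap_of_lt hj, finSwap_of_lt (show j.succ + 1 < N + 1 by omega)]
      ext k
      refine Fin.cases ?_ (fun k => ?_) k
      · simp [Equiv.swap_apply_def, Fin.ext_iff]
      · simp only [Function.comp, vcons_succ, Equiv.swap_apply_def, Fin.ext_iff, Fin.val_succ]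
        split_ifs <;> first | omega | rfl | skip
        · exact vcons_succ a _ ⟨j + 1, hj⟩
        · exact vcons_succ a _ ⟨j, by omega⟩
        · exact vcons_succ a _ k
    · rw [finSwap, finSwap, dif_neg hj, dif_neg (by omega)]
      rfl

theorem antitone_vcons {N : ℕ} {a : ℝ} {x : Fin N → ℝ} (hx : Antitone x) (ha : ∀ k, x k ≤ a) :
    Antitone (vcons a x) := by
  intro j k
  refine Fin.cases (fun _ => ?_) (fun j => ?_) j
  · refine Fin.cases ?_ (fun k => ?_) k
    · rfl
    · simpa using ha k
  · refine Fin.cases (fun h => ?_) (fun k => ?_) k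
    · exact absurd h (by simp)
    · intro h
      simpa using hx (Fin.succ_le_succ_iff.1 h)

theorem map_succ_lt {N : ℕ} {l : List ℕ} (hl : ∀ j ∈ l, j + 1 < N) :
    ∀ j ∈ l.map Nat.succ, j + 1 < N + 1 := by
  intro j hj
  obtain ⟨i, hi, rfl⟩ := List.mem_map.1 hj
  exact Nat.succ_lt_succ (hl i hi)

theorem wprod_map_succ_vcons (γ : ℝ) {N : ℕ} (l : List ℕ) (f : CF (N + 1)) (a : ℝ)
    (x : Fin N → ℝ) :
    wprod (T γ (N + 1)) (l.map Nat.succ) f (vcons a x) = wprod (T γ N) l (consEval a f) x := by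
  rw [← consEval_wprod, consEval_eq]

/-- A largest coordinate in front stays there, so a sorting word for x, shifted by one, sorts the
whole vector. -/
theorem propOp_vcons_of_le (γ : ℝ) {N : ℕ} (f : CF (N + 1)) {a : ℝ} {x : Fin N → ℝ}
    (ha : ∀ k, x k ≤ a) : propOp γ (N + 1) f (vcons a x) = propOp γ N (consEval a f) x := by
  obtain ⟨l, hl, -, hs⟩ := exists_antitone_rearr x
  rw [propOp_eq γ f (map_succ_lt hl) (by
    rw [rearr_map_succ]; exact antitone_vcons hs fun k => ha _), rearr_map_succ,
    wprod_map_succ_vcons, propOp_eq γ _ hl hs]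

theorem continuous_propOp_consEval (γ : ℝ) {N : ℕ} (f : CF (N + 1)) :
    Continuous (Function.uncurry fun t x => propOp γ N (consEval t f) x) := by
  refine LocallyFinite.continuous
    (f := fun w : Equiv.Perm (Fin N) => {q : ℝ × (Fin N → ℝ) | Antitone (q.2 ∘ ⇑(w⁻¹))})
    (locallyFinite_of_finite _) ?_ (fun w => ?_) fun w => ?_
  · refine Set.eq_univ_of_forall fun q => Set.mem_iUnion.2 ⟨chamberPerm q.2, ?_⟩
    exact antitone_chamberPerm q.2
  · have : {q : ℝ × (Fin N → ℝ) | Antitone (q.2 ∘ ⇑(w⁻¹))}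
        = ⋂ a, ⋂ b, ⋂ (_ : a ≤ b), {q : ℝ × (Fin N → ℝ) | q.2 (w⁻¹ b) ≤ q.2 (w⁻¹ a)} := by
      ext x
      simp only [Set.mem_iInter]
      exact Iff.rfl
    rw [this]
    exact isClosed_iInter fun a => isClosed_iInter fun b => isClosed_iInter fun _ =>
      isClosed_le (by fun_prop) (by fun_prop)
  · obtain ⟨l, hl, rfl⟩ := exists_wprod_finSwap w
    refine ContinuousOn.congr (f := fun q => wprod (T γ (N + 1)) (l.map Nat.succ) f
      (vcons q.1 (rearr l q.2))) ?_ fun q hq => ?_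
    · refine ((ContinuousMap.continuous _).comp ?_).continuousOn
      have := continuous_rearr (N := N) l
      fun_prop
    · exact (propOp_eq γ _ hl hq).trans (wprod_map_succ_vcons γ l f q.1 _).symm

/-- If a single coordinate x_j exceeds b, sorting means sorting x and then swapping b with x_j. That
swap contributes the reflection at index 0, whose integral part is the exchange term. -/
theorem propOp_vcons_of_pairwise (γ : ℝ) {N : ℕ} (f : CF (N + 1)) {b : ℝ} {x : Fin N → ℝ}
    (hx : ∀ j k, j ≠ k → x j ≤ b ∨ x k ≤ b) :
    propOp γ (N + 1) f (vcons b x) = propOp γ N (consEval b f) x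
      + γ * exchange b (fun t x => propOp γ N (consEval t f) x) x := by
  by_cases hle : ∀ k, x k ≤ b
  · rw [exchange_of_le _ hle, mul_zero, add_zero, propOp_vcons_of_le γ f hle]
  push Not at hle
  obtain ⟨j, hj⟩ := hle
  have hothers : ∀ k, k ≠ j → x k ≤ b := fun k hk => (hx k j hk).resolve_right (not_le.2 hj)
  obtain ⟨M, rfl⟩ : ∃ M, N = M + 1 := ⟨N - 1, by have := j.2; omega⟩
  obtain ⟨l, hl, -, hs⟩ := exists_antitone_rearr x
  set w := wprod (finSwap (M + 1)) l with hw
  have hww : ∀ k, w (w⁻¹ k) = k := w.apply_symm_apply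
  have hw0 : w⁻¹ 0 = j := by
    by_contra hne
    have h1 := hothers _ hne
    have h2 : x (w⁻¹ (w j)) ≤ x (w⁻¹ 0) := hs (Fin.zero_le (w j))
    rw [show w⁻¹ (w j) = j from w.symm_apply_apply j] at h2
    linarith
  have hwj : w j = 0 := by rw [← hw0, hww]
  set r : Fin M → ℝ := Fin.tail (rearr l x) with hr
  have hrearr : ∀ s, rearr l (Function.update x j s) = vcons s r := by
    intro s
    ext k
    refine Fin.cases ?_ (fun k => ?_) k
    · rw [vcons_zero, rearr, ← hw, Function.comp, hw0, Function.update_self]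
    · rw [vcons_succ, rearr, ← hw, Function.comp, Function.update_of_ne]
      · rfl
      · intro h
        rw [← h, hww] at hwj
        exact Fin.succ_ne_zero k hwj
  have hrx : rearr l x = vcons (x j) r := by
    rw [← hrearr, Function.update_eq_self]
  have hr_anti : Antitone r := antitone_tail hs
  have hr_le : ∀ k, r k ≤ b := by
    intro k
    refine hothers _ fun h => ?_
    rw [← hw] at h
    rw [← h, hww] at hwj
    exact Fin.succ_ne_zero k hwj
  have hswap : rearr (0 :: l.map Nat.succ) (vcons b x) = vcons (x j) (vcons b r) := by
    rw [rearr_cons, rearr_map_succ, hrx, finSwap_of_lt (show 0 + 1 < M + 1 + 1 by omega)]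
    ext k
    refine Fin.cases ?_ (fun k => Fin.cases ?_ (fun k => ?_) k) k
    · rw [vcons_zero, Function.comp]
      exact (congrArg (vcons b (vcons (x j) r)) (Equiv.swap_apply_left _ _)).trans
        ((vcons_succ b _ 0).trans (vcons_zero _ _))
    · rw [vcons_succ, vcons_zero, Function.comp]
      exact (congrArg (vcons b (vcons (x j) r)) (Equiv.swap_apply_right _ _)).trans
        (vcons_zero b _)
    · rw [vcons_succ, vcons_succ, Function.comp, Equiv.swap_apply_of_ne_of_ne, vcons_succ,
        vcons_succ]
      · simp [Fin.ext_iff]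
      · simp [Fin.ext_iff]
  have hmem : ∀ i ∈ 0 :: l.map Nat.succ, i + 1 < M + 1 + 1 := by
    intro i hi
    rcases List.mem_cons.1 hi with rfl | hi
    · omega
    · exact map_succ_lt hl i hi
  have hanti : Antitone (vcons (x j) (vcons b r)) := by
    refine antitone_vcons (antitone_vcons hr_anti hr_le) fun k => ?_
    refine Fin.cases ?_ (fun k => ?_) k
    · simpa using hj.le
    · simpa using (hr_le k).trans hj.le
  rw [propOp_eq γ f hmem (by rw [hswap]; exact hanti), hswap, wprod_cons, Module.End.mul_apply]
  have hT := T_zero_cons_cons γ (wprod (T γ (M + 1 + 1)) (l.map Nat.succ) f) (x j) b r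
  simp only [← vcons_eq, wprod_map_succ_vcons] at hT
  rw [hT, ← hrx, ← propOp_eq γ _ hl hs]
  congr 2
  rw [exchange, Finset.sum_eq_single j]
  · rw [max_eq_left hj.le]
    refine intervalIntegral.integral_congr fun t ht => ?_
    rw [Set.uIcc_of_le hj.le] at ht
    -- The new value b + x_j - t is still at least b, so the same word sorts the updated vector.
    rw [propOp_eq γ _ hl (x := Function.update x j (b + x j - t)) (by
      rw [hrearr]
      exact antitone_vcons hr_anti fun k => (hr_le k).trans (by linarith [ht.2])), hrearr,
      add_comm (x j) b]
  · intro k _ hk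
    rw [max_eq_right (hothers k hk), intervalIntegral.integral_same]
  · intro h; exact absurd (Finset.mem_univ _) h

/-- Induction by peeling off b = z_0. By `transfer_vcons` the left side is the chain sum with top a
at b plus γ times an integral of chain sums with top a + b - t. On the right, keeping z_0 produces
exchange terms with tops a + b - t and b, the latter with a minus sign; moving z_0 produces those
with top b again, and they cancel. -/
theorem transfer_eq_chainSum (γ : ℝ) (μ : ℂ) {N : ℕ} (f : CF N) {a : ℝ} {z : Fin N → ℝ}
    (hz : Antitone z) (ha : ∀ k, z k ≤ a) :
    transfer γ a N μ f z = cexp μ a * chainSum γ μ N a z (propOp γ N f) := by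
  induction N generalizing a with
  | zero =>
    rw [chainSum, propOp_of_antitone γ f hz, transfer_apply, asc_zero, consEval_apply,
      Module.End.one_apply, tens_apply, mul_comm]
    congr 2
    exact Subsingleton.elim _ _
  | succ N ih =>
    set b := z 0 with hb
    set z' : Fin N → ℝ := Fin.tail z with hz'
    have hzz : z = vcons b z' := by
      ext k
      refine Fin.cases ?_ (fun k => ?_) k
      · rw [vcons_zero]
      · rw [vcons_succ]; rfl
    have hz'a : Antitone z' := antitone_tail hz
    have hz'b : ∀ k, z' k ≤ b := fun k => hz (Fin.zero_le _)
    have hba : b ≤ a := ha 0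
    set G : ℝ → (Fin N → ℝ) → ℂ := fun t x => propOp γ N (consEval t f) x with hG
    have hGc : Continuous (Function.uncurry G) := continuous_propOp_consEval γ f
    have h1 : transfer γ a (N + 1) μ f z = cexp μ a * chainSum γ μ N a z' (G b)
        + γ * ∫ t in b..a, cexp μ (a + b - t) * chainSum γ μ N (a + b - t) z' (G t) := by
      rw [hzz, transfer_vcons, ih _ hz'a fun k => (hz'b k).trans hba]
      congr 2
      refine intervalIntegral.integral_congr fun t ht => ?_
      rw [Set.uIcc_of_le hba] at ht
      exact ih _ hz'a fun k => (hz'b k).trans (by linarith [ht.2])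
    have h2 : chainSum γ μ N a z' (fun x => propOp γ (N + 1) f (vcons b x))
        = chainSum γ μ N a z' (G b) + γ * ∫ t in b..a, cexp μ (b - t) *
          (chainSum γ μ N (b + a - t) z' (G t) - chainSum γ μ N b z' (G t)) := by
      rw [chainSum_congr_of_pairwise γ μ a hz'a hz'b (fun x hx =>
        propOp_vcons_of_pairwise γ f hx), chainSum_add γ μ a z' (g := G b)
          (h := fun x => γ * exchange b G x) (ContinuousMap.continuous _)
          (continuous_const.mul (continuous_exchange b hGc)), chainSum_const_mul, chainSum_exchange γ μ hba hz'a hz'b hGc]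
    -- Once the first coordinate has moved to y ≥ b, all others stay below it, so no exchange term
    -- arises.
    have h3 : ∫ y in b..a, cexp μ (b - y) *
          chainSum γ μ N b z' (fun x => propOp γ (N + 1) f (vcons y x))
        = ∫ y in b..a, cexp μ (b - y) * chainSum γ μ N b z' (G y) := by
      refine intervalIntegral.integral_congr fun y hy => ?_
      rw [Set.uIcc_of_le hba] at hy
      congr 1
      exact chainSum_congr_le γ μ hz'a hz'b fun x hx =>
        propOp_vcons_of_le γ f fun k => (hx k).trans hy.1
    rw [h1, chainSum_succ, ← hb, ← hz', h2, h3, mul_add, mul_add, add_assoc]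
    congr 1
    rw [mul_left_comm, mul_left_comm (cexp μ a) (γ : ℂ), ← mul_add, ← mul_add,
      ← intervalIntegral.integral_add, ← intervalIntegral.integral_const_mul (cexp μ a)]
    · congr 1
      refine intervalIntegral.integral_congr fun t _ => ?_
      rw [show a + b - t = a + (b - t) by ring, cexp_add, show b + a - t = a + (b - t) by ring]
      ring
    · refine Continuous.intervalIntegrable (Continuous.mul (by fun_prop) (Continuous.sub ?_ ?_)) _ _
      · exact continuous_chainSum γ μ N hGc (by fun_prop) continuous_const
      · exact continuous_chainSum γ μ N hGc continuous_const continuous_const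
    · refine Continuous.intervalIntegrable (Continuous.mul (by fun_prop) ?_) _ _
      exact continuous_chainSum γ μ N hGc continuous_const continuous_const

/-! ### Chain sums as sums over increasing sequences of indices -/

theorem integral_Icc_vcons {n : ℕ} {F : (Fin (n + 1) → ℝ) → ℂ} (hF : Continuous F) {a b : ℝ}
    (hab : a ≤ b) (lo hi : Fin n → ℝ) :
    ∫ y in Set.Icc (vcons a lo) (vcons b hi), F y
      = ∫ t in a..b, ∫ y in Set.Icc lo hi, F (vcons t y) := by
  set e := MeasurableEquiv.piFinSuccAbove (fun _ : Fin (n + 1) => ℝ) 0 with he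
  have hsymm : ∀ q : ℝ × (Fin n → ℝ), e.symm q = vcons q.1 q.2 := by
    intro q
    rw [vcons_eq]
    exact Fin.insertNth_zero' _ _
  have hpre : e ⁻¹' (Set.Icc a b ×ˢ Set.Icc lo hi) = Set.Icc (vcons a lo) (vcons b hi) := by
    ext y
    obtain ⟨q, rfl⟩ := e.symm.surjective y
    rw [Set.mem_preimage, MeasurableEquiv.apply_symm_apply, hsymm]
    simp only [Set.mem_prod, Set.mem_Icc, Pi.le_def, Fin.forall_fin_succ, vcons_zero, vcons_succ]
    tauto
  have h1 := (volume_preserving_piFinSuccAbove (fun _ : Fin (n + 1) => ℝ) 0).setIntegral_preimage_emb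
    e.measurableEmbedding (fun q => F (vcons q.1 q.2)) (Set.Icc a b ×ˢ Set.Icc lo hi)
  rw [← he, hpre] at h1
  have h2 : ∀ y, F (vcons (e y).1 (e y).2) = F y := fun y => by
    rw [← hsymm, MeasurableEquiv.symm_apply_apply]
  simp only [h2] at h1
  rw [h1, intervalIntegral.integral_of_le hab, ← integral_Icc_eq_integral_Ioc]
  refine setIntegral_prod (fun q : ℝ × (Fin n → ℝ) => F (vcons q.1 q.2)) ?_
  have hc : Continuous fun q : ℝ × (Fin n → ℝ) => F (vcons q.1 q.2) := hF.comp (by fun_prop)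
  exact hc.continuousOn.integrableOn_compact (isCompact_Icc.prod isCompact_Icc)

theorem continuous_extend {N n : ℕ} {i : Fin n → Fin N} (hi : Function.Injective i)
    (z : Fin N → ℝ) : Continuous fun y : Fin n → ℝ => Function.extend i y z := by
  refine continuous_pi fun k => ?_
  by_cases hk : ∃ m, i m = k
  · obtain ⟨m, rfl⟩ := hk
    simp only [hi.extend_apply]
    exact continuous_apply m
  · simp only [Function.extend_apply' _ _ _ hk]
    exact continuous_const

/-- The integral over `z (i m) ≤ y m ≤ z (i (m - 1))`, with `p` for `z (i (-1))`. -/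
def chainInt (μ : ℂ) {N n : ℕ} (i : Fin n → Fin N) (p : ℝ) (z : Fin N → ℝ)
    (g : (Fin N → ℝ) → ℂ) : ℂ :=
  ∫ y in Set.Icc (fun m => z (i m)) (fun m => vcons p (z ∘ i) m.castSucc),
    cexp μ (∑ m, (z (i m) - y m)) * g (Function.extend i y z)

theorem continuous_chainInt_integrand (μ : ℂ) {N n : ℕ} {i : Fin n → Fin N}
    (hi : Function.Injective i) (z : Fin N → ℝ) {g : (Fin N → ℝ) → ℂ} (hg : Continuous g) :
    Continuous fun y : Fin n → ℝ =>
      cexp μ (∑ m, (z (i m) - y m)) * g (Function.extend i y z) :=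
  Continuous.mul (by fun_prop) (hg.comp (continuous_extend hi z))

theorem extend_succ_comp {N n : ℕ} {i : Fin n → Fin N} (hi : Function.Injective i) (b : ℝ)
    (y : Fin n → ℝ) (z : Fin N → ℝ) :
    Function.extend (Fin.succ ∘ i) y (vcons b z) = vcons b (Function.extend i y z) := by
  have hi' : Function.Injective (Fin.succ ∘ i) := (Fin.succ_injective N).comp hi
  ext k
  refine Fin.cases ?_ (fun k => ?_) k
  · rw [Function.extend_apply', vcons_zero, vcons_zero]
    rintro ⟨m, hm⟩
    exact Fin.succ_ne_zero _ hm
  · rw [vcons_succ]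
    by_cases hk : ∃ m, i m = k
    · obtain ⟨m, rfl⟩ := hk
      rw [hi.extend_apply]
      exact hi'.extend_apply y (vcons b z) m
    · rw [Function.extend_apply' _ _ _ hk, Function.extend_apply', vcons_succ]
      rintro ⟨m, hm⟩
      exact hk ⟨m, Fin.succ_injective N hm⟩

/-- The sequence of indices `0, i_1 + 1, i_2 + 1, …`. -/
def zeroCons {N n : ℕ} (i : Fin n → Fin N) : Fin (n + 1) → Fin (N + 1) :=
  Fin.cons (α := fun _ => Fin (N + 1)) 0 (Fin.succ ∘ i)

@[simp] theorem zeroCons_zero {N n : ℕ} (i : Fin n → Fin N) : zeroCons i 0 = 0 := rfl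

@[simp] theorem zeroCons_succ {N n : ℕ} (i : Fin n → Fin N) (m : Fin n) :
    zeroCons i m.succ = (i m).succ := rfl

theorem strictMono_zeroCons {N n : ℕ} {i : Fin n → Fin N} :
    StrictMono (zeroCons i) ↔ StrictMono i := by
  constructor
  · intro h a b hab
    have := h (Fin.succ_lt_succ_iff.2 hab)
    rwa [zeroCons_succ, zeroCons_succ, Fin.succ_lt_succ_iff] at this
  · intro h a b
    refine Fin.cases ?_ (fun b => ?_) b
    · intro hab; exact absurd hab (by simp)
    · refine Fin.cases (fun _ => ?_) (fun a hab => ?_) a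
      · rw [zeroCons_zero, zeroCons_succ]; exact Fin.succ_pos _
      · rw [zeroCons_succ, zeroCons_succ, Fin.succ_lt_succ_iff]
        exact h (Fin.succ_lt_succ_iff.1 hab)

theorem strictMono_succ_comp {N n : ℕ} {i : Fin n → Fin N} :
    StrictMono (Fin.succ ∘ i) ↔ StrictMono i := by
  constructor
  · intro h a b hab
    exact Fin.succ_lt_succ_iff.1 (h hab)
  · intro h a b hab
    exact Fin.succ_lt_succ_iff.2 (h hab)

theorem extend_zeroCons {N n : ℕ} {i : Fin n → Fin N} (hi : StrictMono i) (b t : ℝ)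
    (y : Fin n → ℝ) (z : Fin N → ℝ) :
    Function.extend (zeroCons i) (vcons t y) (vcons b z) = vcons t (Function.extend i y z) := by
  have hi' : Function.Injective (zeroCons i) := (strictMono_zeroCons.2 hi).injective
  ext k
  refine Fin.cases ?_ (fun k => ?_) k
  · rw [vcons_zero]
    exact (hi'.extend_apply (vcons t y) (vcons b z) 0).trans (vcons_zero t y)
  · rw [vcons_succ]
    by_cases hk : ∃ m, i m = k
    · obtain ⟨m, rfl⟩ := hk
      rw [hi.injective.extend_apply]
      exact (hi'.extend_apply (vcons t y) (vcons b z) m.succ).trans (vcons_succ t y m)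
    · rw [Function.extend_apply' _ _ _ hk, Function.extend_apply', vcons_succ]
      rintro ⟨m, hm⟩
      refine Fin.cases (fun hm => ?_) (fun m hm => ?_) m hm
      · exact Fin.succ_ne_zero _ hm.symm
      · exact hk ⟨m, Fin.succ_injective N hm⟩

theorem chainInt_succ_comp (μ : ℂ) {N n : ℕ} {i : Fin n → Fin N} (hi : Function.Injective i)
    (p b : ℝ) (z : Fin N → ℝ) (g : (Fin (N + 1) → ℝ) → ℂ) :
    chainInt μ (Fin.succ ∘ i) p (vcons b z) g = chainInt μ i p z (fun x => g (vcons b x)) := by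
  have h : vcons b z ∘ Fin.succ ∘ i = z ∘ i := by
    ext m
    exact vcons_succ b z (i m)
  simp only [chainInt, extend_succ_comp hi, h]
  simp only [Function.comp, vcons_succ]

/-- Fubini in the variable of the first index; the original value b is the upper limit for the next
moved coordinate. -/
theorem chainInt_zeroCons (μ : ℂ) {N n : ℕ} {i : Fin n → Fin N} (hi : StrictMono i)
    {p b : ℝ} (hbp : b ≤ p) (z : Fin N → ℝ) {g : (Fin (N + 1) → ℝ) → ℂ} (hg : Continuous g) :
    chainInt μ (zeroCons i) p (vcons b z) g
      = ∫ t in b..p, cexp μ (b - t) * chainInt μ i b z (fun x => g (vcons t x)) := by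
  have hlo : (fun m => vcons b z (zeroCons i m)) = vcons b (fun m => z (i m)) := by
    ext m
    refine Fin.cases ?_ (fun m => ?_) m
    · simp
    · simp
  have hhi : (fun m : Fin (n + 1) => vcons p (vcons b z ∘ zeroCons i) m.castSucc)
      = vcons p (fun m : Fin n => vcons b (z ∘ i) m.castSucc) := by
    ext m
    refine Fin.cases ?_ (fun m => ?_) m
    · simp
    · rw [← Fin.succ_castSucc, vcons_succ, vcons_succ]
      refine Fin.cases ?_ (fun k => ?_) m.castSucc
      · simp
      · simp
  rw [chainInt, hlo, hhi, integral_Icc_vcons (continuous_chainInt_integrand μ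
    (strictMono_zeroCons.2 hi).injective _ hg) hbp]
  congr 1
  ext t
  rw [chainInt, ← integral_const_mul]
  congr 1
  ext y
  rw [extend_zeroCons hi, Fin.sum_univ_succ, cexp_add]
  simp only [zeroCons_zero, zeroCons_succ, vcons_zero, vcons_succ]
  ring

open scoped Classical in
theorem sum_strictMono_zero {N : ℕ} (F : (Fin 0 → Fin (N + 1)) → ℂ) :
    ∑ i, (if StrictMono i then F i else 0)
      = ∑ i : Fin 0 → Fin N, if StrictMono i then F (Fin.succ ∘ i) else 0 := by
  rw [Fintype.sum_unique, Fintype.sum_unique, if_pos (Subsingleton.strictMono _),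
    if_pos (Subsingleton.strictMono _)]
  congr 1
  exact Subsingleton.elim _ _

-- An increasing sequence either avoids the index 0, and is then a shifted sequence, or starts with
-- it. This is the alternative in the recursion of `chainSum`.
open scoped Classical in
theorem sum_strictMono_succ {N n : ℕ} (F : (Fin (n + 1) → Fin (N + 1)) → ℂ) :
    ∑ i, (if StrictMono i then F i else 0)
      = ∑ i : Fin (n + 1) → Fin N, (if StrictMono i then F (Fin.succ ∘ i) else 0)
        + ∑ i : Fin n → Fin N, if StrictMono i then F (zeroCons i) else 0 := by
  have h1 : ∑ i : Fin (n + 1) → Fin N, (if StrictMono i then F (Fin.succ ∘ i) else 0)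
      = ∑ i : Fin (n + 1) → Fin (N + 1),
        if i 0 = 0 then 0 else if StrictMono i then F i else 0 := by
    refine Fintype.sum_of_injective (fun i => Fin.succ ∘ i)
      ((Fin.succ_injective N).comp_left) _ _ (fun i hi => ?_) fun i => ?_
    · by_contra hne
      split_ifs at hne with h0 hm
      · exact hne rfl
      · refine hi ⟨fun m => (i m).pred fun h => h0 ?_, ?_⟩
        · exact le_antisymm (h ▸ hm.monotone (Fin.zero_le m)) (Fin.zero_le _)
        · ext m; simp
      · exact hne rfl
    · rw [if_neg (show ¬ (Fin.succ ∘ i) 0 = 0 from Fin.succ_ne_zero _)]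
      simp only [strictMono_succ_comp]
  have h2 : ∑ i : Fin n → Fin N, (if StrictMono i then F (zeroCons i) else 0)
      = ∑ i : Fin (n + 1) → Fin (N + 1),
        if i 0 = 0 then (if StrictMono i then F i else 0) else 0 := by
    refine Fintype.sum_of_injective zeroCons ?_ _ _ (fun i hi => ?_) fun i => ?_
    · intro i j hij
      ext m
      have := congrFun hij m.succ
      rw [zeroCons_succ, zeroCons_succ] at this
      exact congrArg Fin.val (Fin.succ_injective N this)
    · by_contra hne
      split_ifs at hne with h0 hm
      · refine hi ⟨fun m => (i m.succ).pred fun h => ?_, ?_⟩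
        · have := hm (Fin.succ_pos m)
          rw [h] at this
          exact absurd this (by simp)
        · ext m
          refine Fin.cases ?_ (fun m => ?_) m
          · rw [zeroCons_zero, h0]
          · rw [zeroCons_succ, Fin.succ_pred]
      · exact hne rfl
      · exact hne rfl
    · rw [if_pos (zeroCons_zero i)]
      simp only [strictMono_zeroCons]
  rw [h1, h2, ← Finset.sum_add_distrib]
  refine Finset.sum_congr rfl fun i _ => ?_
  split_ifs <;> simp

open scoped Classical in
theorem chainSum_eq_sum (γ : ℝ) (μ : ℂ) {N : ℕ} {p : ℝ} {z : Fin N → ℝ} (hz : Antitone z)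
    (hp : ∀ k, z k ≤ p) {g : (Fin N → ℝ) → ℂ} (hg : Continuous g) :
    chainSum γ μ N p z g = ∑ n ∈ Finset.range (N + 1), (γ : ℂ) ^ n *
      ∑ i : Fin n → Fin N, if StrictMono i then chainInt μ i p z g else 0 := by
  induction N generalizing p with
  | zero =>
    rw [chainSum, zero_add, Finset.sum_range_one, pow_zero, one_mul, Fintype.sum_unique,
      if_pos (Subsingleton.strictMono _), chainInt]
    have h : (Set.Icc (fun m : Fin 0 => z ((default : Fin 0 → Fin 0) m))
        fun m => vcons p (z ∘ default) m.castSucc) = Set.univ :=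
      Set.eq_univ_of_forall fun y => ⟨fun m => m.elim0, fun m => m.elim0⟩
    rw [h, Measure.restrict_univ]
    have h0 : ∀ y : Fin 0 → ℝ, Function.extend (default : Fin 0 → Fin 0) y z = z := fun y =>
      Subsingleton.elim _ _
    simp [h0, cexp, volume_pi, measureReal_def]
  | succ N ih =>
    set b := z 0 with hb
    set z' : Fin N → ℝ := Fin.tail z with hz'
    have hzz : z = vcons b z' := by
      ext k
      refine Fin.cases ?_ (fun k => ?_) k
      · rw [vcons_zero]
      · rw [vcons_succ]; rfl
    have hz'a : Antitone z' := antitone_tail hz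
    have hz'b : ∀ k, z' k ≤ b := fun k => hz (Fin.zero_le _)
    have hbp : b ≤ p := hp 0
    have hgc : ∀ t, Continuous fun x => g (vcons t x) := fun t => hg.comp (by fun_prop)
    -- the sequences that avoid the first index and those that contain it
    set S : (n : ℕ) → ℂ := fun n => ∑ i : Fin n → Fin N,
      if StrictMono i then chainInt μ i p z' (fun x => g (vcons b x)) else 0 with hS
    set R : (n : ℕ) → ℝ → ℂ := fun n t => ∑ i : Fin n → Fin N,
      if StrictMono i then chainInt μ i b z' (fun x => g (vcons t x)) else 0 with hR
    have hRc : ∀ n, Continuous (R n) := by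
      intro n
      refine continuous_finsetSum _ fun i _ => ?_
      split_ifs with hi
      · refine continuous_parametric_integral_of_continuous (f := fun t y =>
          cexp μ (∑ m, (z' (i m) - y m)) * g (vcons t (Function.extend i y z'))) ?_ isCompact_Icc
        have := continuous_extend hi.injective z'
        exact Continuous.mul (by fun_prop) (hg.comp (by fun_prop))
      · exact continuous_const
    have hz0 : (∑ i : Fin 0 → Fin (N + 1), if StrictMono i then chainInt μ i p z g else 0)
        = S 0 := by
      rw [sum_strictMono_zero, hzz]
      refine Finset.sum_congr rfl fun i _ => ?_
      split_ifs with hi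
      · exact chainInt_succ_comp μ hi.injective p b z' g
      · rfl
    have hzs : ∀ n, (∑ i : Fin (n + 1) → Fin (N + 1),
        if StrictMono i then chainInt μ i p z g else 0)
        = S (n + 1) + ∫ t in b..p, cexp μ (b - t) * R n t := by
      intro n
      rw [sum_strictMono_succ, hzz]
      congr 1
      · refine Finset.sum_congr rfl fun i _ => ?_
        split_ifs with hi
        · exact chainInt_succ_comp μ hi.injective p b z' g
        · rfl
      · simp only [hR, Finset.mul_sum]
        rw [intervalIntegral.integral_finsetSum]
        · refine Finset.sum_congr rfl fun i _ => ?_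
          split_ifs with hi
          · exact chainInt_zeroCons μ hi hbp z' hg
          · simp
        · intro i _
          refine Continuous.intervalIntegrable (Continuous.mul (by fun_prop) ?_) _ _
          split_ifs with hi
          · refine continuous_parametric_integral_of_continuous (f := fun t y =>
              cexp μ (∑ m, (z' (i m) - y m)) * g (vcons t (Function.extend i y z'))) ?_
              isCompact_Icc
            have := continuous_extend hi.injective z'
            exact Continuous.mul (by fun_prop) (hg.comp (by fun_prop))
          · exact continuous_const
    -- N has no N + 1 distinct indices below it; this drops the top term, so that both groups of
    -- sequences run over the same lengths.
    have hSN : S (N + 1) = 0 := by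
      refine Finset.sum_eq_zero fun i _ => if_neg fun hi => ?_
      have := Fintype.card_le_of_injective i hi.injective
      simp at this
    rw [chainSum_succ, ← hb, ← hz', ih hz'a (fun k => (hz'b k).trans hbp) (hgc b)]
    have h1 : ∀ t, chainSum γ μ N b z' (fun x => g (vcons t x))
        = ∑ n ∈ Finset.range (N + 1), (γ : ℂ) ^ n * R n t := fun t => ih hz'a hz'b (hgc t)
    simp only [h1]
    rw [Finset.sum_range_succ' _ (N + 1)]
    simp only [hzs, hz0, mul_add, Finset.sum_add_distrib]
    have h2 : ∑ n ∈ Finset.range (N + 1), (γ : ℂ) ^ (n + 1) * S (n + 1) + (γ : ℂ) ^ 0 * S 0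
        = ∑ n ∈ Finset.range (N + 1), (γ : ℂ) ^ n * S n := by
      rw [← Finset.sum_range_succ' (fun n => (γ : ℂ) ^ n * S n), Finset.sum_range_succ _ (N + 1),
        hSN, mul_zero, add_zero]
    rw [add_right_comm, h2]
    congr 1
    simp only [Finset.mul_sum]
    rw [intervalIntegral.integral_finsetSum, Finset.mul_sum]
    · refine Finset.sum_congr rfl fun n _ => ?_
      simp only [mul_left_comm (cexp μ _), intervalIntegral.integral_const_mul]
      ring
    · intro n _
      exact (Continuous.mul (by fun_prop) (continuous_const.mul (hRc n))).intervalIntegrable _ _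

/-! ### The operators `a` on propagated functions -/

theorem setIntegral_univ_pi_Ioc {n : ℕ} (lo hi : Fin n → ℝ) (F : (Fin n → ℝ) → ℂ) :
    ∫ y in Set.univ.pi fun m => Set.Ioc (lo m) (hi m), F y = ∫ y in Set.Icc lo hi, F y := by
  rw [volume_pi, setIntegral_congr_set Measure.univ_pi_Ioc_ae_eq_Icc]

theorem nodes_minus_bdry {N n : ℕ} (xp xm : ℝ) (i : Fin n ↪ Fin N) (x : Fin N → ℝ) :
    nodes .minus i (bdry xp xm .minus x) = vcons xm (x ∘ i) := by
  ext m
  refine Fin.cases ?_ (fun m => ?_) m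
  · simp [nodes, bdry]
  · simp [nodes, bdry, Side.shift]

theorem eHat_minus_bdry {N n : ℕ} (xp xm : ℝ) (μ : ℂ) (i : Fin n ↪ Fin N)
    (g : (Fin N → ℝ) → ℂ) (x : Fin N → ℝ) :
    eHat .minus μ i g (bdry xp xm .minus x) =
      open scoped Classical in
      if ∀ m : Fin n, vcons xm (x ∘ i) m.succ < vcons xm (x ∘ i) m.castSucc then
        cexp μ xm * ∫ y in Set.Icc (fun m => x (i m)) (fun m => vcons xm (x ∘ i) m.castSucc),
          cexp μ (∑ m, (x (i m) - y m)) * g (Function.extend i y x)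
      else 0 := by
  classical
  rw [eHat]
  simp only [nodes_minus_bdry, bdry_shift, hatPhi, barPhi]
  refine if_congr Iff.rfl ?_ rfl
  have h0 : bdry xp xm .minus x (Side.minus.newIdx N) = xm := by simp [bdry, Side.newIdx]
  rw [h0]
  congr 1
  have h1 : ∀ m : Fin n, vcons xm (x ∘ i) m.succ = x (i m) := fun m => by simp
  simp only [h1]
  rw [setIntegral_univ_pi_Ioc]
  simp only [cexp]
  push_cast
  rfl

-- At a point with distinct coordinates below x^-, an index tuple satisfies the ordering condition
-- exactly when its image under the sorting permutation w is increasing. Reindexing by w turns the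
-- sum into one over increasing sequences at the sorted point; sequences not of the form w ∘ i are
-- not injective.
open scoped Classical in
theorem sum_eHat_minus {N n : ℕ} (xp xm : ℝ) (μ : ℂ) (g : (Fin N → ℝ) → ℂ) {x : Fin N → ℝ}
    (hx : Function.Injective x) (hxm : ∀ k, x k < xm) (w : Equiv.Perm (Fin N))
    (hw : Antitone (x ∘ ⇑(w⁻¹))) :
    ∑ i : Fin n ↪ Fin N, eHat .minus μ i g (bdry xp xm .minus x)
      = cexp μ xm * ∑ i : Fin n → Fin N,
        if StrictMono i then chainInt μ i xm (x ∘ ⇑(w⁻¹)) (fun y => g (y ∘ w)) else 0 := by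
  set z : Fin N → ℝ := x ∘ ⇑(w⁻¹) with hz
  have hzw : ∀ k, z (w k) = x k := fun k => congrArg x (w.symm_apply_apply k)
  have hza : StrictAnti z := hw.strictAnti_of_injective (hx.comp (w⁻¹).injective)
  rw [Finset.mul_sum]
  refine Fintype.sum_of_injective (fun (i : Fin n ↪ Fin N) m => w (i m)) ?_ _ _
    (fun i hi => ?_) fun i => ?_
  · intro i j hij
    ext m
    exact congrArg Fin.val (w.injective (congrFun hij m))
  · rw [if_neg, mul_zero]
    intro hm
    refine hi ⟨⟨fun m => w⁻¹ (i m), (w⁻¹).injective.comp hm.injective⟩, ?_⟩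
    ext m
    exact congrArg Fin.val (w.apply_symm_apply (i m))
  · have hcomp : z ∘ (fun m => w (i m)) = x ∘ i := funext fun m => hzw (i m)
    rw [eHat_minus_bdry]
    have hiff : (∀ m : Fin n, vcons xm (x ∘ i) m.succ < vcons xm (x ∘ i) m.castSucc)
        ↔ StrictMono fun m => w (i m) := by
      rw [← Fin.strictAnti_iff_succ_lt]
      constructor
      · intro h a b hab
        have h1 := h (Fin.succ_lt_succ_iff.2 hab)
        rw [vcons_succ, vcons_succ, ← hcomp] at h1
        exact hza.lt_iff_gt.1 h1
      · intro h a b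
        refine Fin.cases ?_ (fun b => ?_) b
        · intro hab; exact absurd hab (by simp)
        · refine Fin.cases (fun _ => ?_) (fun a hab => ?_) a
          · rw [vcons_zero, vcons_succ]; exact hxm _
          · rw [vcons_succ, vcons_succ, ← hcomp]
            exact hza (h (Fin.succ_lt_succ_iff.1 hab))
    rw [mul_ite, mul_zero]
    refine if_congr hiff ?_ rfl
    rw [chainInt, hcomp]
    simp only [hzw]
    congr 2
    ext y
    congr 2
    ext k
    simp only [Function.comp]
    by_cases hk : ∃ m, i m = k
    · obtain ⟨m, rfl⟩ := hk
      rw [i.injective.extend_apply]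
      exact ((w.injective.comp i.injective).extend_apply y z m).symm
    · rw [Function.extend_apply' _ _ _ hk, Function.extend_apply', hzw]
      rintro ⟨m, hm⟩
      exact hk ⟨m, w.injective hm⟩

/-- Sorting x by w replaces f by w^γ f through the covariance of P; at the sorted point the formula
is a chain sum, hence a transfer, and w^γ then comes out of the transfer and is absorbed into P. -/
theorem aFun_minus_propOp (γ xp xm : ℝ) (μ : ℂ) {N : ℕ} (f : CF N) {x : Fin N → ℝ}
    (hx : Function.Injective x) (hxm : ∀ k, x k < xm) :
    aFun γ xp xm .minus μ (propOp γ N f) x = propOp γ N (transfer γ xm N μ f) x := by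
  classical
  obtain ⟨l, hl, -, hs⟩ := exists_antitone_rearr x
  have h1 : aFun γ xp xm .minus μ (propOp γ N f) x = cexp μ xm *
      ∑ n ∈ Finset.range (N + 1), (γ : ℂ) ^ n * ∑ i : Fin n → Fin N, if StrictMono i then
        chainInt μ i xm (rearr l x) (fun y => propOp γ N f (y ∘ ⇑(wprod (finSwap N) l))) else 0 := by
    rw [aFun, checkPhi, bFun, Finset.mul_sum]
    refine Finset.sum_congr rfl fun n _ => ?_
    rw [sum_eHat_minus xp xm μ _ hx hxm _ hs, mul_left_comm]
    rfl
  have h2 : ∀ y : Fin N → ℝ, propOp γ N f (y ∘ ⇑(wprod (finSwap N) l))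
      = propOp γ N (wprod (T γ N) l f) y := by
    intro y
    rw [← propOp_rearr γ f _ hl]
    congr 1
    ext k
    exact congrArg y ((wprod (finSwap N) l).apply_symm_apply k)
  simp only [h2] at h1
  have hle : ∀ k, rearr l x k ≤ xm := fun k => (hxm _).le
  rw [h1, ← chainSum_eq_sum γ μ hs hle (ContinuousMap.continuous _),
    ← transfer_eq_chainSum γ μ _ hs hle, transfer_wprod γ xm μ hl, ← propOp_eq γ _ hl hs]

/-! ### Reflection -/

/-- The reflection `x ↦ (-x_N, …, -x_1)`. -/
def refl {N : ℕ} (x : Fin N → ℝ) : Fin N → ℝ := fun k => -x k.rev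

@[simp] theorem refl_refl {N : ℕ} (x : Fin N → ℝ) : refl (refl x) = x := by
  ext k; simp [refl]

theorem continuous_refl {N : ℕ} : Continuous (refl (N := N)) := by
  unfold refl; fun_prop

/-- Composition with the reflection. -/
def reflComp (N : ℕ) : Module.End ℂ (CF N) where
  toFun f := ⟨fun x => f (refl x), f.continuous.comp continuous_refl⟩
  map_add' _ _ := rfl
  map_smul' _ _ := rfl

theorem reflComp_apply {N : ℕ} (f : CF N) (x : Fin N → ℝ) : reflComp N f x = f (refl x) := rfl

theorem reflComp_reflComp {N : ℕ} (f : CF N) : reflComp N (reflComp N f) = f := by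
  ext x; rw [reflComp_apply, reflComp_apply, refl_refl]

theorem refl_comp_swap {N : ℕ} (i k : Fin N) (x : Fin N → ℝ) :
    refl (x ∘ Equiv.swap i k) = refl x ∘ Equiv.swap i.rev k.rev := by
  ext j
  simp only [refl, Function.comp, Equiv.swap_apply_def]
  congr 2
  simp only [Fin.rev_eq_iff]
  split_ifs <;> simp

theorem reflOp_reflComp {N : ℕ} (γ : ℝ) (i k : Fin N) (f : CF N) :
    reflOp γ i k (reflComp N f) = reflComp N (reflOp γ k.rev i.rev f) := by
  ext x
  simp only [reflOp_apply, reflComp_apply]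
  rw [refl_comp_swap, Equiv.swap_comm]
  congr 2
  have h1 : refl x k.rev - refl x i.rev = x i - x k := by simp [refl]; ring
  rw [h1]
  congr 1
  ext y
  congr 1
  ext j
  simp only [refl, Pi.sub_apply, Pi.smul_apply, smul_eq_mul, Pi.single_apply, Fin.rev_eq_iff]
  ring

/-- Reversal with negation maps e_j - e_{j+1} to a difference of adjacent basis vectors of the same
orientation, so γ keeps its sign. -/
theorem T_reflComp (γ : ℝ) {N j : ℕ} (hj : j + 1 < N) (f : CF N) :
    T γ N j (reflComp N f) = reflComp N (T γ N (N - 2 - j) f) := by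
  rw [T_of_lt γ hj, T_of_lt γ (show N - 2 - j + 1 < N by omega), reflOp_reflComp]
  congr 4 <;> simp only [Fin.ext_iff, Fin.val_rev] <;> omega

theorem wprod_T_reflComp (γ : ℝ) {N : ℕ} {l : List ℕ} (hl : ∀ j ∈ l, j + 1 < N) (f : CF N) :
    wprod (T γ N) l (reflComp N f) = reflComp N (wprod (T γ N) (l.map fun j => N - 2 - j) f) := by
  induction l with
  | nil => rfl
  | cons j l ih =>
    rw [List.map_cons, wprod_cons, wprod_cons, Module.End.mul_apply, Module.End.mul_apply,
      ih fun i hi => hl i (List.mem_cons_of_mem _ hi), T_reflComp γ (hl j List.mem_cons_self)]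

theorem refl_rearr {N : ℕ} {l : List ℕ} (hl : ∀ j ∈ l, j + 1 < N) (x : Fin N → ℝ) :
    refl (rearr l x) = rearr (l.map fun j => N - 2 - j) (refl x) := by
  induction l with
  | nil => rfl
  | cons j l ih =>
    have hj : j + 1 < N := hl j List.mem_cons_self
    rw [List.map_cons, rearr_cons, rearr_cons, finSwap_of_lt hj, refl_comp_swap,
      ih fun i hi => hl i (List.mem_cons_of_mem _ hi),
      finSwap_of_lt (show N - 2 - j + 1 < N by omega), Equiv.swap_comm]
    congr 3 <;> simp only [Fin.ext_iff, Fin.val_rev] <;> omega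

/-- The reflection preserves the fundamental chamber and permutes the simple swaps, so it carries
sorting words to sorting words. -/
theorem propOp_reflComp (γ : ℝ) {N : ℕ} (f : CF N) :
    propOp γ N (reflComp N f) = reflComp N (propOp γ N f) := by
  ext x
  obtain ⟨l, hl, -, hs⟩ := exists_antitone_rearr x
  rw [propOp_eq γ _ hl hs, wprod_T_reflComp γ hl, reflComp_apply, reflComp_apply, refl_rearr hl,
    propOp_eq γ f]
  · intro j hj
    obtain ⟨i, hi, rfl⟩ := List.mem_map.1 hj
    have := hl i hi
    omega
  · rw [← refl_rearr hl]
    intro a b hab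
    exact neg_le_neg (hs (Fin.rev_le_rev.2 hab))

theorem nodes_plus_bdry {N n : ℕ} (xp xm : ℝ) (i : Fin n ↪ Fin N) (x : Fin N → ℝ)
    (m : Fin (n + 1)) :
    nodes .plus i (bdry xp xm .plus x) m
      = -vcons (-xp) (fun k => refl x (i k.rev).rev) m.rev := by
  refine Fin.lastCases ?_ (fun m => ?_) m
  · simp [nodes, bdry]
  · rw [Fin.rev_castSucc]
    simp [nodes, bdry, Side.shift, refl]

theorem refl_extend {N n : ℕ} (i : Fin n ↪ Fin N) (y : Fin n → ℝ) (x : Fin N → ℝ) :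
    refl (Function.extend i y x) = Function.extend (fun m => (i m.rev).rev) (refl y) (refl x) := by
  have hinj : Function.Injective fun m : Fin n => (i m.rev).rev :=
    Fin.rev_injective.comp (i.injective.comp Fin.rev_injective)
  ext k
  by_cases hk : ∃ m : Fin n, (i m.rev).rev = k
  · obtain ⟨m, rfl⟩ := hk
    rw [refl, Fin.rev_rev, i.injective.extend_apply]
    exact (hinj.extend_apply (refl y) (refl x) m).symm
  · rw [Function.extend_apply' _ _ _ hk, refl, Function.extend_apply', refl]
    rintro ⟨m, hm⟩
    exact hk ⟨m.rev, by rw [Fin.rev_rev, hm, Fin.rev_rev]⟩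

/-- The conjugation of a tuple of indices by the order reversal. -/
def revEmb {N n : ℕ} (i : Fin n ↪ Fin N) : Fin n ↪ Fin N :=
  ⟨fun m => (i m.rev).rev, Fin.rev_injective.comp (i.injective.comp Fin.rev_injective)⟩

theorem revEmb_revEmb {N n : ℕ} (i : Fin n ↪ Fin N) : revEmb (revEmb i) = i := by
  ext m
  simp [revEmb]

theorem measurePreserving_refl (n : ℕ) :
    MeasurePreserving (refl (N := n)) volume volume := by
  have h1 := volume_measurePreserving_piCongrLeft (fun _ : Fin n => ℝ) Fin.revPerm
  have h2 : MeasurePreserving (fun y : Fin n → ℝ => fun k => -y k) volume volume :=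
    volume_preserving_pi fun _ => Measure.measurePreserving_neg volume
  have h3 := h2.comp h1
  convert h3 using 1
  ext y k
  have := MeasurableEquiv.piCongrLeft_apply_apply (β := fun _ : Fin n => ℝ) Fin.revPerm y k.rev
  simp only [Fin.revPerm_apply, Fin.rev_rev] at this
  simp only [refl, Function.comp, this]

theorem measurableEmbedding_refl (n : ℕ) : MeasurableEmbedding (refl (N := n)) :=
  (Homeomorph.mk ⟨refl, refl, refl_refl, refl_refl⟩ continuous_refl
    continuous_refl : (Fin n → ℝ) ≃ₜ (Fin n → ℝ)).measurableEmbedding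

/-- Under the reflection J becomes [-x^-, -x^+], the added particle moves from the first to the last
place, the node sequence is reversed and negated, and μ changes sign in the phases. -/
theorem eHat_plus_bdry {N n : ℕ} (xp xm : ℝ) (μ : ℂ) (i : Fin n ↪ Fin N)
    (g : (Fin N → ℝ) → ℂ) (x : Fin N → ℝ) :
    eHat .plus μ i g (bdry xp xm .plus x)
      = eHat .minus (-μ) (revEmb i) (fun y => g (refl y)) (bdry (-xm) (-xp) .minus (refl x)) := by
  classical
  set q : Fin (n + 1) → ℝ := vcons (-xp) (fun k => refl x (i k.rev).rev) with hq
  have hq' : vcons (-xp) (refl x ∘ revEmb i) = q := rfl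
  have hiff : (∀ m : Fin n, nodes .plus i (bdry xp xm .plus x) m.succ
        < nodes .plus i (bdry xp xm .plus x) m.castSucc)
      ↔ ∀ m : Fin n, q m.succ < q m.castSucc := by
    simp only [nodes_plus_bdry, neg_lt_neg_iff, ← hq, Fin.rev_castSucc, Fin.rev_succ]
    constructor
    · intro h m
      simpa using h m.rev
    · intro h m
      exact h m.rev
  rw [eHat_minus_bdry, hq', eHat]
  refine if_congr hiff ?_ rfl
  have h0 : bdry xp xm .plus x (Side.plus.newIdx N) = xp := by simp [bdry, Side.newIdx]
  rw [h0]
  congr 1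
  · rw [cexp]; congr 1; push_cast; ring
  rw [setIntegral_univ_pi_Ioc]
  have hset : refl ⁻¹' (Set.Icc (fun m => refl x (revEmb i m)) fun m => q m.castSucc)
      = Set.Icc (fun m : Fin n => nodes .plus i (bdry xp xm .plus x) m.succ)
          fun m => nodes .plus i (bdry xp xm .plus x) m.castSucc := by
    ext y
    simp only [Set.mem_preimage, Set.mem_Icc, Pi.le_def, nodes_plus_bdry, ← hq, Fin.rev_succ,
      Fin.rev_castSucc]
    have h1 : ∀ m : Fin n, q m.succ = refl x (revEmb i m) := fun m => by
      rw [hq, vcons_succ]; rfl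
    simp only [h1, refl]
    constructor
    · rintro ⟨h2, h3⟩
      refine ⟨fun m => ?_, fun m => ?_⟩
      · have := h3 m.rev
        rw [Fin.rev_rev] at this
        linarith
      · have := h2 m.rev
        simp only [Fin.rev_rev] at this
        linarith
    · rintro ⟨h2, h3⟩
      refine ⟨fun m => ?_, fun m => ?_⟩
      · have := h3 m.rev
        rw [Fin.rev_rev] at this
        linarith
      · have := h2 m.rev
        rw [Fin.rev_rev] at this
        linarith
  rw [← hset]
  -- The integration variables are reflected as well, which preserves volume.
  refine Eq.trans ?_ ((measurePreserving_refl n).setIntegral_preimage_emb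
    (measurableEmbedding_refl n) _ _)
  congr 1
  ext y
  simp only [hatPhi, barPhi, bdry_shift]
  congr 1
  · rw [cexp]
    congr 1
    have h4 : ∑ m, (refl x (revEmb i m) - refl y m) = -∑ m, (x (i m) - y m) := by
      rw [← Finset.sum_neg_distrib, ← Equiv.sum_comp Fin.revPerm]
      refine Finset.sum_congr rfl fun m _ => ?_
      simp only [refl, revEmb, Fin.revPerm_apply, Function.Embedding.coeFn_mk, Fin.rev_rev]
      ring
    rw [h4]
    push_cast
    ring
  · congr 1
    rw [← refl_refl (Function.extend i y x), refl_extend]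
    rfl

theorem aFun_plus (γ xp xm : ℝ) (μ : ℂ) {N : ℕ} (g : (Fin N → ℝ) → ℂ) (x : Fin N → ℝ) :
    aFun γ xp xm .plus μ g x
      = aFun γ (-xm) (-xp) .minus (-μ) (fun y => g (refl y)) (refl x) := by
  rw [aFun, aFun, checkPhi, checkPhi, bFun, bFun]
  refine Finset.sum_congr rfl fun n _ => ?_
  congr 1
  refine Fintype.sum_equiv ⟨revEmb, revEmb, revEmb_revEmb, revEmb_revEmb⟩ _ _ fun i => ?_
  exact eHat_plus_bdry xp xm μ i g x

/-! ### Intertwiners for both signs -/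

/-- The operator on continuous functions that corresponds to `a^ε_μ` under propagation. -/
def inter (γ xp xm : ℝ) (N : ℕ) (ε : Side) (μ : ℂ) : Module.End ℂ (CF N) :=
  match ε with
  | .plus => reflComp N * transfer γ (-xp) N (-μ) * reflComp N
  | .minus => transfer γ xm N μ

theorem inter_comm (γ xp xm : ℝ) {N : ℕ} (ε : Side) (μ ν : ℂ) (f : CF N) :
    inter γ xp xm N ε μ (inter γ xp xm N ε ν f) = inter γ xp xm N ε ν (inter γ xp xm N ε μ f) := by
  cases ε
  · simp only [inter, Module.End.mul_apply, reflComp_reflComp]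
    rw [transfer_comm]
  · exact transfer_comm γ xm μ ν f

theorem aFun_propOp (γ xp xm : ℝ) (ε : Side) (μ : ℂ) {N : ℕ} (f : CF N) {x : Fin N → ℝ}
    (hx : Function.Injective x) (hxJ : ∀ k, x k ∈ Set.Ioo xp xm) :
    aFun γ xp xm ε μ (propOp γ N f) x = propOp γ N (inter γ xp xm N ε μ f) x := by
  cases ε
  · have h1 : Function.Injective (refl x) :=
      neg_injective.comp (hx.comp Fin.rev_injective)
    have h2 := aFun_minus_propOp γ (-xm) (-xp) (-μ) (reflComp N f) h1
      fun k => neg_lt_neg (hxJ _).1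
    rw [propOp_reflComp] at h2
    rw [aFun_plus, inter, Module.End.mul_apply, Module.End.mul_apply, propOp_reflComp,
      reflComp_apply, ← h2]
    rfl
  · exact aFun_minus_propOp γ xp xm μ f hx fun k => (hxJ k).2

/-! ### Passage to `L²(J^N)` -/

theorem memLp_continuousMap {N : ℕ} (xp xm : ℝ) (f : CF N) :
    MemLp f 2 (cubeMeasure N xp xm) := by
  obtain ⟨C, hC⟩ := (isCompact_univ_pi fun _ : Fin N => isCompact_Icc
    (a := xp) (b := xm)).exists_bound_of_continuousOn f.continuous.continuousOn
  refine MemLp.of_bound f.continuous.aestronglyMeasurable C ?_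
  filter_upwards [ae_mem_cube N xp xm] with x hx
  exact hC x fun k _ => hx k

/-- The class in `L²(J^N)` of a continuous function on `ℝ^N`. -/
def toL2 (N : ℕ) (xp xm : ℝ) : CF N →ₗ[ℂ] Sector N xp xm where
  toFun f := (memLp_continuousMap xp xm f).toLp f
  map_add' f g :=
    MemLp.toLp_add (memLp_continuousMap xp xm f) (memLp_continuousMap xp xm g)
  map_smul' c f := MemLp.toLp_const_smul c (memLp_continuousMap xp xm f)

theorem coeFn_toL2 {N : ℕ} (xp xm : ℝ) (f : CF N) :
    toL2 N xp xm f =ᵐ[cubeMeasure N xp xm] f :=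
  MemLp.coeFn_toLp (memLp_continuousMap xp xm f)

theorem toL2_propOp_pw {N : ℕ} (xp xm γ : ℝ) (lam : Fin N → ℂ) :
    toL2 N xp xm (propOp γ N (pw lam)) = psiL2 xp xm γ lam := rfl

theorem norm_toL2_le (N : ℕ) (xp xm : ℝ) : ∃ K : ℝ, 0 ≤ K ∧ ∀ (f : CF N) (c : ℝ), 0 ≤ c →
    (∀ x : Fin N → ℝ, (∀ k, x k ∈ Set.Icc xp xm) → ‖f x‖ ≤ c) → ‖toL2 N xp xm f‖ ≤ K * c := by
  refine ⟨(cubeMeasure N xp xm Set.univ ^ (2 : ℝ≥0∞).toReal⁻¹).toReal, ENNReal.toReal_nonneg,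
    fun f c hc hf => ?_⟩
  rw [← ENNReal.toReal_ofReal hc, ← ENNReal.toReal_mul]
  change ‖(memLp_continuousMap xp xm f).toLp f‖ ≤ _
  rw [Lp.norm_toLp]
  refine ENNReal.toReal_mono ?_ (eLpNorm_le_of_ae_bound (C := c) ?_)
  · exact ENNReal.mul_ne_top (ENNReal.rpow_ne_top_of_nonneg (by positivity)
      (measure_ne_top _ _)) ENNReal.ofReal_ne_top
  · filter_upwards [ae_mem_cube N xp xm] with x hx using hf x hx

/-- Approximation of f by plane waves uniformly on the cube survives P and the passage to L², both
being bounded for the supremum there. It is needed because the intertwiner takes a plane wave out of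
the span of plane waves. -/
theorem toL2_propOp_mem_zBar {N : ℕ} (xp xm γ : ℝ) (f : CF N) :
    toL2 N xp xm (propOp γ N f) ∈ zBar N xp xm γ := by
  have hspan : ∀ g ∈ Submodule.span ℂ (Set.range (pw (N := N))),
      toL2 N xp xm (propOp γ N g) ∈
        Submodule.span ℂ (Set.range fun lam : Fin N → ℂ => psiL2 xp xm γ lam) := by
    intro g hg
    have h := Submodule.mem_map_of_mem (f := (toL2 N xp xm).comp (propOp γ N)) hg
    rw [Submodule.map_span, ← Set.range_comp] at h
    exact h
  obtain ⟨K, hK, hn⟩ := norm_toL2_le N xp xm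
  obtain ⟨B, hB, hp⟩ := cubeBdd_propOp γ N xp xm
  refine Metric.mem_closure_iff.2 fun ε hε => ?_
  have hδ : 0 < ε / (K * B + 1) := by positivity
  obtain ⟨g, hg, hfg⟩ := exists_span_pw_near xp xm f hδ
  refine ⟨_, hspan g hg, ?_⟩
  rw [dist_eq_norm, ← map_sub, ← map_sub]
  have h := hn (propOp γ N (f - g)) _ (by positivity) (hp (f - g) _ hfg)
  refine h.trans_lt ?_
  rw [← mul_assoc, ← mul_div_assoc, div_lt_iff₀ (by positivity)]
  nlinarith

theorem ae_mem_Ioo (N : ℕ) (xp xm : ℝ) :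
    ∀ᵐ x ∂cubeMeasure N xp xm, ∀ k, x k ∈ Set.Ioo xp xm := by
  have h : (Set.univ.pi fun _ : Fin N => Set.Ioo xp xm) =ᵐ[volume]
      Set.univ.pi fun _ => Set.Icc xp xm := by
    rw [volume_pi]
    exact Measure.ae_eq_set_pi fun _ _ => Ioo_ae_eq_Icc
  rw [cubeMeasure, ← Measure.restrict_congr_set h]
  filter_upwards [ae_restrict_mem (MeasurableSet.univ_pi fun _ => measurableSet_Ioo)] with x hx k
  exact hx k (Set.mem_univ k)

/-- Each diagonal x_j = x_k is a proper subspace, hence a null set. -/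
theorem ae_injective (N : ℕ) (xp xm : ℝ) :
    ∀ᵐ x ∂cubeMeasure N xp xm, Function.Injective x := by
  refine ae_restrict_of_ae ?_
  have h : ∀ j k : Fin N, j ≠ k → ∀ᵐ x : Fin N → ℝ, x j ≠ x k := by
    intro j k hjk
    set p : (Fin N → ℝ) →ₗ[ℝ] ℝ := 
      LinearMap.proj (R := ℝ) (φ := fun _ : Fin N => ℝ) j - LinearMap.proj k with hp
    have hne : LinearMap.ker p ≠ ⊤ := by
      intro h
      have h1 : Pi.single j (1 : ℝ) ∈ LinearMap.ker p := h ▸ Submodule.mem_top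
      simp [hp, hjk.symm] at h1
    have h0 := Measure.addHaar_submodule (volume : Measure (Fin N → ℝ)) _ hne
    rw [ae_iff]
    refine measure_mono_null (fun x hx => ?_) h0
    simpa [hp, sub_eq_zero] using hx
  have h' : ∀ᵐ x : Fin N → ℝ, ∀ j k : Fin N, j ≠ k → x j ≠ x k := by
    simpa only [ae_all_iff] using h
  filter_upwards [h'] with x hx j k hjk
  by_contra hne
  exact hx j k hne hjk

/-- The pointwise intertwining needs distinct coordinates in the open interval, which almost every
point of the cube has. -/
theorem aOp_toL2_propOp {N : ℕ} {xp xm : ℝ} (hJ : xp < xm) (γ : ℝ) (ε : Side) (μ : ℂ)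
    (f : CF N) :
    aOp hJ N γ ε μ (toL2 N xp xm (propOp γ N f))
      = toL2 N xp xm (propOp γ N (inter γ xp xm N ε μ f)) := by
  refine Lp.ext ?_
  filter_upwards [coeFn_aOp hJ N γ ε μ (toL2 N xp xm (propOp γ N f)),
    (isL2Bounded_aFun hJ.le N γ ε μ).congr _ _ (coeFn_toL2 xp xm (propOp γ N f)),
    coeFn_toL2 xp xm (propOp γ N (inter γ xp xm N ε μ f)), ae_injective N xp xm,
    ae_mem_Ioo N xp xm] with x h1 h2 h3 h4 h5
  rw [h1, h2, h3, aFun_propOp γ xp xm ε μ f h4 h5]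

theorem aOp_mem_zBar {N : ℕ} {xp xm : ℝ} (hJ : xp < xm) (γ : ℝ) (ε : Side) (μ : ℂ)
    {f : Sector N xp xm} (hf : f ∈ zBar N xp xm γ) : aOp hJ N γ ε μ f ∈ zBar N xp xm γ := by
  have h : zBar N xp xm γ ≤ (zBar N xp xm γ).comap (aOp hJ N γ ε μ : Sector N xp xm →ₗ[ℂ] _) := by
    refine Submodule.topologicalClosure_minimal _ (Submodule.span_le.2 ?_)
      ((Submodule.isClosed_topologicalClosure _).preimage (aOp hJ N γ ε μ).continuous)
    rintro _ ⟨lam, rfl⟩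
    change aOp hJ N γ ε μ (psiL2 xp xm γ lam) ∈ zBar N xp xm γ
    rw [← toL2_propOp_pw, aOp_toL2_propOp]
    exact toL2_propOp_mem_zBar xp xm γ _
  exact h hf

/-- The set where two bounded operators agree is a closed subspace, so the generators ψ_λ suffice;
there the commutation is that of the intertwiners. -/
theorem aOp_comm_of_mem_zBar {N : ℕ} {xp xm : ℝ} (hJ : xp < xm) (γ : ℝ) (ε : Side) (μ ν : ℂ)
    {f : Sector N xp xm} (hf : f ∈ zBar N xp xm γ) :
    aOp hJ N γ ε μ (aOp hJ N γ ε ν f) = aOp hJ N γ ε ν (aOp hJ N γ ε μ f) := by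
  set A := aOp hJ N γ ε μ
  set B := aOp hJ N γ ε ν
  have h : zBar N xp xm γ ≤ LinearMap.eqLocus (A.comp B : Sector N xp xm →ₗ[ℂ] Sector N xp xm)
      (B.comp A : Sector N xp xm →ₗ[ℂ] Sector N xp xm) := by
    refine Submodule.topologicalClosure_minimal _ (Submodule.span_le.2 ?_)
      (isClosed_eq (A.comp B).continuous (B.comp A).continuous)
    rintro _ ⟨lam, rfl⟩
    change A (B (psiL2 xp xm γ lam)) = B (A (psiL2 xp xm γ lam))
    rw [← toL2_propOp_pw, aOp_toL2_propOp, aOp_toL2_propOp, aOp_toL2_propOp, aOp_toL2_propOp]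
    exact congrArg (fun g : CF N => toL2 N xp xm (propOp γ N g))
      (inter_comm γ xp xm ε μ ν (pw lam))
  exact h hf

end QNLS

end

theorem mainTheorem6 (γ : ℝ) (N : ℕ) (xp xm : ℝ) (hJ : xp < xm) (ε : QNLS.Side) :
    (∀ μ : ℂ, ∀ f ∈ QNLS.zBar N xp xm γ,
      QNLS.aOp hJ N γ ε μ f ∈ QNLS.zBar N xp xm γ) ∧
    (∀ μ ν : ℂ, ∀ f ∈ QNLS.zBar N xp xm γ,
      QNLS.aOp hJ N γ ε μ (QNLS.aOp hJ N γ ε ν f) =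
        QNLS.aOp hJ N γ ε ν (QNLS.aOp hJ N γ ε μ f)) :=
  ⟨fun μ _ hf => QNLS.aOp_mem_zBar hJ γ ε μ hf,
    fun μ ν _ hf => QNLS.aOp_comm_of_mem_zBar hJ γ ε μ ν hf⟩
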